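/- **Setting.** Let $d\ge 2$, let $\Omega\subset\mathbb R^d$ be a lattice with fundamental domain $F$ of measure $1$, and let $\Gamma=\{\gamma\in\mathbb R^d:(\gamma,\omega)\in 2\pi\mathbb Z\ \ \forall\omega\in\Omega\}$ be the dual lattice. Put $$\varkappa=3^d+d+2,\quad \alpha=\tfrac1\varkappa,\quad \alpha_1=3\alpha,\quad s\ge \tfrac{3d-1}{2}(3^d+d+2)+\tfrac{d3^d}{4}+d+6,\quad p=s-d .$$ Let $q$ be a real-valued $\Omega$-periodic function in $W_2^s(F)$, i.e. $q\in L_2(F)$ and $\sum_{\gamma\in\Gamma}|q_\gamma|^2(1+|\gamma|^{2s})<\infty$ with $q_\gamma=\int_F q(x)e^{-i(\gamma,x)}dx$, and assume $\int_F q\,dx=0$. For $t\in\mathbb R^d$ let $L_t(q)$ be the self-adjoint operator in $L_2(F)$ generated by $-\Delta+q(x)$ and the conditions $u(x+\omega)=e^{i(t,\omega)}u(x)$, $\omega\in\Omega$. Let $\Lambda_N(t)$ denote its eigenvalues, $\Psi_{N,t}$ corresponding normalized eigenfunctions, and $b(N,\gamma)=\int_F\Psi_{N,t}(x)e^{-i(\gamma+t,x)}dx$.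 For $\rho>0$ put $R(\rho)=\{x\in\mathbb R^d:|x|<\rho\}$, $\Gamma(r)=\{\gamma\in\Gamma:0<|\gamma|<r\}$, $$V_{\gamma_1}(\rho^{\alpha_1})=\{x:\big||x|^2-|x+\gamma_1|^2\big|\le\rho^{\alpha_1}\}\cap\big(R(\tfrac32\rho)\setminus R(\tfrac12\rho)\big),$$ $$U(\rho^{\alpha_1},p)=\big(R(\tfrac32\rho)\setminus R(\tfrac12\rho)\big)\setminus\bigcup_{\gamma_1\in\Gamma(p\rho^\alpha)}V_{\gamma_1}(\rho^{\alpha_1}).$$ For $k\ge1$ let $$S_k(a,x)=\sum_{\gamma_1,\dots,\gamma_k}\frac{q_{\gamma_1}\cdots q_{\gamma_k}\,q_{-\gamma_1-\cdots-\gamma_k}}{\prod_{j=1}^k\big(a-|x-\sum_{i=1}^j\gamma_i|^2\big)},$$ the sum being over $\gamma_1,\dots,\gamma_k\in\Gamma(\rho^\alpha)$ with $\gamma_1+\cdots+\gamma_j\ne0$ for $j=1,\dots,k$, and define the (possibly complex-valued) corrections by $$F_0(x)=0,\qquad F_n(x)=\sum_{k=1}^n S_k\big(|x|^2+F_{n-1}(x),x\big)\quad(n\ge1).$$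 All $O(\cdot)$ are as $\rho\to\infty$, with constants, and a threshold for $\rho$, that do not depend on $\rho$, $t$, $\gamma$, $N$. $[a]$ is the integer part of $a$. **Theorem 2.1.** (a) One has $$F_1(x)=\sum_{\gamma_1\in\Gamma(\rho^\alpha)}\frac{|q_{\gamma_1}|^2}{|x|^2-|x-\gamma_1|^2},$$ and, for $x\in U(\rho^{\alpha_1},p)$, $F_k(x)=O(\rho^{-\alpha_1})$ for all integers $0\le k\le p$. Let $0\le c<p-\frac14 d3^d$ and $c_5>0$. If $\gamma\in\Gamma$, $\gamma+t\in U(\rho^{\alpha_1},p)$, and $$\big|\Lambda_N(t)-|\gamma+t|^2\big|<\tfrac12\rho^{\alpha_1},\qquad |b(N,\gamma)|>c_5\rho^{-c\alpha},$$ then $$\Lambda_N(t)=|\gamma+t|^2+F_{k-1}(\gamma+t)+O\big(|\gamma+t|^{-k\alpha_1}\big)\qquad(\ast)$$ for $k=1,2,\dots,[\frac13(p-c)]$. (b) For all sufficiently large $\rho$ and every vector $\gamma+t\in U(\rho^{\alpha_1},p)$ (with $\gamma\in\Gamma$) there is an eigenvalue $\Lambda_N(t)$ of $L_t(q)$ that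 satisfies $(\ast)$ for all $k=1,2,\dots,[\frac13(p-\frac12\varkappa(d-1))]$. -/

import Mathlib

open MeasureTheory

noncomputable section

namespace PeriodicSchrodinger

/-- `ℝ^d` with its Euclidean norm and inner product. -/
abbrev Space (d : ℕ) : Type := EuclideanSpace ℝ (Fin d)

variable {d : ℕ}

/-- The plane wave `x ↦ e^{i⟨v, x⟩}`. -/
def planeWave (v x : Space d) : ℂ := Complex.exp (Complex.I * ((inner ℝ v x : ℝ) : ℂ))

/-- The dual lattice `{γ : ⟨γ, ω⟩ ∈ 2πℤ for all ω ∈ Ω}`. -/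
def dualLattice (Ω : Submodule ℤ (Space d)) : AddSubgroup (Space d) where
  carrier := {γ | ∀ ω ∈ Ω, ∃ n : ℤ, (inner ℝ γ ω : ℝ) = 2 * Real.pi * n}
  zero_mem' := fun ω _ => ⟨0, by simp⟩
  add_mem' := by
    intro a b ha hb ω hω
    obtain ⟨m, hm⟩ := ha ω hω
    obtain ⟨n, hn⟩ := hb ω hω
    exact ⟨m + n, by rw [inner_add_left, hm, hn]; push_cast; ring⟩
  neg_mem' := by
    intro a ha ω hω
    obtain ⟨m, hm⟩ := ha ω hω
    exact ⟨-m, by rw [inner_neg_left, hm]; push_cast; ring⟩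

/-- `{γ ∈ Γ : 0 < |γ| < r}`, where `Γ` is the dual lattice of `Ω`. -/
def dualBall (Ω : Submodule ℤ (Space d)) (r : ℝ) : Set (Space d) :=
  {γ | γ ∈ dualLattice Ω ∧ 0 < ‖γ‖ ∧ ‖γ‖ < r}

theorem dualBall_finite (Ω : Submodule ℤ (Space d)) [DiscreteTopology Ω] [IsZLattice ℝ Ω]
    (r : ℝ) : (dualBall Ω r).Finite := by
  classical
  let b₀ := Module.Free.chooseBasis ℤ Ω
  let b := b₀.ofZLatticeBasis ℝ Ω
  let φ : Space d → (Module.Free.ChooseBasisIndex ℤ Ω → ℝ) := fun γ i => inner ℝ γ (b i)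
  have hbΩ : ∀ i, b i ∈ Ω := fun i => by
    rw [Module.Basis.ofZLatticeBasis_apply]; exact (b₀ i).2
  have hinj : Function.Injective φ := by
    intro x y hxy
    have h0 : ∀ i, inner ℝ (x - y) (b i) = 0 := fun i => by
      rw [inner_sub_left, sub_eq_zero]; exact congrFun hxy i
    have hsum : inner ℝ (x - y) (x - y) = 0 := by
      nth_rewrite 2 [← b.sum_repr (x - y)]
      simp [inner_sum, inner_smul_right, h0]
    exact sub_eq_zero.1 (inner_self_eq_zero.1 hsum)
  let N : Module.Free.ChooseBasisIndex ℤ Ω → ℤ := fun i => ⌈r * ‖b i‖ / (2 * Real.pi)⌉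
  have hfin : (Set.pi Set.univ
      (fun i => (fun n : ℤ => 2 * Real.pi * (n : ℝ)) '' Set.Icc (-(N i)) (N i))).Finite :=
    Set.Finite.pi fun i => (Set.finite_Icc _ _).image _
  refine Set.Finite.of_finite_image (hfin.subset ?_) hinj.injOn
  rintro _ ⟨γ, ⟨hγ, _, hr⟩, rfl⟩ i _
  obtain ⟨n, hn⟩ := hγ (b i) (hbΩ i)
  have hpi : (0 : ℝ) < 2 * Real.pi := by positivity
  have h1 : |2 * Real.pi * (n : ℝ)| ≤ r * ‖b i‖ := by
    rw [← hn]
    exact (abs_real_inner_le_norm _ _).trans (by gcongr)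
  have h2 : |(n : ℝ)| ≤ r * ‖b i‖ / (2 * Real.pi) := by
    rw [le_div_iff₀ hpi]
    rw [abs_mul, abs_of_pos hpi] at h1
    linarith
  have h3 : |(n : ℝ)| ≤ (N i : ℝ) := h2.trans (Int.le_ceil _)
  have h4 := abs_le.1 h3
  exact ⟨n, ⟨by exact_mod_cast h4.1, by exact_mod_cast h4.2⟩, hn.symm⟩

/-- The finite set `{γ ∈ Γ : 0 < |γ| < r}` as a `Finset`. -/
def dualBallFinset (Ω : Submodule ℤ (Space d)) [DiscreteTopology Ω] [IsZLattice ℝ Ω]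
    (r : ℝ) : Finset (Space d) := (dualBall_finite Ω r).toFinset

/-- The `L²(F)` pairing `(f, e^{i⟨v, ·⟩}) = ∫_F f(x) e^{-i⟨v, x⟩} dx`. -/
def planeCoeff (F : Set (Space d)) (f : Space d → ℂ) (v : Space d) : ℂ :=
  ∫ x in F, f x * (starRingEnd ℂ) (planeWave v x)

/-- The Fourier coefficient `q_γ` of a real potential. -/
def potCoeff (F : Set (Space d)) (q : Space d → ℝ) (γ : Space d) : ℂ :=
  planeCoeff F (fun x => (q x : ℂ)) γ

/-- A real `Ω`-periodic `q` of class `W_2^s(ℝ^d / Ω)`: it is square integrable over the fundamental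
domain `F` and `∑_{γ ∈ Γ} |q_γ|² (1 + |γ|^{2s}) < ∞`. -/
structure IsSobolevPotential (Ω : Submodule ℤ (Space d)) (F : Set (Space d)) (s : ℝ)
    (q : Space d → ℝ) : Prop where
  periodic : ∀ ω ∈ Ω, ∀ x, q (x + ω) = q x
  memLp : MemLp q 2 (volume.restrict F)
  summable : Summable fun γ : dualLattice Ω =>
    ‖potCoeff F q (γ : Space d)‖ ^ 2 * (1 + ‖(γ : Space d)‖ ^ (2 * s))

/-- The quasiperiodic condition `u(x + ω) = e^{i⟨t, ω⟩} u(x)` for all `ω ∈ Ω`. -/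
def IsQuasiperiodic (Ω : Submodule ℤ (Space d)) (t : Space d) (u : Space d → ℂ) : Prop :=
  ∀ ω ∈ Ω, ∀ x, u (x + ω) = planeWave t ω * u x

/-- `u` lies in the domain of `L_t(q)` and `L_t(q) u = f`. Here `L_t(q)` is the self-adjoint operator
generated in `L²(F)` by `-Δ + q` and the quasiperiodic conditions: `-Δ + q` on smooth
quasiperiodic functions is essentially self-adjoint, and its closure is its adjoint, which is
written out below by means of smooth quasiperiodic test functions `φ`. -/
structure BlochOperatorEq (Ω : Submodule ℤ (Space d)) (F : Set (Space d)) (q : Space d → ℝ)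
    (t : Space d) (u f : Space d → ℂ) : Prop where
  quasiperiodic : IsQuasiperiodic Ω t u
  memLp : MemLp u 2 (volume.restrict F)
  quasiperiodic_image : IsQuasiperiodic Ω t f
  memLp_image : MemLp f 2 (volume.restrict F)
  weak_eq : ∀ φ : Space d → ℂ, ContDiff ℝ (⊤ : ℕ∞) φ → IsQuasiperiodic Ω t φ →
    ∫ x in F, u x * (starRingEnd ℂ) (-(Laplacian.laplacian φ x) + (q x : ℂ) * φ x)
      = ∫ x in F, f x * (starRingEnd ℂ) (φ x)

/-- `Ψ` is a normalized eigenfunction of `L_t(q)` with eigenvalue `Λ`. -/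
structure IsBlochEigenfunction (Ω : Submodule ℤ (Space d)) (F : Set (Space d))
    (q : Space d → ℝ) (t : Space d) (Λ : ℝ) (Ψ : Space d → ℂ) : Prop where
  eigen_eq : BlochOperatorEq Ω F q t Ψ (fun x => (Λ : ℂ) * Ψ x)
  normalized : ∫ x in F, ‖Ψ x‖ ^ 2 = 1

/-- `Λ` is an eigenvalue of `L_t(q)`. -/
def IsBlochEigenvalue (Ω : Submodule ℤ (Space d)) (F : Set (Space d))
    (q : Space d → ℝ) (t : Space d) (Λ : ℝ) : Prop :=
  ∃ Ψ : Space d → ℂ, IsBlochEigenfunction Ω F q t Λ Ψ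

/-- `ϰ = 3^d + d + 2`. -/
def kap (d : ℕ) : ℝ := 3 ^ d + d + 2

/-- `α = 1 / ϰ`. -/
def alph (d : ℕ) : ℝ := 1 / kap d

/-- `α₁ = 3 α`. -/
def alphOne (d : ℕ) : ℝ := 3 * alph d

/-- The smoothness threshold `s₀`. -/
def sZero (d : ℕ) : ℝ :=
  (3 * d - 1) / 2 * (3 ^ d + d + 2) + d * 3 ^ d / 4 + d + 6

/-- The spherical shell `{x : ρ/2 ≤ |x| < 3ρ/2}`. -/
def shell (d : ℕ) (ρ : ℝ) : Set (Space d) :=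
  Metric.ball 0 (3 / 2 * ρ) \ Metric.ball 0 (1 / 2 * ρ)

/-- The resonance domain `V_γ(ρ^{α₁})`. -/
def resonanceDomain (ρ : ℝ) (γ : Space d) : Set (Space d) :=
  {x | |‖x‖ ^ 2 - ‖x + γ‖ ^ 2| ≤ ρ ^ alphOne d} ∩ shell d ρ

/-- The non-resonance domain `U(ρ^{α₁}, p)`. -/
def nonResonanceDomain (Ω : Submodule ℤ (Space d)) (ρ p : ℝ) : Set (Space d) :=
  shell d ρ \ ⋃ γ ∈ dualBall Ω (p * ρ ^ alph d), resonanceDomain ρ γ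

open Classical in
/-- The iterated sum `S_k(a, x)`: the sum over `(γ₁, …, γ_k)` with `γ_i ∈ Γ`, `0 < |γ_i| < ρ^α`
and all partial sums `γ₁ + ⋯ + γ_j` non-zero, of
`q_{γ₁} ⋯ q_{γ_k} q_{-γ₁-⋯-γ_k} / ∏_{j=1}^k (a - |x - γ₁ - ⋯ - γ_j|²)`. -/
def iterSum (Ω : Submodule ℤ (Space d)) [DiscreteTopology Ω] [IsZLattice ℝ Ω]
    (F : Set (Space d)) (q : Space d → ℝ) (ρ : ℝ) (k : ℕ) (a : ℂ) (x : Space d) : ℂ :=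
  ∑ g ∈ (Fintype.piFinset fun _ : Fin k => dualBallFinset Ω (ρ ^ alph d)).filter
      (fun g => ∀ j : Fin k, ∑ i ∈ Finset.Iic j, g i ≠ 0),
    ((∏ i, potCoeff F q (g i)) * potCoeff F q (-∑ i, g i)) /
      ∏ j : Fin k, (a - ((‖x - ∑ i ∈ Finset.Iic j, g i‖ ^ 2 : ℝ) : ℂ))

/-- The corrections: `F_0 = 0` and `F_s(x) = ∑_{k=1}^s S_k(|x|² + F_{s-1}(x), x)` for `s ≥ 1`. -/
def correction (Ω : Submodule ℤ (Space d)) [DiscreteTopology Ω] [IsZLattice ℝ Ω]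
    (F : Set (Space d)) (q : Space d → ℝ) (ρ : ℝ) : ℕ → Space d → ℂ
  | 0, _ => 0
  | s + 1, x => ∑ k ∈ Finset.Icc 1 (s + 1),
      iterSum Ω F q ρ k (((‖x‖ ^ 2 : ℝ) : ℂ) + correction Ω F q ρ s x) x

end PeriodicSchrodinger

end

open PeriodicSchrodinger

/-!
Tested against the plane wave `e^{i⟨γ + t, ·⟩}`, the eigenvalue equation becomes the binding formula
`(Λ - |γ + t|²) b(γ) = ∑_{γ'} q_{γ'} b(γ - γ')` for the Fourier coefficients `b` of the
eigenfunction (`IsBlochEigenfunction.binding`). Smoothness of `q` makes the terms with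
`|γ'| ≥ ρ^α` negligible, of size `O(ρ^{-pα})`.

*Asymptotics.* Solve the binding formula at `γ - γ'` for `b(γ - γ')`, substitute, and iterate. Each
time the path of lattice steps returns to its origin, a multiple of `b(γ)` splits off, and what has
split off after `m` steps is `b(γ) ∑_{j ≤ m} S_j(Λ, γ + t)`. For `γ + t` in the non-resonance domain
and fewer than `p` steps all denominators are at least `ρ^{α₁} / 2`, so that each step gains a
factor `θ = O(ρ^{-α₁})` (`norm_sub_sum_pathStep_le`). Division by `b(γ)`, which is not too small,
leaves `Λ = |γ + t|² + ∑_j S_j(Λ, γ + t) + O(θ^K)`. The corrections `F_k` are the successive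
approximations to the solution of this equation. Since `∑_j S_j` is Lipschitz in `Λ` with a constant
`O(θ²)`, they converge at the stated rate (`norm_sub_correction_le`).

*Existence.* In the Fourier basis the operator is the infinite matrix `|γ + t|² δ + q_{γ - γ'}`, a
diagonal matrix plus a bounded Hermitian convolution. In a finite section of it, at least half of
the unit mass at `γ` is carried by eigenvectors whose eigenvalue lies in a window of width
`O(ρ^{α₁})` about `|γ + t|²`. Such an eigenvector is concentrated on the lattice points in a thin
spherical shell. There are `O(ρ^{d-1})` of these points (`exists_card_shell_le`), hence
`O(ρ^{d-1})` such eigenvectors, and one of them has `|b(γ)|² ≥ c ρ^{-(d-1)}`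
(`exists_eigenvector_finite_section`). This bound survives the passage to the limit over all
finite sections along an ultrafilter, where only compactness of bounded sets of numbers is used
(`exists_eigenvector_convolution`). The limit vector solves the eigenvalue equation, so its
coefficients decay fast (`exists_decay_of_eigenvector`), and its plane wave series is an
eigenfunction (`isBlochEigenfunction_planeSeries`), to which the asymptotics apply with
`c = ϰ (d - 1) / 2`.

That functions on `F` are determined by their Fourier coefficients is reduced to the
completeness of the exponentials on the standard torus (`ae_eq_zero_of_planeCoeff_eq_zero`).
-/

namespace PeriodicSchrodinger

/-! ### Sums over paths in the lattice -/

section Paths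

variable {V : Type*} [AddCommGroup V]

open Classical in
/-- One step of the path sum: `f` is transported along the steps `γ ∈ B` with weight
`w γ / D (σ + γ)`, and paths that return to `0` are discarded. The sums `S_k` are values of its
iterates at `0`. -/
noncomputable def pathStep (B : Finset V) (w D : V → ℂ) (f : V → ℂ) (σ : V) : ℂ :=
  ∑ γ ∈ B with σ + γ ≠ 0, w γ / D (σ + γ) * f (σ + γ)

theorem pathStep_add (B : Finset V) (w D f g : V → ℂ) :
    pathStep B w D (f + g) = pathStep B w D f + pathStep B w D g := by
  funext σ
  simp [pathStep, mul_add, Finset.sum_add_distrib]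

theorem pathStep_smul (B : Finset V) (w D f : V → ℂ) (c : ℂ) :
    pathStep B w D (c • f) = c • pathStep B w D f := by
  funext σ
  simp only [pathStep, Pi.smul_apply, smul_eq_mul, Finset.mul_sum]
  exact Finset.sum_congr rfl fun _ _ => by ring

theorem pathStep_iterate_add (B : Finset V) (w D f g : V → ℂ) (k : ℕ) :
    (pathStep B w D)^[k] (f + g) = (pathStep B w D)^[k] f + (pathStep B w D)^[k] g := by
  induction k with
  | zero => rfl
  | succ k ih => simp only [Function.iterate_succ_apply', ih, pathStep_add]

theorem pathStep_iterate_smul (B : Finset V) (w D f : V → ℂ) (c : ℂ) (k : ℕ) :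
    (pathStep B w D)^[k] (c • f) = c • (pathStep B w D)^[k] f := by
  induction k with
  | zero => rfl
  | succ k ih => simp only [Function.iterate_succ_apply', ih, pathStep_smul]

open Classical in
/-- The iterates of `pathStep`, written as sums over all tuples of steps. -/
theorem sum_paths_eq_pathStep_iterate (B : Finset V) (w D f : V → ℂ) (k : ℕ) (σ : V) :
    ∑ g ∈ (Fintype.piFinset fun _ : Fin k => B).filter
        (fun g => ∀ j : Fin k, σ + ∑ i ∈ Finset.Iic j, g i ≠ 0),
      ((∏ i, w (g i)) * f (σ + ∑ i, g i)) / ∏ j : Fin k, D (σ + ∑ i ∈ Finset.Iic j, g i)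
      = (pathStep B w D)^[k] f σ := by
  induction k generalizing σ with
  | zero => simp
  | succ k ih =>
    have hIic0 : ∀ (g : Fin (k + 1) → V), ∑ i ∈ Finset.Iic (0 : Fin (k + 1)), g i = g 0 := by
      intro g
      have : Finset.Iic (0 : Fin (k + 1)) = {0} := by
        ext i; simp
      rw [this, Finset.sum_singleton]
    have hIicS : ∀ (g : Fin (k + 1) → V) (j : Fin k),
        ∑ i ∈ Finset.Iic j.succ, g i = g 0 + ∑ i ∈ Finset.Iic j, g i.succ := by
      intro g j
      have : Finset.Iic j.succ = insert 0 ((Finset.Iic j).map (Fin.succEmb k)) := by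
        ext i
        refine Fin.cases ?_ (fun i => ?_) i
        · simp
        · simp
      rw [this, Finset.sum_insert (by simp), Finset.sum_map]
      simp
    rw [Function.iterate_succ_apply']
    simp only [pathStep]
    simp_rw [← ih, Finset.mul_sum]
    rw [Finset.sum_sigma']
    refine Finset.sum_bij' (fun g _ => ⟨g 0, Fin.tail g⟩) (fun p _ => Fin.cons p.1 p.2)
      ?_ ?_ ?_ ?_ ?_
    · intro g hg
      simp only [Finset.mem_filter, Fintype.mem_piFinset] at hg
      simp only [Finset.mem_sigma, Finset.mem_filter, Fintype.mem_piFinset, Fin.tail]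
      refine ⟨⟨hg.1 0, by have := hg.2 0; rwa [hIic0] at this⟩, fun i => hg.1 i.succ, fun j => ?_⟩
      have := hg.2 j.succ
      rwa [hIicS, ← add_assoc] at this
    · intro p hp
      simp only [Finset.mem_sigma, Finset.mem_filter, Fintype.mem_piFinset] at hp
      simp only [Finset.mem_filter, Fintype.mem_piFinset]
      refine ⟨fun i => ?_, fun j => ?_⟩
      · refine Fin.cases ?_ (fun i => ?_) i
        · simpa using hp.1.1
        · simpa using hp.2.1 i
      · refine Fin.cases ?_ (fun j => ?_) j
        · rw [hIic0]; simpa using hp.1.2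
        · rw [hIicS, ← add_assoc]; simpa using hp.2.2 j
    · intro g _; simp
    · intro p _; simp
    · intro g _
      simp only [Fin.prod_univ_succ, Fin.sum_univ_succ, hIic0, hIicS, Fin.tail, add_assoc]
      rw [div_mul_div_comm]
      congr 1
      ring

variable {B : Finset V} {w : V → ℂ} {S : ℕ → Set V} {δ M : ℝ}

/-- Bounds for path sums are proved along sets `S k`, thought of as the points from which `k` further
steps are possible with all denominators at least `δ` in norm. -/
theorem norm_pathStep_le {D : V → ℂ} (hδ : 0 < δ) (hM : ∑ γ ∈ B, ‖w γ‖ ≤ M) {k : ℕ}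
    (hS : ∀ k, ∀ σ ∈ S (k + 1), ∀ γ ∈ B, σ + γ ∈ S k ∧ (σ + γ ≠ 0 → δ ≤ ‖D (σ + γ)‖))
    {f : V → ℂ} {A : ℝ} (hA : 0 ≤ A) (hf : ∀ σ ∈ S k, ‖f σ‖ ≤ A) {σ : V} (hσ : σ ∈ S (k + 1)) :
    ‖pathStep B w D f σ‖ ≤ M / δ * A := by
  classical
  calc ‖pathStep B w D f σ‖ ≤ ∑ γ ∈ B with σ + γ ≠ 0, ‖w γ‖ / δ * A := by
        refine norm_sum_le_of_le _ fun γ hγ => ?_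
        rw [Finset.mem_filter] at hγ
        obtain ⟨h1, h2⟩ := hS k σ hσ γ hγ.1
        rw [norm_mul, norm_div]
        have := h2 hγ.2
        gcongr
        exact hf _ h1
    _ ≤ ∑ γ ∈ B, ‖w γ‖ / δ * A :=
        Finset.sum_le_sum_of_subset_of_nonneg (Finset.filter_subset _ _)
          fun _ _ _ => by positivity
    _ = (∑ γ ∈ B, ‖w γ‖) / δ * A := by rw [Finset.sum_div, Finset.sum_mul]
    _ ≤ M / δ * A := by gcongr

theorem norm_pathStep_iterate_le {D : V → ℂ} (hδ : 0 < δ) (hM : ∑ γ ∈ B, ‖w γ‖ ≤ M)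
    (hS : ∀ k, ∀ σ ∈ S (k + 1), ∀ γ ∈ B, σ + γ ∈ S k ∧ (σ + γ ≠ 0 → δ ≤ ‖D (σ + γ)‖))
    {f : V → ℂ} {A : ℝ} (hA : 0 ≤ A) (hf : ∀ σ ∈ S 0, ‖f σ‖ ≤ A) (k : ℕ) {σ : V} (hσ : σ ∈ S k) :
    ‖(pathStep B w D)^[k] f σ‖ ≤ (M / δ) ^ k * A := by
  have hM0 : 0 ≤ M := (Finset.sum_nonneg fun _ _ => norm_nonneg _).trans hM
  induction k generalizing σ with
  | zero => simpa using hf σ hσ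
  | succ k ih =>
    rw [Function.iterate_succ_apply', pow_succ', mul_assoc]
    exact norm_pathStep_le hδ hM hS (by positivity) (fun τ hτ => ih hτ) hσ

/-- The iterated path sums are Lipschitz in the denominators. -/
theorem norm_pathStep_iterate_sub_le {D D' : V → ℂ} (hδ : 0 < δ) (hM : ∑ γ ∈ B, ‖w γ‖ ≤ M)
    (hS : ∀ k, ∀ σ ∈ S (k + 1), ∀ γ ∈ B, σ + γ ∈ S k ∧ (σ + γ ≠ 0 → δ ≤ ‖D (σ + γ)‖))
    (hS' : ∀ k, ∀ σ ∈ S (k + 1), ∀ γ ∈ B, σ + γ ∈ S k ∧ (σ + γ ≠ 0 → δ ≤ ‖D' (σ + γ)‖))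
    {η : ℝ} (hη : ∀ σ, ‖D σ - D' σ‖ ≤ η)
    {f : V → ℂ} {A : ℝ} (hA : 0 ≤ A) (hf : ∀ σ ∈ S 0, ‖f σ‖ ≤ A) (k : ℕ) {σ : V} (hσ : σ ∈ S k) :
    ‖(pathStep B w D)^[k] f σ - (pathStep B w D')^[k] f σ‖ ≤ k * (M / δ) ^ k * A * (η / δ) := by
  classical
  have hM0 : 0 ≤ M := (Finset.sum_nonneg fun _ _ => norm_nonneg _).trans hM
  have hη0 : 0 ≤ η := (norm_nonneg _).trans (hη 0)
  induction k generalizing σ with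
  | zero => simp
  | succ k ih =>
    rw [Function.iterate_succ_apply', Function.iterate_succ_apply']
    set u := (pathStep B w D)^[k] f
    set u' := (pathStep B w D')^[k] f with hu'
    have h1 : ‖pathStep B w D (u + (-1 : ℂ) • u') σ‖ ≤ M / δ * (k * (M / δ) ^ k * A * (η / δ)) := by
      refine norm_pathStep_le hδ hM hS (by positivity) (fun τ hτ => ?_) hσ
      have := ih hτ
      simpa [← sub_eq_add_neg] using this
    have h2 : ‖pathStep B w D u' σ - pathStep B w D' u' σ‖
        ≤ M / δ * ((M / δ) ^ k * A * (η / δ)) := by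
      unfold pathStep
      rw [← Finset.sum_sub_distrib]
      calc _ ≤ ∑ γ ∈ B with σ + γ ≠ 0, ‖w γ‖ / δ * ((M / δ) ^ k * A * (η / δ)) := by
            refine norm_sum_le_of_le _ fun γ hγ => ?_
            rw [Finset.mem_filter] at hγ
            obtain ⟨h1, h2⟩ := hS k σ hσ γ hγ.1
            obtain ⟨-, h3⟩ := hS' k σ hσ γ hγ.1
            have h2 := h2 hγ.2
            have h3 := h3 hγ.2
            have hD : D (σ + γ) ≠ 0 := norm_pos_iff.1 (hδ.trans_le h2)
            have hD' : D' (σ + γ) ≠ 0 := norm_pos_iff.1 (hδ.trans_le h3)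
            have e : w γ / D (σ + γ) * u' (σ + γ) - w γ / D' (σ + γ) * u' (σ + γ)
                = w γ / D (σ + γ) * (u' (σ + γ) * ((D' (σ + γ) - D (σ + γ)) / D' (σ + γ))) := by
              field_simp
            rw [e, norm_mul, norm_mul, norm_div, norm_div, norm_sub_rev]
            have h4 := norm_pathStep_iterate_le hδ hM hS' hA hf k h1
            rw [← hu'] at h4
            have h5 := hη (σ + γ)
            gcongr
        _ ≤ ∑ γ ∈ B, ‖w γ‖ / δ * ((M / δ) ^ k * A * (η / δ)) :=
            Finset.sum_le_sum_of_subset_of_nonneg (Finset.filter_subset _ _)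
              fun _ _ _ => by positivity
        _ = (∑ γ ∈ B, ‖w γ‖) / δ * ((M / δ) ^ k * A * (η / δ)) := by
            rw [Finset.sum_div, Finset.sum_mul]
        _ ≤ _ := by gcongr
    rw [pathStep_add, pathStep_smul] at h1
    calc ‖pathStep B w D u σ - pathStep B w D' u' σ‖
        = ‖(pathStep B w D u + (-1 : ℂ) • pathStep B w D u') σ
          + (pathStep B w D u' σ - pathStep B w D' u' σ)‖ := by
          congr 1; simp only [Pi.add_apply, Pi.smul_apply, smul_eq_mul]; ring
      _ ≤ _ := (norm_add_le _ _).trans (add_le_add h1 h2)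
      _ = _ := by push_cast; ring

open Classical in
/-- Unrolling the binding formula `D σ * β σ = ∑ w γ * β (σ + γ) + e σ`: each `β (σ + γ)` is
replaced by the right-hand side of the formula at `σ + γ`, the term containing `β 0` is split off,
and the rest is treated in the same way. -/
theorem pathStep_unroll {D : V → ℂ} (hδ : 0 < δ)
    (hS : ∀ k, ∀ σ ∈ S (k + 1), ∀ γ ∈ B, σ + γ ∈ S k ∧ (σ + γ ≠ 0 → δ ≤ ‖D (σ + γ)‖))
    (hanti : Antitone S) {β e h e' : V → ℂ}
    (hβ : ∀ σ ∈ S 0, D σ * β σ = ∑ γ ∈ B, w γ * β (σ + γ) + e σ)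
    (hh : ∀ σ, h σ = ∑ γ ∈ B with σ + γ ≠ 0, w γ * β (σ + γ))
    (he' : ∀ σ, e' σ = e σ - if -σ ∈ B then 0 else β 0 * w (-σ)) (k : ℕ) {σ : V} (hσ : σ ∈ S k) :
    h σ = ∑ j ∈ Finset.Icc 1 k,
        (pathStep B w D)^[j] (β 0 • (fun τ => w (-τ)) + e') σ + (pathStep B w D)^[k] h σ := by
  set g : V → ℂ := β 0 • (fun τ => w (-τ)) + e' with hg
  have hstep : ∀ σ ∈ S 1, h σ = pathStep B w D (g + h) σ := by
    intro σ hσ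
    rw [hh, pathStep]
    refine Finset.sum_congr rfl fun γ hγ => ?_
    rw [Finset.mem_filter] at hγ
    obtain ⟨h1, h2⟩ := hS 0 σ hσ γ hγ.1
    have hD : D (σ + γ) ≠ 0 := norm_pos_iff.1 (hδ.trans_le (h2 hγ.2))
    have hsplit : ∑ γ' ∈ B, w γ' * β (σ + γ + γ')
        = h (σ + γ) + if -(σ + γ) ∈ B then β 0 * w (-(σ + γ)) else 0 := by
      rw [hh, ← Finset.sum_filter_add_sum_filter_not B (fun γ' => σ + γ + γ' ≠ 0)]
      congr 1
      have : (B.filter fun γ' => ¬ (σ + γ + γ' ≠ 0)) = if -(σ + γ) ∈ B then {-(σ + γ)} else ∅ := by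
        ext τ
        simp only [Finset.mem_filter, not_not, add_eq_zero_iff_eq_neg']
        split_ifs with hc
        · simp only [Finset.mem_singleton]
          exact ⟨fun hτ => hτ.2, fun hτ => ⟨hτ ▸ hc, hτ⟩⟩
        · simp only [Finset.notMem_empty, iff_false]
          rintro ⟨h3, rfl⟩
          exact hc h3
      rw [this]
      split_ifs
      · simp [mul_comm]
      · simp
    have h4 := hβ _ h1
    rw [hsplit] at h4
    have h5 : (g + h) (σ + γ) = D (σ + γ) * β (σ + γ) := by
      rw [h4]
      simp only [hg, Pi.add_apply, Pi.smul_apply, smul_eq_mul, he']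
      split_ifs <;> ring
    rw [h5]
    field_simp
  induction k generalizing σ with
  | zero => simp
  | succ k ih =>
    rw [hstep σ (hanti (by omega) hσ), pathStep_add, Finset.sum_Icc_succ_top (by omega)]
    have hsum : ∑ j ∈ Finset.Icc 1 k, (pathStep B w D)^[j + 1] g σ + (pathStep B w D)^[k + 1] h σ
        = pathStep B w D h σ := by
      simp only [Function.iterate_succ_apply', pathStep]
      rw [Finset.sum_comm, ← Finset.sum_add_distrib]
      refine Finset.sum_congr rfl fun γ hγ => ?_
      rw [← Finset.mul_sum, ← mul_add, ← ih (hS k σ hσ γ (Finset.mem_filter.1 hγ).1).1]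
    have hshift : ∑ j ∈ Finset.Icc 1 k, (pathStep B w D)^[j] g σ + (pathStep B w D)^[k + 1] g σ
        = pathStep B w D g σ + ∑ j ∈ Finset.Icc 1 k, (pathStep B w D)^[j + 1] g σ := by
      clear ih hσ hsum
      induction k with
      | zero => simp
      | succ k ihk =>
        rw [Finset.sum_Icc_succ_top (by omega), Finset.sum_Icc_succ_top (by omega), ihk]
        ring
    rw [hshift, Pi.add_apply, ← hsum]
    ring

/-- The binding formula after `m` iterations: only multiples of `β 0` and small terms are left. -/
theorem norm_sub_sum_pathStep_le {D : V → ℂ} (hδ : 0 < δ) (hM : ∑ γ ∈ B, ‖w γ‖ ≤ M)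
    (hMδ : M ≤ δ) (hB : (0 : V) ∉ B)
    (hS : ∀ k, ∀ σ ∈ S (k + 1), ∀ γ ∈ B, σ + γ ∈ S k ∧ (σ + γ ≠ 0 → δ ≤ ‖D (σ + γ)‖))
    (hanti : Antitone S) {β e : V → ℂ} {ε : ℝ}
    (hβ : ∀ σ ∈ S 0, D σ * β σ = ∑ γ ∈ B, w γ * β (σ + γ) + e σ)
    (hβ1 : ∀ σ, ‖β σ‖ ≤ 1) (he : ∀ σ ∈ S 0, ‖e σ‖ ≤ ε)
    (hw : ∀ σ ∈ S 0, -σ ∉ B → ‖w (-σ)‖ ≤ ε) {m : ℕ} (h0 : (0 : V) ∈ S m) :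
    ‖D 0 * β 0 - β 0 * ∑ j ∈ Finset.Icc 1 m, (pathStep B w D)^[j] (fun τ => w (-τ)) 0‖
      ≤ (2 * m + 1) * ε + (M / δ) ^ m * M := by
  classical
  have hM0 : 0 ≤ M := (Finset.sum_nonneg fun _ _ => norm_nonneg _).trans hM
  have hε : 0 ≤ ε := (norm_nonneg _).trans (he 0 (hanti (Nat.zero_le _) h0))
  set h : V → ℂ := fun σ => ∑ γ ∈ B with σ + γ ≠ 0, w γ * β (σ + γ) with hh
  set e' : V → ℂ := fun σ => e σ - if -σ ∈ B then 0 else β 0 * w (-σ) with he'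
  have hun := pathStep_unroll hδ hS hanti hβ (h := h) (e' := e') (fun _ => rfl) (fun _ => rfl) m h0
  have hhb : ∀ σ, ‖h σ‖ ≤ M := by
    intro σ
    calc ‖h σ‖ ≤ ∑ γ ∈ B with σ + γ ≠ 0, ‖w γ‖ := by
          refine norm_sum_le_of_le _ fun γ _ => ?_
          rw [norm_mul]
          exact mul_le_of_le_one_right (norm_nonneg _) (hβ1 _)
      _ ≤ ∑ γ ∈ B, ‖w γ‖ :=
          Finset.sum_le_sum_of_subset_of_nonneg (Finset.filter_subset _ _)
            fun _ _ _ => by positivity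
      _ ≤ M := hM
  have heb : ∀ σ ∈ S 0, ‖e' σ‖ ≤ 2 * ε := by
    intro σ hσ
    have h1 := he σ hσ
    simp only [he']
    split_ifs with hc
    · rw [sub_zero]; linarith
    · have h2 : ‖β 0 * w (-σ)‖ ≤ ε := by
        rw [norm_mul]
        have := hw σ hσ hc
        nlinarith [hβ1 0, norm_nonneg (β 0), norm_nonneg (w (-σ))]
      linarith [norm_sub_le (e σ) (β 0 * w (-σ))]
  have h00 : D 0 * β 0 = h 0 + e 0 := by
    rw [hβ 0 (hanti (Nat.zero_le _) h0)]
    congr 1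
    simp only [hh, zero_add]
    rw [Finset.filter_true_of_mem]
    intro γ hγ h
    exact hB (h ▸ hγ)
  have key : D 0 * β 0 - β 0 * ∑ j ∈ Finset.Icc 1 m, (pathStep B w D)^[j] (fun τ => w (-τ)) 0
      = e 0 + ∑ j ∈ Finset.Icc 1 m, (pathStep B w D)^[j] e' 0 + (pathStep B w D)^[m] h 0 := by
    rw [h00, hun]
    simp only [pathStep_iterate_add, pathStep_iterate_smul, Pi.add_apply, Pi.smul_apply,
      smul_eq_mul, Finset.sum_add_distrib, Finset.mul_sum]
    ring
  rw [key]
  have hθ : M / δ ≤ 1 := by rwa [div_le_one hδ]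
  have hθ0 : 0 ≤ M / δ := by positivity
  have h1 : ‖∑ j ∈ Finset.Icc 1 m, (pathStep B w D)^[j] e' 0‖ ≤ m * (2 * ε) := by
    calc _ ≤ ∑ j ∈ Finset.Icc 1 m, 2 * ε := by
          refine norm_sum_le_of_le _ fun j hj => ?_
          rw [Finset.mem_Icc] at hj
          refine (norm_pathStep_iterate_le hδ hM hS (by positivity) heb j
            (hanti hj.2 h0)).trans ?_
          exact mul_le_of_le_one_left (by positivity) (pow_le_one₀ hθ0 hθ)
      _ = _ := by simp
  have h2 : ‖(pathStep B w D)^[m] h 0‖ ≤ (M / δ) ^ m * M :=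
    norm_pathStep_iterate_le hδ hM hS hM0 (fun σ _ => hhb σ) m h0
  calc _ ≤ ‖e 0‖ + ‖∑ j ∈ Finset.Icc 1 m, (pathStep B w D)^[j] e' 0‖
        + ‖(pathStep B w D)^[m] h 0‖ := norm_add₃_le
    _ ≤ ε + m * (2 * ε) + (M / δ) ^ m * M := by
        gcongr
        exact he 0 (hanti (Nat.zero_le _) h0)
    _ = _ := by ring

end Paths

variable {d : ℕ}

/-! ### The corrections in the non-resonance domain -/

section Corrections

variable (Ω : Submodule ℤ (Space d))

/-- The points of the dual lattice from which `k` further steps of length less than `R` do not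
leave the ball of radius `p * R`. -/
def stepRegion (p R : ℝ) (k : ℕ) : Set (Space d) :=
  {σ | σ ∈ dualLattice Ω ∧ ‖σ‖ + k * R ≤ p * R}

theorem antitone_stepRegion {p R : ℝ} (hR : 0 ≤ R) : Antitone (stepRegion Ω p R) := by
  rintro k l hkl σ ⟨h1, h2⟩
  refine ⟨h1, le_trans ?_ h2⟩
  gcongr

theorem zero_mem_stepRegion {p R : ℝ} (hR : 0 ≤ R) {k : ℕ} (hk : (k : ℝ) ≤ p) :
    (0 : Space d) ∈ stepRegion Ω p R k := by
  refine ⟨zero_mem _, ?_⟩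
  rw [norm_zero, zero_add]
  gcongr

theorem lt_abs_of_mem_nonResonanceDomain {ρ p : ℝ} {x : Space d}
    (hx : x ∈ nonResonanceDomain Ω ρ p) {τ : Space d} (hτ : τ ∈ dualLattice Ω) (h0 : τ ≠ 0)
    (hp : ‖τ‖ < p * ρ ^ alph d) : ρ ^ alphOne d < |‖x‖ ^ 2 - ‖x - τ‖ ^ 2| := by
  by_contra! h
  refine hx.2 (Set.mem_biUnion (x := -τ) ⟨neg_mem hτ, by simpa using h0, by simpa using hp⟩
    ⟨?_, hx.1⟩)
  simpa [← sub_eq_add_neg] using h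

variable [DiscreteTopology Ω] [IsZLattice ℝ Ω]

theorem mem_dualBallFinset {r : ℝ} {γ : Space d} :
    γ ∈ dualBallFinset Ω r ↔ γ ∈ dualLattice Ω ∧ 0 < ‖γ‖ ∧ ‖γ‖ < r := by
  simp [dualBallFinset, dualBall]

/-- `S_k` is the `k`-th iterate of the path sum at the origin, applied to the weight
`τ ↦ q_{-τ}` of the step that closes the path. -/
theorem iterSum_eq_pathStep_iterate (F : Set (Space d)) (q : Space d → ℝ) (ρ : ℝ) (k : ℕ) (a : ℂ)
    (x : Space d) :
    iterSum Ω F q ρ k a x = (pathStep (dualBallFinset Ω (ρ ^ alph d)) (potCoeff F q)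
      (fun τ => a - ((‖x - τ‖ ^ 2 : ℝ) : ℂ)))^[k] (fun τ => potCoeff F q (-τ)) 0 := by
  rw [← sum_paths_eq_pathStep_iterate]
  simp only [iterSum, zero_add]

theorem potCoeff_neg (F : Set (Space d)) (q : Space d → ℝ) (γ : Space d) :
    potCoeff F q (-γ) = (starRingEnd ℂ) (potCoeff F q γ) := by
  simp only [potCoeff, planeCoeff]
  rw [← integral_conj]
  refine integral_congr_ae (Filter.Eventually.of_forall fun x => ?_)
  simp [planeWave, ← Complex.exp_conj]

theorem correction_one (F : Set (Space d)) (q : Space d → ℝ) (ρ : ℝ) (x : Space d) :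
    correction Ω F q ρ 1 x = ∑ γ ∈ dualBallFinset Ω (ρ ^ alph d),
      ((‖potCoeff F q γ‖ ^ 2 / (‖x‖ ^ 2 - ‖x - γ‖ ^ 2) : ℝ) : ℂ) := by
  simp only [correction, zero_add, add_zero, Finset.Icc_self, Finset.sum_singleton]
  rw [iterSum_eq_pathStep_iterate]
  simp only [Function.iterate_one, pathStep, zero_add]
  rw [Finset.filter_true_of_mem fun γ hγ =>
    norm_pos_iff.1 ((mem_dualBallFinset Ω).1 hγ).2.1]
  refine Finset.sum_congr rfl fun γ _ => ?_
  rw [potCoeff_neg, div_mul_eq_mul_div, Complex.mul_conj, Complex.normSq_eq_norm_sq]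
  push_cast
  rfl

/-- In the non-resonance domain the denominators stay away from zero along all admissible paths. -/
theorem stepRegion_step {ρ p : ℝ} (hρ : 0 < ρ) {x : Space d} (hx : x ∈ nonResonanceDomain Ω ρ p)
    {a : ℂ} (ha : ‖a - ((‖x‖ ^ 2 : ℝ) : ℂ)‖ ≤ 1 / 2 * ρ ^ alphOne d) (k : ℕ) :
    ∀ σ ∈ stepRegion Ω p (ρ ^ alph d) (k + 1), ∀ γ ∈ dualBallFinset Ω (ρ ^ alph d),
      σ + γ ∈ stepRegion Ω p (ρ ^ alph d) k ∧
        (σ + γ ≠ 0 → 1 / 2 * ρ ^ alphOne d ≤ ‖a - ((‖x - (σ + γ)‖ ^ 2 : ℝ) : ℂ)‖) := by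
  rintro σ ⟨h1, h2⟩ γ hγ
  obtain ⟨h3, -, h5⟩ := (mem_dualBallFinset Ω).1 hγ
  have hR : 0 < ρ ^ alph d := Real.rpow_pos_of_pos hρ _
  have hn := norm_add_le σ γ
  push_cast at h2
  have hk : 0 ≤ (k : ℝ) * ρ ^ alph d := by positivity
  refine ⟨⟨add_mem h1 h3, by linarith⟩, fun h0 => ?_⟩
  have h6 := lt_abs_of_mem_nonResonanceDomain Ω hx (add_mem h1 h3) h0 (by linarith)
  have h7 : |‖x‖ ^ 2 - ‖x - (σ + γ)‖ ^ 2|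
      ≤ ‖a - ((‖x - (σ + γ)‖ ^ 2 : ℝ) : ℂ)‖ + ‖a - ((‖x‖ ^ 2 : ℝ) : ℂ)‖ := by
    have e : |‖x‖ ^ 2 - ‖x - (σ + γ)‖ ^ 2| = ‖(a - ((‖x - (σ + γ)‖ ^ 2 : ℝ) : ℂ))
        - (a - ((‖x‖ ^ 2 : ℝ) : ℂ))‖ := by
      rw [sub_sub_sub_cancel_left, ← Complex.ofReal_sub, Complex.norm_real, Real.norm_eq_abs]
    rw [e]
    exact norm_sub_le _ _
  linarith

theorem sum_Icc_pow_le {θ : ℝ} (h0 : 0 ≤ θ) (h1 : θ ≤ 1 / 2) (m n : ℕ) :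
    ∑ j ∈ Finset.Icc m n, θ ^ j ≤ 2 * θ ^ m := by
  rw [← Finset.Ico_add_one_right_eq_Icc]
  refine (geom_sum_Ico_le_of_lt_one h0 (by linarith)).trans ?_
  rw [div_le_iff₀ (by linarith)]
  nlinarith [pow_nonneg h0 m]

variable {Ω} {F : Set (Space d)} {q : Space d → ℝ} {ρ p M δ : ℝ} {x : Space d}

theorem norm_iterSum_le (hρ : 0 < ρ) (hx : x ∈ nonResonanceDomain Ω ρ p)
    (hδ : δ = 1 / 2 * ρ ^ alphOne d)
    (hM : ∑ γ ∈ dualBallFinset Ω (ρ ^ alph d), ‖potCoeff F q γ‖ ≤ M)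
    (hM' : ∀ γ ∈ dualLattice Ω, ‖potCoeff F q γ‖ ≤ M)
    {a : ℂ} (ha : ‖a - ((‖x‖ ^ 2 : ℝ) : ℂ)‖ ≤ δ) {k : ℕ} (hk : (k : ℝ) ≤ p) :
    ‖iterSum Ω F q ρ k a x‖ ≤ (M / δ) ^ k * M := by
  subst hδ
  rw [iterSum_eq_pathStep_iterate]
  have hR := Real.rpow_pos_of_pos hρ (alph d)
  have hM0 : 0 ≤ M := (Finset.sum_nonneg fun _ _ => norm_nonneg _).trans hM
  refine norm_pathStep_iterate_le (S := stepRegion Ω p (ρ ^ alph d)) ?_ hM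
    (stepRegion_step Ω hρ hx ha) hM0 (fun σ hσ => hM' _ (neg_mem hσ.1)) k
    (zero_mem_stepRegion Ω hR.le hk)
  positivity

theorem norm_iterSum_sub_le (hρ : 0 < ρ) (hx : x ∈ nonResonanceDomain Ω ρ p)
    (hδ : δ = 1 / 2 * ρ ^ alphOne d)
    (hM : ∑ γ ∈ dualBallFinset Ω (ρ ^ alph d), ‖potCoeff F q γ‖ ≤ M)
    (hM' : ∀ γ ∈ dualLattice Ω, ‖potCoeff F q γ‖ ≤ M)
    {a b : ℂ} (ha : ‖a - ((‖x‖ ^ 2 : ℝ) : ℂ)‖ ≤ δ) (hb : ‖b - ((‖x‖ ^ 2 : ℝ) : ℂ)‖ ≤ δ)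
    {k : ℕ} (hk : (k : ℝ) ≤ p) :
    ‖iterSum Ω F q ρ k a x - iterSum Ω F q ρ k b x‖ ≤ k * (M / δ) ^ k * M * (‖a - b‖ / δ) := by
  subst hδ
  rw [iterSum_eq_pathStep_iterate, iterSum_eq_pathStep_iterate]
  have hR := Real.rpow_pos_of_pos hρ (alph d)
  have hM0 : 0 ≤ M := (Finset.sum_nonneg fun _ _ => norm_nonneg _).trans hM
  refine norm_pathStep_iterate_sub_le (S := stepRegion Ω p (ρ ^ alph d)) ?_ hM
    (stepRegion_step Ω hρ hx ha) (stepRegion_step Ω hρ hx hb) (fun σ => ?_) hM0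
    (fun σ hσ => hM' _ (neg_mem hσ.1)) k (zero_mem_stepRegion Ω hR.le hk)
  · positivity
  · rw [sub_sub_sub_cancel_right]

/-- The corrections are small compared with the denominators, uniformly in their order. -/
theorem norm_correction_le (hρ : 0 < ρ) (hx : x ∈ nonResonanceDomain Ω ρ p)
    (hδ : δ = 1 / 2 * ρ ^ alphOne d)
    (hM : ∑ γ ∈ dualBallFinset Ω (ρ ^ alph d), ‖potCoeff F q γ‖ ≤ M)
    (hM' : ∀ γ ∈ dualLattice Ω, ‖potCoeff F q γ‖ ≤ M)
    (hθ : M / δ ≤ 1 / 2) {k : ℕ} (hk : (k : ℝ) ≤ p) :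
    ‖correction Ω F q ρ k x‖ ≤ 2 * (M / δ) * M := by
  have hM0 : 0 ≤ M := (Finset.sum_nonneg fun _ _ => norm_nonneg _).trans hM
  have hδ0 : 0 < δ := by rw [hδ]; positivity
  induction k with
  | zero => rw [correction, norm_zero]; positivity
  | succ k ih =>
    push_cast at hk
    have ih := ih (by linarith)
    have hMδ : 2 * M ≤ δ := by rw [div_le_iff₀ hδ0] at hθ; linarith
    have ha : ‖((‖x‖ ^ 2 : ℝ) : ℂ) + correction Ω F q ρ k x - ((‖x‖ ^ 2 : ℝ) : ℂ)‖ ≤ δ := by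
      rw [add_sub_cancel_left]
      refine ih.trans ?_
      nlinarith
    rw [correction]
    calc _ ≤ ∑ j ∈ Finset.Icc 1 (k + 1), (M / δ) ^ j * M := by
          refine norm_sum_le_of_le _ fun j hj => ?_
          rw [Finset.mem_Icc] at hj
          have : (j : ℝ) ≤ k + 1 := by exact_mod_cast hj.2
          exact norm_iterSum_le hρ hx hδ hM hM' ha (by linarith)
      _ = (∑ j ∈ Finset.Icc 1 (k + 1), (M / δ) ^ j) * M := by rw [Finset.sum_mul]
      _ ≤ 2 * (M / δ) ^ 1 * M := by
          gcongr
          exact sum_Icc_pow_le (by positivity) hθ _ _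
      _ = _ := by rw [pow_one]

/-- Solving `a = |x|² + ∑ S_j(a, x) + O(θ^K)` by iteration: each substitution of an approximate
root improves its accuracy by a factor `θ`. -/
theorem norm_sub_correction_le (hρ : 0 < ρ) (hx : x ∈ nonResonanceDomain Ω ρ p)
    (hδ : δ = 1 / 2 * ρ ^ alphOne d)
    (hM : ∑ γ ∈ dualBallFinset Ω (ρ ^ alph d), ‖potCoeff F q γ‖ ≤ M)
    (hM' : ∀ γ ∈ dualLattice Ω, ‖potCoeff F q γ‖ ≤ M)
    (hθ : M / δ ≤ 1 / 2) {m K : ℕ} (hm : (m : ℝ) ≤ p) (hKm : K ≤ m) {E : ℝ} (hE0 : 0 ≤ E)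
    {a : ℂ} (ha : ‖a - ((‖x‖ ^ 2 : ℝ) : ℂ)‖ ≤ δ)
    (hE : ‖a - ((‖x‖ ^ 2 : ℝ) : ℂ) - ∑ j ∈ Finset.Icc 1 m, iterSum Ω F q ρ j a x‖
      ≤ E * (M / δ) ^ K) {k : ℕ} (hk1 : 1 ≤ k) (hkK : k ≤ K) :
    ‖a - (((‖x‖ ^ 2 : ℝ) : ℂ) + correction Ω F q ρ (k - 1) x)‖
      ≤ (E + 2 * M) * (1 + (m : ℝ) ^ 2) ^ k * (M / δ) ^ k := by
  have hM0 : 0 ≤ M := (Finset.sum_nonneg fun _ _ => norm_nonneg _).trans hM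
  have hδ0 : 0 < δ := by rw [hδ]; positivity
  have hMδ : 2 * M ≤ δ := by rw [div_le_iff₀ hδ0] at hθ; linarith
  set θ := M / δ with hθdef
  have hθ0 : 0 ≤ θ := by positivity
  have hE' : ∀ k ≤ K, E * θ ^ K ≤ E * θ ^ k := fun k hk =>
    mul_le_mul_of_nonneg_left (pow_le_pow_of_le_one hθ0 (by linarith) hk) hE0
  have htail : ∀ k, ‖∑ j ∈ Finset.Icc k m, iterSum Ω F q ρ j a x‖ ≤ 2 * M * θ ^ k := by
    intro k
    calc _ ≤ ∑ j ∈ Finset.Icc k m, θ ^ j * M := by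
          refine norm_sum_le_of_le _ fun j hj => ?_
          rw [Finset.mem_Icc] at hj
          have : (j : ℝ) ≤ m := by exact_mod_cast hj.2
          exact norm_iterSum_le hρ hx hδ hM hM' ha (by linarith)
      _ = (∑ j ∈ Finset.Icc k m, θ ^ j) * M := by rw [Finset.sum_mul]
      _ ≤ (2 * θ ^ k) * M := by
          gcongr
          exact sum_Icc_pow_le hθ0 hθ _ _
      _ = _ := by ring
  induction k, hk1 using Nat.le_induction with
  | base =>
    have e : a - (((‖x‖ ^ 2 : ℝ) : ℂ) + correction Ω F q ρ (1 - 1) x)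
        = (a - ((‖x‖ ^ 2 : ℝ) : ℂ) - ∑ j ∈ Finset.Icc 1 m, iterSum Ω F q ρ j a x)
          + ∑ j ∈ Finset.Icc 1 m, iterSum Ω F q ρ j a x := by
      simp [correction]
    rw [e]
    calc _ ≤ E * θ ^ 1 + 2 * M * θ ^ 1 :=
          (norm_add_le _ _).trans (add_le_add (hE.trans (hE' 1 hkK)) (htail 1))
      _ = (E + 2 * M) * 1 * θ ^ 1 := by ring
      _ ≤ _ := by
          gcongr
          rw [pow_one]
          nlinarith [sq_nonneg (m : ℝ)]
  | succ k hk1 ih =>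
    have ih := ih (by omega)
    obtain ⟨l, rfl⟩ : ∃ l, k = l + 1 := ⟨k - 1, by omega⟩
    simp only [Nat.add_sub_cancel] at ih ⊢
    have hlm : ((l + 1 : ℕ) : ℝ) ≤ m := by exact_mod_cast (by omega : l + 1 ≤ m)
    have hlp : (l : ℝ) ≤ p := by push_cast at hlm; linarith
    set b := ((‖x‖ ^ 2 : ℝ) : ℂ) + correction Ω F q ρ l x with hb
    have hbδ : ‖b - ((‖x‖ ^ 2 : ℝ) : ℂ)‖ ≤ δ := by
      rw [hb, add_sub_cancel_left]
      refine (norm_correction_le hρ hx hδ hM hM' hθ hlp).trans ?_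
      nlinarith
    have hsplit : ∑ j ∈ Finset.Icc 1 m, iterSum Ω F q ρ j a x
        = ∑ j ∈ Finset.Icc 1 (l + 1), iterSum Ω F q ρ j a x
          + ∑ j ∈ Finset.Icc (l + 1 + 1) m, iterSum Ω F q ρ j a x := by
      simp only [← Finset.Ico_add_one_right_eq_Icc]
      rw [Finset.sum_Ico_consecutive _ (by omega) (by omega)]
    have e : a - (((‖x‖ ^ 2 : ℝ) : ℂ) + correction Ω F q ρ (l + 1) x)
        = (a - ((‖x‖ ^ 2 : ℝ) : ℂ) - ∑ j ∈ Finset.Icc 1 m, iterSum Ω F q ρ j a x)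
          + ∑ j ∈ Finset.Icc (l + 1 + 1) m, iterSum Ω F q ρ j a x
          + ∑ j ∈ Finset.Icc 1 (l + 1), (iterSum Ω F q ρ j a x - iterSum Ω F q ρ j b x) := by
      rw [correction, ← hb, hsplit, Finset.sum_sub_distrib]
      ring
    have hlip : ‖∑ j ∈ Finset.Icc 1 (l + 1), (iterSum Ω F q ρ j a x - iterSum Ω F q ρ j b x)‖
        ≤ m * (m * θ * θ * ‖a - b‖) := by
      calc _ ≤ ∑ j ∈ Finset.Icc 1 (l + 1), m * θ * θ * ‖a - b‖ := by
            refine norm_sum_le_of_le _ fun j hj => ?_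
            rw [Finset.mem_Icc] at hj
            have hj2 : (j : ℝ) ≤ ((l + 1 : ℕ) : ℝ) := by exact_mod_cast hj.2
            have hjm : (j : ℝ) ≤ m := hj2.trans hlm
            refine (norm_iterSum_sub_le hρ hx hδ hM hM' ha hbδ (by linarith)).trans ?_
            rw [← hθdef]
            have h1 : θ ^ j ≤ θ := by
              simpa using pow_le_pow_of_le_one hθ0 (by linarith) hj.1
            calc (j : ℝ) * θ ^ j * M * (‖a - b‖ / δ) = j * θ ^ j * θ * ‖a - b‖ := by
                  rw [hθdef]; ring
              _ ≤ m * θ * θ * ‖a - b‖ := by gcongr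
        _ = ((l + 1 : ℕ) : ℝ) * (m * θ * θ * ‖a - b‖) := by simp
        _ ≤ _ := by gcongr
    rw [e]
    set C := (E + 2 * M) * (1 + (m : ℝ) ^ 2) ^ (l + 1) with hC
    have hCge : E + 2 * M ≤ C :=
      le_mul_of_one_le_right (by positivity) (one_le_pow₀ (by nlinarith [sq_nonneg (m : ℝ)]))
    have hC0 : 0 ≤ C := by positivity
    calc _ ≤ E * θ ^ (l + 1 + 1) + 2 * M * θ ^ (l + 1 + 1) + m * (m * θ * θ * (C * θ ^ (l + 1))) := by
          refine norm_add₃_le.trans ?_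
          gcongr
          · exact hE.trans (hE' _ hkK)
          · exact htail _
          · exact hlip.trans (by gcongr)
      _ = (E + 2 * M) * θ ^ (l + 1 + 1) + (m : ℝ) ^ 2 * C * θ ^ (l + 1 + 1) * θ := by ring
      _ ≤ C * θ ^ (l + 1 + 1) + (m : ℝ) ^ 2 * C * θ ^ (l + 1 + 1) * 1 := by
          gcongr
          linarith
      _ = _ := by rw [hC]; ring

end Corrections

/-! ### The dual lattice -/

section DualLattice

variable (Ω : Submodule ℤ (Space d)) [DiscreteTopology Ω] [IsZLattice ℝ Ω]

/-- The non-zero vectors of the dual lattice are bounded away from zero. -/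
theorem exists_le_norm_dualLattice :
    ∃ r : ℝ, 0 < r ∧ r ≤ 1 ∧ ∀ γ ∈ dualLattice Ω, γ ≠ 0 → r ≤ ‖γ‖ := by
  classical
  set T := insert (1 : ℝ) ((dualBallFinset Ω 1).image fun γ => ‖γ‖) with hT
  have hne : T.Nonempty := Finset.insert_nonempty _ _
  refine ⟨T.min' hne, ?_, Finset.min'_le _ _ (Finset.mem_insert_self _ _), fun γ hγ h0 => ?_⟩
  · rw [Finset.lt_min'_iff]
    intro y hy
    rw [hT, Finset.mem_insert, Finset.mem_image] at hy
    rcases hy with rfl | ⟨γ, hγ, rfl⟩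
    · exact one_pos
    · exact ((mem_dualBallFinset Ω).1 hγ).2.1
  · by_cases h1 : ‖γ‖ < 1
    · refine Finset.min'_le _ _ (Finset.mem_insert_of_mem (Finset.mem_image_of_mem _ ?_))
      exact (mem_dualBallFinset Ω).2 ⟨hγ, norm_pos_iff.2 h0, h1⟩
    · exact (Finset.min'_le _ _ (Finset.mem_insert_self _ _)).trans (not_lt.1 h1)

theorem summable_norm_rpow_dualLattice {r : ℝ} (hr : r < -d) :
    Summable fun γ : dualLattice Ω => ‖(γ : Space d)‖ ^ r := by
  obtain ⟨c, hc0, -, hc⟩ := exists_le_norm_dualLattice Ω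
  let L : Submodule ℤ (Space d) := AddSubgroup.toIntSubmodule (dualLattice Ω)
  have hL : DiscreteTopology L := by
    refine DiscreteTopology.of_forall_le_dist hc0 fun x y hxy => ?_
    have h1 : (x : Space d) - y ∈ dualLattice Ω := sub_mem x.2 y.2
    have h2 : (x : Space d) - y ≠ 0 := sub_ne_zero.2 fun h => hxy (Subtype.ext h)
    simpa [Subtype.dist_eq, dist_eq_norm] using hc _ h1 h2
  have hspan : Submodule.span ℤ (L : Set (Space d)) = L := Submodule.span_eq L
  have hrank : Module.finrank ℤ L ≤ d := by
    have h1 := Real.finrank_eq_int_finrank_of_discrete (s := (L : Set (Space d)))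
      (by rw [hspan]; exact hL)
    have h2 : Set.finrank ℤ (L : Set (Space d)) = Module.finrank ℤ L := by
      rw [Set.finrank, hspan]
    rw [← h2, ← h1, Set.finrank]
    simpa using Submodule.finrank_le (Submodule.span ℝ (L : Set (Space d)))
  have hr' : r < -(Module.finrank ℤ L : ℝ) := by
    have : (Module.finrank ℤ L : ℝ) ≤ d := by exact_mod_cast hrank
    linarith
  exact ZLattice.summable_norm_rpow L r hr'

/-- A translate of the dual lattice has `O(r^{d-1})` points in a spherical shell of radius `r` and
bounded thickness, uniformly in the translation: disjoint balls around these points lie in a shell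
of volume `O(r^{d-1})`. -/
theorem exists_card_shell_le :
    ∃ C : ℝ, 0 < C ∧ ∀ (r : ℝ), 2 ≤ r → ∀ (t : Space d) (T : Finset (Space d)),
      (∀ γ ∈ T, γ ∈ dualLattice Ω ∧ |‖γ + t‖ - r| ≤ 1) → (T.card : ℝ) ≤ C * r ^ (d - 1) := by
  obtain ⟨c, hc0, hc1, hc⟩ := exists_le_norm_dualLattice Ω
  refine ⟨4 * d * 2 ^ (d - 1) / (c / 2) ^ d + 1, by positivity, fun r hr t T hT => ?_⟩
  set v := volume.real (Metric.ball (0 : Space d) 1) with hv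
  have hv0 : 0 < v := by
    rw [hv, measureReal_def]
    exact ENNReal.toReal_pos (Metric.measure_ball_pos volume _ one_pos).ne' measure_ball_lt_top.ne
  have hball : ∀ (x : Space d) {s : ℝ}, 0 ≤ s → 0 < d → volume.real (Metric.ball x s) = s ^ d * v := by
    intro x s hs hd
    have : Nontrivial (Space d) := by
      rw [← Module.finrank_pos_iff (R := ℝ)]
      simpa using hd
    rw [measureReal_def, Measure.addHaar_ball _ _ hs, ENNReal.toReal_mul,
      ENNReal.toReal_ofReal (by positivity), hv, measureReal_def]
    simp
  rcases Nat.eq_zero_or_pos d with hd | hd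
  · subst hd
    have : T.card ≤ 1 := Finset.card_le_one.2 fun a _ b _ => Subsingleton.elim _ _
    have : (T.card : ℝ) ≤ 1 := by exact_mod_cast this
    simpa using this
  have hdisj : (T : Set (Space d)).PairwiseDisjoint fun γ => Metric.ball (γ + t) (c / 2) := by
    intro γ hγ γ' hγ' hne
    refine Metric.ball_disjoint_ball ?_
    have h := hc (γ - γ') (sub_mem (hT γ hγ).1 (hT γ' hγ').1) (sub_ne_zero.2 hne)
    rw [dist_add_right, dist_eq_norm]
    linarith
  have hsub : (⋃ γ ∈ T, Metric.ball (γ + t) (c / 2)) ⊆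
      Metric.ball (0 : Space d) (r + 2) \ Metric.ball 0 (r - 2) := by
    refine Set.iUnion₂_subset fun γ hγ y hy => ?_
    rw [Metric.mem_ball, dist_eq_norm] at hy
    have h1 := abs_le.1 (hT γ hγ).2
    have h2 := abs_le.1 (abs_norm_sub_norm_le y (γ + t))
    simp only [Set.mem_sdiff, Metric.mem_ball, dist_zero_right, not_lt]
    constructor <;> linarith
  have hmono := measureReal_mono hsub (by
    exact ((measure_mono Set.sdiff_subset).trans_lt
      (measure_ball_lt_top (μ := volume) (x := (0 : Space d)) (r := r + 2))).ne)
  rw [measureReal_biUnion_finset hdisj (fun _ _ => measurableSet_ball)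
      (fun _ _ => measure_ball_lt_top.ne),
    measureReal_sdiff (Metric.ball_subset_ball (by linarith)) measurableSet_ball,
    hball _ (by linarith) hd, hball _ (by linarith) hd,
    Finset.sum_congr rfl (fun γ _ => hball (γ + t) (by linarith : 0 ≤ c / 2) hd)] at hmono
  simp only [Finset.sum_const, nsmul_eq_mul] at hmono
  have h1 : (T.card : ℝ) * (c / 2) ^ d ≤ (r + 2) ^ d - (r - 2) ^ d := by
    have : (T.card : ℝ) * (c / 2) ^ d * v ≤ ((r + 2) ^ d - (r - 2) ^ d) * v := by linarith
    exact le_of_mul_le_mul_right this hv0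
  have h2 : (r + 2) ^ d - (r - 2) ^ d ≤ 4 * d * (2 * r) ^ (d - 1) := by
    refine (le_abs_self _).trans ((abs_pow_sub_pow_le (r + 2) (r - 2) d).trans ?_)
    have e1 : |r + 2 - (r - 2)| = 4 := by norm_num
    rw [e1, abs_of_nonneg (by linarith : (0 : ℝ) ≤ r + 2), abs_of_nonneg (by linarith : 0 ≤ r - 2)]
    have : max (r + 2) (r - 2) ≤ 2 * r := max_le (by linarith) (by linarith)
    have h0 : 0 ≤ max (r + 2) (r - 2) := le_max_of_le_left (by linarith)
    gcongr
  have hcd : 0 < (c / 2) ^ d := by positivity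
  have h3 : (T.card : ℝ) ≤ 4 * d * (2 * r) ^ (d - 1) / (c / 2) ^ d := by
    rw [le_div_iff₀ hcd]; linarith
  refine h3.trans ?_
  rw [mul_pow]
  have : 0 ≤ r ^ (d - 1) := by positivity
  calc _ = 4 * d * 2 ^ (d - 1) / (c / 2) ^ d * r ^ (d - 1) := by ring
    _ ≤ _ := by nlinarith

end DualLattice

/-! ### Decay of the Fourier coefficients -/

section Decay

theorem sum_norm_potCoeff_le_tsum {Ω : Submodule ℤ (Space d)} {F : Set (Space d)}
    {q : Space d → ℝ}
    (h : Summable fun γ : dualLattice Ω => ‖potCoeff F q γ‖) (T : Finset (Space d))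
    (hT : ∀ γ ∈ T, γ ∈ dualLattice Ω) :
    ∑ γ ∈ T, ‖potCoeff F q γ‖ ≤ ∑' γ : dualLattice Ω, ‖potCoeff F q γ‖ := by
  classical
  have := h.sum_le_tsum (T.subtype (· ∈ dualLattice Ω)) fun _ _ => norm_nonneg _
  refine le_trans (le_of_eq ?_) this
  rw [Finset.sum_subtype_of_mem (fun γ => ‖potCoeff F q γ‖) hT]

variable {Ω : Submodule ℤ (Space d)} [DiscreteTopology Ω] [IsZLattice ℝ Ω]
  {F : Set (Space d)} {s p : ℝ} {q : Space d → ℝ}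

/-- This is the Cauchy-Schwarz inequality for `(|γ|^s |q_γ|) |γ|^{-d}`, in which the second factor is
square summable over the lattice because `2 d > d`. -/
theorem IsSobolevPotential.summable_rpow (hq : IsSobolevPotential Ω F s q) (hd : 0 < d)
    (hp : p = s - d) (hp0 : 0 ≤ p) :
    Summable fun γ : dualLattice Ω => (1 + ‖(γ : Space d)‖) ^ p * ‖potCoeff F q γ‖ := by
  classical
  obtain ⟨c, hc0, -, hc⟩ := exists_le_norm_dualLattice Ω
  have hd' : (0 : ℝ) < d := by exact_mod_cast hd
  have h1 : Summable fun γ : dualLattice Ω => (c⁻¹ + 1) ^ p *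
      (‖potCoeff F q (γ : Space d)‖ ^ 2 * (1 + ‖(γ : Space d)‖ ^ (2 * s))
        + ‖(γ : Space d)‖ ^ (-(2 * d : ℝ))) :=
    (hq.summable.add (summable_norm_rpow_dualLattice Ω (by linarith))).mul_left _
  refine Summable.of_norm_bounded_eventually h1 ?_
  rw [Filter.eventually_cofinite]
  refine (Set.finite_singleton (0 : dualLattice Ω)).subset fun γ hγ => ?_
  simp only [Set.mem_ofPred_eq, Set.mem_singleton_iff] at hγ ⊢
  by_contra h0
  refine hγ ?_
  have hγ0 : (γ : Space d) ≠ 0 := fun h => h0 (Subtype.ext h)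
  set n := ‖(γ : Space d)‖ with hn
  set u := ‖potCoeff F q (γ : Space d)‖ with hu
  have hcn : c ≤ n := hc _ γ.2 hγ0
  have hn0 : 0 < n := hc0.trans_le hcn
  rw [Real.norm_of_nonneg (by positivity)]
  have h2 : (1 + n) ^ p ≤ (c⁻¹ + 1) ^ p * n ^ p := by
    rw [← Real.mul_rpow (by positivity) hn0.le]
    refine Real.rpow_le_rpow (by positivity) ?_ hp0
    have : 1 ≤ c⁻¹ * n := by rw [← div_eq_inv_mul, one_le_div hc0]; exact hcn
    linarith
  have h3 : n ^ p * u ≤ u ^ 2 * (1 + n ^ (2 * s)) + n ^ (-(2 * d : ℝ)) := by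
    have e1 : n ^ p = n ^ s * n ^ (-(d : ℝ)) := by
      rw [← Real.rpow_add hn0, hp, sub_eq_add_neg]
    have e2 : n ^ (2 * s) = (n ^ s) ^ 2 := by
      rw [← Real.rpow_natCast, ← Real.rpow_mul hn0.le]; push_cast; ring_nf
    have e3 : n ^ (-(2 * d : ℝ)) = (n ^ (-(d : ℝ))) ^ 2 := by
      rw [← Real.rpow_natCast, ← Real.rpow_mul hn0.le]; push_cast; ring_nf
    rw [e1, e2, e3]
    nlinarith [sq_nonneg (n ^ s * u - n ^ (-(d : ℝ))), sq_nonneg u, sq_nonneg (n ^ s * u),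
      sq_nonneg (n ^ (-(d : ℝ)))]
  calc (1 + n) ^ p * u ≤ ((c⁻¹ + 1) ^ p * n ^ p) * u := by gcongr
    _ = (c⁻¹ + 1) ^ p * (n ^ p * u) := by ring
    _ ≤ _ := by gcongr

theorem IsSobolevPotential.summable_norm (hq : IsSobolevPotential Ω F s q) (hd : 0 < d)
    (hp : p = s - d) (hp0 : 0 ≤ p) : Summable fun γ : dualLattice Ω => ‖potCoeff F q γ‖ := by
  refine Summable.of_nonneg_of_le (fun _ => norm_nonneg _) (fun γ => ?_)
    (hq.summable_rpow hd hp hp0)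
  exact le_mul_of_one_le_left (norm_nonneg _)
    (Real.one_le_rpow (by linarith [norm_nonneg (γ : Space d)]) hp0)

theorem IsSobolevPotential.tsum_tail_le (hq : IsSobolevPotential Ω F s q) (hd : 0 < d)
    (hp : p = s - d) (hp0 : 0 ≤ p) {R : ℝ} (hR : 0 < R) (P : dualLattice Ω → Prop)
    [DecidablePred P] (hP : ∀ γ, P γ → R ≤ ‖(γ : Space d)‖) :
    ∑' γ : dualLattice Ω, (if P γ then ‖potCoeff F q γ‖ else 0)
      ≤ (∑' γ : dualLattice Ω, (1 + ‖(γ : Space d)‖) ^ p * ‖potCoeff F q γ‖) * R ^ (-p) := by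
  have hs := hq.summable_rpow hd hp hp0
  rw [← tsum_mul_right]
  refine Summable.tsum_le_tsum (fun γ => ?_) ?_ (hs.mul_right _)
  · split_ifs with h
    · have h1 : R ^ p ≤ (1 + ‖(γ : Space d)‖) ^ p :=
        Real.rpow_le_rpow hR.le (by linarith [hP γ h]) hp0
      rw [Real.rpow_neg hR.le, mul_assoc, mul_comm ‖_‖, ← mul_assoc, ← div_eq_mul_inv]
      refine le_mul_of_one_le_left (norm_nonneg _) ?_
      rwa [one_le_div (Real.rpow_pos_of_pos hR _)]
    · positivity
  · refine Summable.of_nonneg_of_le (fun γ => by split_ifs <;> positivity) (fun γ => ?_)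
      (hq.summable_norm hd hp hp0)
    split_ifs
    · exact le_rfl
    · positivity

end Decay

/-! ### Plane waves on a fundamental domain -/

section PlaneWaves

theorem norm_planeWave (v x : Space d) : ‖planeWave v x‖ = 1 := by
  rw [planeWave, mul_comm, Complex.norm_exp_ofReal_mul_I]

theorem planeWave_add_right (v x y : Space d) :
    planeWave v (x + y) = planeWave v x * planeWave v y := by
  simp only [planeWave, ← Complex.exp_add, inner_add_right]
  push_cast
  ring_nf

theorem planeWave_add_left (v w x : Space d) :
    planeWave (v + w) x = planeWave v x * planeWave w x := by
  simp only [planeWave, ← Complex.exp_add, inner_add_left]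
  push_cast
  ring_nf

theorem conj_planeWave (v x : Space d) :
    (starRingEnd ℂ) (planeWave v x) = planeWave (-v) x := by
  simp [planeWave, ← Complex.exp_conj]

theorem planeWave_zero (x : Space d) : planeWave (0 : Space d) x = 1 := by
  simp [planeWave]

theorem planeWave_mul_conj (v w x : Space d) :
    planeWave v x * (starRingEnd ℂ) (planeWave w x) = planeWave (v - w) x := by
  rw [conj_planeWave, ← planeWave_add_left, sub_eq_add_neg]

theorem planeWave_mul_conj_self (v x : Space d) :
    planeWave v x * (starRingEnd ℂ) (planeWave v x) = 1 := by
  rw [planeWave_mul_conj, sub_self, planeWave_zero]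

theorem contDiff_planeWave (v : Space d) {n : WithTop ℕ∞} : ContDiff ℝ n (planeWave v) := by
  exact Complex.contDiff_exp.comp (contDiff_const.mul
    (Complex.ofRealCLM.contDiff.comp (contDiff_const.inner ℝ contDiff_id)))

theorem continuous_planeWave (v : Space d) : Continuous (planeWave v) :=
  (contDiff_planeWave v (n := 0)).continuous

theorem planeWave_eq_one {Ω : Submodule ℤ (Space d)} {γ ω : Space d} (hγ : γ ∈ dualLattice Ω)
    (hω : ω ∈ Ω) : planeWave γ ω = 1 := by
  obtain ⟨n, hn⟩ := hγ ω hω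
  rw [planeWave, hn, Complex.exp_eq_one_iff]
  exact ⟨n, by push_cast; ring⟩

theorem isQuasiperiodic_planeWave {Ω : Submodule ℤ (Space d)} {γ : Space d}
    (hγ : γ ∈ dualLattice Ω) (t : Space d) : IsQuasiperiodic Ω t (planeWave (γ + t)) := by
  intro ω hω x
  rw [planeWave_add_right, planeWave_add_left γ t ω, planeWave_eq_one hγ hω]
  ring

/-- The product of a quasiperiodic function and the conjugate of another one is periodic. -/
theorem IsQuasiperiodic.mul_conj {Ω : Submodule ℤ (Space d)} {t : Space d} {u v : Space d → ℂ}
    (hu : IsQuasiperiodic Ω t u) (hv : IsQuasiperiodic Ω t v) {ω : Space d} (hω : ω ∈ Ω)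
    (x : Space d) : u (x + ω) * (starRingEnd ℂ) (v (x + ω)) = u x * (starRingEnd ℂ) (v x) := by
  rw [hu ω hω, hv ω hω, map_mul]
  linear_combination u x * (starRingEnd ℂ) (v x) * planeWave_mul_conj_self t ω

end PlaneWaves

section FundamentalDomain

-- Instance search finds these for additive subgroups, but not for `ℤ`-submodules.
instance vaddInvariantMeasure_lattice (Ω : Submodule ℤ (Space d)) :
    VAddInvariantMeasure Ω (Space d) volume :=
  inferInstanceAs (VAddInvariantMeasure Ω.toAddSubgroup (Space d) volume)

instance measurableConstVAdd_lattice (Ω : Submodule ℤ (Space d)) :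
    MeasurableConstVAdd Ω (Space d) :=
  inferInstanceAs (MeasurableConstVAdd Ω.toAddSubgroup (Space d))

variable {Ω : Submodule ℤ (Space d)} [DiscreteTopology Ω] [IsZLattice ℝ Ω] {F : Set (Space d)}

open Pointwise in
theorem setIntegral_add_right_of_periodic (hF : IsAddFundamentalDomain Ω F volume)
    {f : Space d → ℂ} (hf : ∀ ω ∈ Ω, ∀ x, f (x + ω) = f x) (v : Space d) :
    ∫ x in F, f (x + v) = ∫ x in F, f x := by
  have h1 : IsAddFundamentalDomain Ω (v +ᵥ F) volume := hF.vadd_of_comm v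
  rw [hF.setIntegral_eq h1 (f := f) (fun g x => ?_)]
  · have h2 := (measurePreserving_add_right (volume : Measure (Space d)) v).setIntegral_image_emb
      (measurableEmbedding_addRight v) f F
    rw [← h2]
    congr 2
    ext y
    simp only [Set.mem_image, Set.mem_vadd_set, vadd_eq_add]
    simp only [add_comm]
  · have := hf g g.2 x
    rwa [add_comm] at this

theorem isProbabilityMeasure_restrict (hF1 : volume F = 1) :
    IsProbabilityMeasure (volume.restrict F) := ⟨by simpa using hF1⟩

/-- Plane waves with distinct frequencies in the dual lattice are orthogonal. -/
theorem integral_planeWave (hF : IsAddFundamentalDomain Ω F volume) (hF1 : volume F = 1)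
    {γ : Space d} (hγ : γ ∈ dualLattice Ω) :
    ∫ x in F, planeWave γ x = if γ = 0 then 1 else 0 := by
  split_ifs with h
  · subst h
    simp [planeWave_zero, measureReal_def, hF1]
  · -- Translation by `v` multiplies the integral by `e^{i⟨γ, v⟩} = -1`.
    set v : Space d := (Real.pi / ‖γ‖ ^ 2) • γ with hv
    have hn : ‖γ‖ ^ 2 ≠ 0 := by simpa using h
    have h1 : planeWave γ v = -1 := by
      rw [planeWave, hv, inner_smul_right, real_inner_self_eq_norm_sq, div_mul_cancel₀ _ hn,
        mul_comm, Complex.exp_pi_mul_I]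
    have h2 := setIntegral_add_right_of_periodic hF (f := planeWave γ)
      (fun ω hω x => by rw [planeWave_add_right, planeWave_eq_one hγ hω, mul_one]) v
    simp only [planeWave_add_right, h1, mul_neg_one, integral_neg] at h2
    have h3 : (2 : ℂ) * ∫ x in F, planeWave γ x = 0 := by linear_combination -h2
    simpa using h3

end FundamentalDomain

/-! ### Completeness of the plane waves -/

section Completeness

variable {Ω : Submodule ℤ (Space d)}

theorem exists_dualLattice_inner_eq {ι : Type*} [Fintype ι] (b : Module.Basis ι ℝ (Space d))
    (hb : Submodule.span ℤ (Set.range b) = Ω) (n : ι → ℤ) :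
    ∃ γ ∈ dualLattice Ω, ∀ i, (inner ℝ γ (b i) : ℝ) = 2 * Real.pi * n i := by
  classical
  let ℓ : Space d →ₗ[ℝ] ℝ := b.constr ℝ fun i => 2 * Real.pi * (n i : ℝ)
  let γ : Space d := (InnerProductSpace.toDual ℝ (Space d)).symm (LinearMap.toContinuousLinearMap ℓ)
  have hγ : ∀ x, (inner ℝ γ x : ℝ) = ℓ x := fun x => by
    simp [γ]
  have hγb : ∀ i, (inner ℝ γ (b i) : ℝ) = 2 * Real.pi * n i := fun i => by
    rw [hγ]; simp [ℓ]
  refine ⟨γ, ?_, hγb⟩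
  intro ω hω
  rw [← hb] at hω
  induction hω using Submodule.span_induction with
  | mem x hx =>
    obtain ⟨i, rfl⟩ := hx
    exact ⟨n i, hγb i⟩
  | zero => exact ⟨0, by simp⟩
  | add x y _ _ hx hy =>
    obtain ⟨k, hk⟩ := hx
    obtain ⟨l, hl⟩ := hy
    exact ⟨k + l, by rw [inner_add_right, hk, hl]; push_cast; ring⟩
  | smul a x _ hx =>
    obtain ⟨k, hk⟩ := hx
    refine ⟨a * k, ?_⟩
    rw [← Int.cast_smul_eq_zsmul ℝ a x, inner_smul_right, hk]
    push_cast
    ring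

section Torus

-- The Haar measure used by Mathlib's Fourier theory on `UnitAddTorus`.
noncomputable local instance instMeasureSpaceUnitAddCircle : MeasureSpace UnitAddCircle :=
  ⟨AddCircle.haarAddCircle⟩

local instance instIsAddHaarUnitAddCircle :
    Measure.IsAddHaarMeasure (volume : Measure UnitAddCircle) :=
  inferInstanceAs (Measure.IsAddHaarMeasure AddCircle.haarAddCircle)

local instance instIsProbabilityUnitAddCircle :
    IsProbabilityMeasure (volume : Measure UnitAddCircle) :=
  inferInstanceAs (IsProbabilityMeasure AddCircle.haarAddCircle)

/-- A square integrable function on the cube is zero almost everywhere if its Fourier coefficients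
are zero. -/
theorem ae_eq_zero_of_cube_fourier_eq_zero {ι : Type*} [Fintype ι] {g : (ι → ℝ) → ℂ}
    (hg : MemLp g 2 (volume.restrict {x : ι → ℝ | ∀ i, x i ∈ Set.Ioc (0 : ℝ) (0 + 1)}))
    (h0 : ∀ n : ι → ℤ, ∫ x in {x : ι → ℝ | ∀ i, x i ∈ Set.Ioc (0 : ℝ) (0 + 1)},
      UnitAddTorus.mFourier (-n) (fun i => (x i : UnitAddCircle)) * g x = 0) :
    ∫ x in {x : ι → ℝ | ∀ i, x i ∈ Set.Ioc (0 : ℝ) (0 + 1)}, ‖g x‖ ^ 2 = 0 := by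
  set box : Set (ι → ℝ) := {x : ι → ℝ | ∀ i, x i ∈ Set.Ioc (0 : ℝ) (0 + 1)} with hbox
  have hboxm : MeasurableSet box :=
    MeasurableSet.univ_pi' (fun i => measurableSet_Ioc)
  let e := UnitAddTorus.measurableEquivPiIoc (fun _ : ι => (0 : ℝ))
  let G : UnitAddTorus ι → ℂ := fun y => g (e y)
  have hGg : ∀ x ∈ box, G (fun i => (x i : UnitAddCircle)) = g x := by
    intro x hx
    have : e (fun i => (x i : UnitAddCircle)) = ⟨x, hx⟩ := by
      rw [← e.symm.injective.eq_iff, e.symm_apply_apply]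
      rfl
    simp only [G, this]
  have hmp : MeasurePreserving (fun y => ((e y : {x : ι → ℝ // ∀ i, x i ∈ Set.Ioc (0 : ℝ) (0 + 1)}) :
      ι → ℝ)) (volume : Measure (UnitAddTorus ι)) (volume.restrict box) := by
    refine MeasurePreserving.comp (μb := Measure.comap Subtype.val volume) ⟨measurable_subtype_coe, ?_⟩
      (UnitAddTorus.measurePreserving_equivPiIoc (fun _ : ι => (0 : ℝ)))
    exact map_comap_subtype_coe hboxm volume
  have hG : MemLp G 2 volume := hg.comp_measurePreserving hmp
  have hcoeff : ∀ n, UnitAddTorus.mFourierCoeff G n = 0 := by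
    intro n
    rw [UnitAddTorus.mFourierCoeff_eq_integral G n (fun _ => 0), ← h0 n]
    refine setIntegral_congr_fun hboxm fun x hx => ?_
    simp only [smul_eq_mul]
    rw [hGg x hx]
  have hsum := UnitAddTorus.hasSum_sq_mFourierCoeff (hG.toLp G)
  have hc' : ∀ n, UnitAddTorus.mFourierCoeff (hG.toLp G) n = 0 := by
    intro n
    rw [← hcoeff n]
    refine integral_congr_ae ?_
    filter_upwards [hG.coeFn_toLp] with y hy
    rw [hy]
  simp only [hc', norm_zero] at hsum
  have hz : ∫ y, ‖G y‖ ^ 2 = 0 := by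
    have h1 : ∫ y, ‖(hG.toLp G) y‖ ^ 2 = ∫ y, ‖G y‖ ^ 2 := by
      refine integral_congr_ae ?_
      filter_upwards [hG.coeFn_toLp] with y hy
      rw [hy]
    rw [← h1]
    refine hsum.unique ?_
    simp [hasSum_zero]
  rw [UnitAddTorus.integral_preimage _ (fun _ => 0)] at hz
  rw [← hz]
  refine setIntegral_congr_fun hboxm fun x hx => ?_
  rw [hGg x hx]

end Torus

theorem mFourier_eq_conj_planeWave {ι : Type*} [Fintype ι] (b : Module.Basis ι ℝ (Space d))
    (n : ι → ℤ) {γ : Space d} (hγ : ∀ i, (inner ℝ γ (b i) : ℝ) = 2 * Real.pi * n i) (x : ι → ℝ) :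
    UnitAddTorus.mFourier (-n) (fun i => (x i : UnitAddCircle))
      = (starRingEnd ℂ) (planeWave γ (∑ i, x i • b i)) := by
  rw [UnitAddTorus.mFourier_neg, planeWave, inner_sum]
  congr 1
  simp only [UnitAddTorus.mFourier, ContinuousMap.coe_mk, fourier_coe_apply, inner_smul_right, hγ]
  rw [← Complex.exp_sum]
  congr 1
  push_cast
  rw [Finset.mul_sum]
  refine Finset.sum_congr rfl fun i _ => ?_
  ring

variable [DiscreteTopology Ω] [IsZLattice ℝ Ω] {F : Set (Space d)}

/-- A periodic function in `L²(F)` whose Fourier coefficients all vanish is zero almost everywhere.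
In the coordinates of a lattice basis this is the completeness of the exponentials on the
torus. -/
theorem ae_eq_zero_of_planeCoeff_eq_zero (hF : IsAddFundamentalDomain Ω F volume)
    {g : Space d → ℂ} (hper : ∀ ω ∈ Ω, ∀ x, g (x + ω) = g x) (hg : MemLp g 2 (volume.restrict F))
    (h0 : ∀ γ ∈ dualLattice Ω, planeCoeff F g γ = 0) : g =ᵐ[volume.restrict F] 0 := by
  classical
  let b₀ := Module.Free.chooseBasis ℤ Ω
  let b := b₀.ofZLatticeBasis ℝ Ω
  have hb : Submodule.span ℤ (Set.range b) = Ω := b₀.ofZLatticeBasis_span ℝ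
  set P := ZSpan.fundamentalDomain b with hPdef
  have hP : IsAddFundamentalDomain Ω P volume := ZLattice.isAddFundamentalDomain b₀ volume
  have hvadd : ∀ {E : Type} (f : Space d → E), (∀ ω ∈ Ω, ∀ x, f (x + ω) = f x) →
      ∀ (ω : Ω) x, f (ω +ᵥ x) = f x := fun f hf ω x => by
    have := hf ω ω.2 x
    rwa [add_comm] at this
  have hsq : ∀ ω ∈ Ω, ∀ x, ‖g (x + ω)‖ ^ 2 = ‖g x‖ ^ 2 := fun ω hω x => by rw [hper ω hω]
  have hgP : MemLp g 2 (volume.restrict P) := by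
    have hm := (hF.aestronglyMeasurable_on_iff hP (hvadd g hper)).1 hg.1
    rw [memLp_two_iff_integrable_sq_norm hm]
    exact (hF.integrableOn_iff hP (hvadd _ hsq)).1
      ((memLp_two_iff_integrable_sq_norm hg.1).1 hg)
  let T : ((Module.Free.ChooseBasisIndex ℤ Ω) → ℝ) ≃L[ℝ] Space d := b.equivFunL.symm
  have hT : ∀ x, T x = ∑ i, x i • b i := fun x => by
    exact b.equivFun_symm_apply x
  set box : Set ((Module.Free.ChooseBasisIndex ℤ Ω) → ℝ) :=
    {x | ∀ i, x i ∈ Set.Ioc (0 : ℝ) (0 + 1)} with hbox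
  obtain ⟨c, hc0, hct, hc⟩ : ∃ c : ENNReal, c ≠ 0 ∧ c ≠ ⊤ ∧
      Measure.map T (volume : Measure ((Module.Free.ChooseBasisIndex ℤ Ω) → ℝ))
        = c • (volume : Measure (Space d)) := by
    have hH : (Measure.map T (volume : Measure ((Module.Free.ChooseBasisIndex ℤ Ω) → ℝ))
      ).IsAddHaarMeasure := T.isAddHaarMeasure_map _
    exact ⟨_, ENNReal.coe_ne_zero.2
      (Measure.addHaarScalarFactor_pos_of_isAddHaarMeasure _ volume).ne', ENNReal.coe_ne_top,
      Measure.isAddLeftInvariant_eq_smul _ volume⟩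
  have hpre : T ⁻¹' P = Set.pi Set.univ fun _ => Set.Ico (0 : ℝ) 1 := by
    ext x
    simp only [Set.mem_preimage, hPdef, ZSpan.mem_fundamentalDomain, Set.mem_pi, Set.mem_univ,
      true_imp_iff]
    have : ∀ i, b.repr (T x) i = x i := fun i => by
      rw [hT, Module.Basis.repr_sum_self]
    simp only [this]
  have hmap : Measure.map T (volume.restrict box) = c • volume.restrict P := by
    have hae : box =ᵐ[volume] T ⁻¹' P := by
      rw [hpre]
      have : box = Set.pi Set.univ fun _ => Set.Ioc (0 : ℝ) 1 := by
        ext x; simp [hbox]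
      rw [this]
      exact (Measure.univ_pi_Ioc_ae_eq_Icc (f := fun _ => (0 : ℝ)) (g := fun _ => (1 : ℝ))).trans
        (Measure.univ_pi_Ico_ae_eq_Icc (f := fun _ => (0 : ℝ)) (g := fun _ => (1 : ℝ))).symm
    rw [Measure.restrict_congr_set hae, ← Measure.restrict_smul, ← hc,
      Measure.restrict_map T.continuous.measurable (ZSpan.fundamentalDomain_measurableSet b)]
  have hTm : MeasurableEmbedding T := T.toHomeomorph.measurableEmbedding
  have hint : ∀ {E : Type} [NormedAddCommGroup E] [NormedSpace ℝ E] (f : Space d → E),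
      ∫ x in box, f (T x) = c.toReal • ∫ x in P, f x := by
    intro E _ _ f
    rw [← hTm.integral_map, hmap, integral_smul_measure]
  have hmem : MemLp (g ∘ T) 2 (volume.restrict box) := by
    rw [← hTm.memLp_map_measure_iff, hmap]
    exact hgP.smul_measure hct
  have hzero := ae_eq_zero_of_cube_fourier_eq_zero hmem (fun n => by
    obtain ⟨γ, hγ, hγn⟩ := exists_dualLattice_inner_eq b hb n
    have h1 : ∀ x, UnitAddTorus.mFourier (-n) (fun i => (x i : UnitAddCircle)) * (g ∘ T) x
        = g (T x) * (starRingEnd ℂ) (planeWave γ (T x)) := fun x => by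
      rw [mFourier_eq_conj_planeWave b n hγn, hT, mul_comm, ← hT]
      rfl
    simp only [h1]
    rw [hint (fun x => g x * (starRingEnd ℂ) (planeWave γ x)), ← hF.setIntegral_eq hP]
    · have := h0 γ hγ
      rw [planeCoeff] at this
      rw [this, smul_zero]
    · refine hvadd (fun x => g x * (starRingEnd ℂ) (planeWave γ x)) fun ω hω x => ?_
      rw [hper ω hω, planeWave_add_right, planeWave_eq_one hγ hω, mul_one])
  simp only [Function.comp_apply] at hzero
  rw [hint (fun x => ‖g x‖ ^ 2), ← hF.setIntegral_eq hP (hvadd _ hsq)] at hzero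
  have hz : ∫ x in F, ‖g x‖ ^ 2 = 0 := by
    rcases smul_eq_zero.1 hzero with h | h
    · exact absurd h (ENNReal.toReal_pos hc0 hct).ne'
    · exact h
  rw [integral_eq_zero_iff_of_nonneg (fun _ => by positivity)
    ((memLp_two_iff_integrable_sq_norm hg.1).1 hg)] at hz
  filter_upwards [hz] with x hx
  simpa using hx

end Completeness

/-! ### Eigenvectors of a convolution matrix with a diagonal part -/

section Convolution

variable {G : Type*} [AddCommGroup G] {a : G → ℂ} {M : ℝ}

theorem tsum_norm_sub_left (a : G → ℂ) (k : G) : ∑' l, ‖a (k - l)‖ = ∑' l, ‖a l‖ :=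
  (Equiv.subLeft k).tsum_eq fun l => ‖a l‖

theorem sum_norm_sub_left_le (ha : Summable fun g => ‖a g‖) (hM : ∑' g, ‖a g‖ ≤ M) (T : Finset G)
    (k : G) : ∑ l ∈ T, ‖a (k - l)‖ ≤ M := by
  refine le_trans (Summable.sum_le_tsum (f := fun l => ‖a (k - l)‖) T (fun _ _ => norm_nonneg _)
    ((Equiv.subLeft k).summable_iff.2 ha)) ?_
  rwa [tsum_norm_sub_left]

theorem sum_norm_sub_right_le (ha : Summable fun g => ‖a g‖) (hM : ∑' g, ‖a g‖ ≤ M) (T : Finset G)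
    (k : G) : ∑ l ∈ T, ‖a (l - k)‖ ≤ M := by
  refine le_trans (Summable.sum_le_tsum (f := fun l => ‖a (l - k)‖) T (fun _ _ => norm_nonneg _)
    ((Equiv.subRight k).summable_iff.2 ha)) ?_
  have h := (Equiv.subRight k).tsum_eq fun l => ‖a l‖
  simp only [Equiv.subRight_apply] at h
  rwa [h]

/-- Schur's test for a truncated convolution. -/
theorem sum_sq_norm_convolution_le (ha : Summable fun g => ‖a g‖) (hM : ∑' g, ‖a g‖ ≤ M)
    (S : Finset G) (v : G → ℂ) :
    ∑ k ∈ S, ‖∑ l ∈ S, a (k - l) * v l‖ ^ 2 ≤ M ^ 2 * ∑ l ∈ S, ‖v l‖ ^ 2 := by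
  have hM0 : 0 ≤ M := (tsum_nonneg fun _ => norm_nonneg _).trans hM
  have h1 : ∀ k, ‖∑ l ∈ S, a (k - l) * v l‖ ^ 2 ≤ M * ∑ l ∈ S, ‖a (k - l)‖ * ‖v l‖ ^ 2 := by
    intro k
    have hle : ‖∑ l ∈ S, a (k - l) * v l‖ ≤ ∑ l ∈ S, ‖a (k - l)‖ * ‖v l‖ :=
      norm_sum_le_of_le _ fun l _ => (norm_mul _ _).le
    calc ‖∑ l ∈ S, a (k - l) * v l‖ ^ 2 ≤ (∑ l ∈ S, ‖a (k - l)‖ * ‖v l‖) ^ 2 := by gcongr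
      _ ≤ (∑ l ∈ S, ‖a (k - l)‖) * ∑ l ∈ S, ‖a (k - l)‖ * ‖v l‖ ^ 2 :=
          Finset.sum_sq_le_sum_mul_sum_of_sq_le_mul _ (fun _ _ => norm_nonneg _)
            (fun _ _ => by positivity) (fun _ _ => (by ring : _ = _).le)
      _ ≤ _ := by
          gcongr
          exact sum_norm_sub_left_le ha hM S k
  calc _ ≤ ∑ k ∈ S, M * ∑ l ∈ S, ‖a (k - l)‖ * ‖v l‖ ^ 2 := Finset.sum_le_sum fun k _ => h1 k
    _ = M * ∑ l ∈ S, (∑ k ∈ S, ‖a (k - l)‖) * ‖v l‖ ^ 2 := by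
        rw [← Finset.mul_sum, Finset.sum_comm]
        simp only [Finset.sum_mul]
    _ ≤ M * ∑ l ∈ S, M * ‖v l‖ ^ 2 := by
        gcongr with l _
        exact sum_norm_sub_right_le ha hM S l
    _ = _ := by rw [← Finset.mul_sum]; ring

/-- Eigenvectors of a finite section with an eigenvalue near `D g₀` and a large component at `g₀`.
The eigenvectors with eigenvalue outside the window carry at most half of the mass of the unit
vector at `g₀`. An eigenvector with eigenvalue in the window has most of its mass on the at most
`N` sites where `D` is near `D g₀`, so there are at most `4 N / 3` of them. -/
theorem exists_eigenvector_finite_section (ha : Summable fun g => ‖a g‖)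
    (haconj : ∀ g, a (-g) = (starRingEnd ℂ) (a g)) (hM : ∑' g, ‖a g‖ ≤ M) (hM0 : 0 < M)
    (D : G → ℝ) {W N : ℝ} (hW : 2 * M ≤ W) (hN0 : 0 < N) (g₀ : G)
    (hN : ∀ T : Finset G, (∀ k ∈ T, |D k - D g₀| ≤ W + 2 * M) → (T.card : ℝ) ≤ N)
    (S : Finset G) (hS : g₀ ∈ S) :
    ∃ (l : ℝ) (v : G → ℂ), |l - D g₀| ≤ W ∧ (∀ k ∉ S, v k = 0) ∧ ∑ k ∈ S, ‖v k‖ ^ 2 = 1 ∧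
      3 / (8 * N) ≤ ‖v g₀‖ ^ 2 ∧
      ∀ k ∈ S, ((l - D k : ℝ) : ℂ) * v k = ∑ j ∈ S, a (k - j) * v j := by
  classical
  let A : Matrix S S ℂ := Matrix.of fun i j => (if i = j then (D i : ℂ) else 0) + a (i - j)
  have hAij : ∀ i j, A i j = (if i = j then (D i : ℂ) else 0) + a (i - j) := fun _ _ => rfl
  have hA : A.IsHermitian := by
    refine Matrix.IsHermitian.ext fun i j => ?_
    simp only [hAij, star_add, RCLike.star_def]
    rw [← haconj, neg_sub]
    congr 1
    by_cases h : i = j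
    · subst h; simp
    · rw [if_neg h, if_neg (Ne.symm h), map_zero]
  let w : S → EuclideanSpace ℂ S := fun j => hA.eigenvectorBasis j
  let μ : S → ℝ := hA.eigenvalues
  let i₀ : S := ⟨g₀, hS⟩
  have hw1 : ∀ j, ∑ k, ‖w j k‖ ^ 2 = 1 := by
    intro j
    rw [← EuclideanSpace.norm_sq_eq]
    simp [w]
  have hpars : ∀ r : EuclideanSpace ℂ S, ∑ j, ‖inner ℂ (w j) r‖ ^ 2 = ‖r‖ ^ 2 := fun r =>
    hA.eigenvectorBasis.sum_sq_norm_inner_right r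
  have hw2 : ∀ k, ∑ j, ‖w j k‖ ^ 2 = 1 := by
    intro k
    have := hpars (EuclideanSpace.single k 1)
    simpa [EuclideanSpace.inner_single_right] using this
  have heig : ∀ j (k : S), ((μ j - D k : ℝ) : ℂ) * w j k = ∑ l : S, a (k - l) * w j l := by
    intro j k
    have h1 := congrFun (hA.mulVec_eigenvectorBasis j) k
    simp only [Matrix.mulVec, dotProduct, hAij, add_mul, Finset.sum_add_distrib, ite_mul, zero_mul,
      Finset.sum_ite_eq, Finset.mem_univ, if_true, Pi.smul_apply, Complex.real_smul] at h1
    push_cast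
    linear_combination -h1
  have hfar : ∑ j, (μ j - D g₀) ^ 2 * ‖w j i₀‖ ^ 2 ≤ M ^ 2 := by
    let r : EuclideanSpace ℂ S := WithLp.toLp 2 fun l : S => a (l - g₀)
    have h1 : ∀ j, inner ℂ (w j) r = (starRingEnd ℂ) (((μ j - D g₀ : ℝ) : ℂ) * w j i₀) := by
      intro j
      have := heig j i₀
      rw [this, PiLp.inner_apply, map_sum]
      refine Finset.sum_congr rfl fun l _ => ?_
      simp only [r, RCLike.inner_apply, map_mul]
      rw [← haconj, neg_sub]
    have h2 := hpars r
    simp only [h1, RCLike.norm_conj, norm_mul, Complex.norm_real, mul_pow, Real.norm_eq_abs,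
      sq_abs] at h2
    rw [h2, EuclideanSpace.norm_sq_eq]
    have h3 : ∑ l : S, ‖a (l - g₀)‖ ≤ M := by
      rw [Finset.sum_coe_sort S fun l => ‖a (l - g₀)‖]
      exact sum_norm_sub_right_le ha hM S g₀
    calc ∑ l : S, ‖a (l - g₀)‖ ^ 2 ≤ (∑ l : S, ‖a (l - g₀)‖) ^ 2 :=
          Finset.sum_sq_le_sq_sum_of_nonneg fun _ _ => norm_nonneg _
      _ ≤ M ^ 2 := by
          gcongr
  have hconv : ∀ j, ∑ k : S, (μ j - D k) ^ 2 * ‖w j k‖ ^ 2 ≤ M ^ 2 := by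
    intro j
    let v : G → ℂ := fun k => if h : k ∈ S then w j ⟨k, h⟩ else 0
    have hv : ∀ k : S, v k = w j k := fun k => by simp [v]
    have h1 := sum_sq_norm_convolution_le ha hM S v
    rw [← Finset.sum_coe_sort S, ← Finset.sum_coe_sort S fun l => ‖v l‖ ^ 2] at h1
    simp only [hv, hw1, mul_one] at h1
    refine le_trans (le_of_eq ?_) h1
    refine Finset.sum_congr rfl fun k _ => ?_
    rw [← Finset.sum_coe_sort S]
    simp only [hv]
    rw [← heig, norm_mul, mul_pow, Complex.norm_real, Real.norm_eq_abs, sq_abs]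
  set J : Finset S := Finset.univ.filter fun j => |μ j - D g₀| ≤ W with hJ
  set T : Finset S := Finset.univ.filter fun k => |D k - D g₀| ≤ W + 2 * M with hT
  have hTN : (T.card : ℝ) ≤ N := by
    have h1 := hN (T.map (Function.Embedding.subtype _)) (fun k hk => by
      simp only [Finset.mem_map, hT, Finset.mem_filter] at hk
      obtain ⟨k', hk', rfl⟩ := hk
      exact hk'.2)
    rwa [Finset.card_map] at h1
  have hnear : ∀ j ∈ J, 3 / 4 ≤ ∑ k ∈ T, ‖w j k‖ ^ 2 := by
    intro j hj
    have hj : |μ j - D g₀| ≤ W := (Finset.mem_filter.1 hj).2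
    have h1 : ∑ k ∈ Finset.univ.filter (fun k : S => ¬ |D k - D g₀| ≤ W + 2 * M),
        (4 * M ^ 2) * ‖w j k‖ ^ 2 ≤ M ^ 2 := by
      refine le_trans (Finset.sum_le_sum fun k hk => ?_)
        ((Finset.sum_le_sum_of_subset_of_nonneg (Finset.filter_subset _ _)
          fun _ _ _ => by positivity).trans (hconv j))
      have hk := (Finset.mem_filter.1 hk).2
      rw [not_le] at hk
      have h2 : 2 * M ≤ |μ j - D k| := by
        have := abs_sub_abs_le_abs_sub (D k - D g₀) (μ j - D g₀)
        rw [sub_sub_sub_cancel_right] at this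
        rw [abs_sub_comm (μ j)]
        linarith
      gcongr
      rw [← sq_abs (μ j - D k)]
      nlinarith
    rw [← Finset.mul_sum] at h1
    have h2 := hw1 j
    rw [← Finset.sum_filter_add_sum_filter_not Finset.univ
      (fun k : S => |D k - D g₀| ≤ W + 2 * M)] at h2
    have h3 : ∑ k ∈ Finset.univ.filter (fun k : S => ¬ |D k - D g₀| ≤ W + 2 * M),
        ‖w j k‖ ^ 2 ≤ 1 / 4 := by
      have : 0 < M ^ 2 := by positivity
      nlinarith
    linarith
  have hJcard : 3 / 4 * (J.card : ℝ) ≤ N := by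
    calc 3 / 4 * (J.card : ℝ) = ∑ j ∈ J, (3 / 4 : ℝ) := by simp [mul_comm]
      _ ≤ ∑ j ∈ J, ∑ k ∈ T, ‖w j k‖ ^ 2 := Finset.sum_le_sum hnear
      _ = ∑ k ∈ T, ∑ j ∈ J, ‖w j k‖ ^ 2 := Finset.sum_comm
      _ ≤ ∑ k ∈ T, 1 := by
          refine Finset.sum_le_sum fun k _ => ?_
          rw [← hw2 k]
          exact Finset.sum_le_sum_of_subset_of_nonneg (Finset.filter_subset _ _)
            fun _ _ _ => by positivity
      _ ≤ N := by simpa using hTN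
  have hJmass : 1 / 2 ≤ ∑ j ∈ J, ‖w j i₀‖ ^ 2 := by
    have h1 : ∑ j ∈ Finset.univ.filter (fun j : S => ¬ |μ j - D g₀| ≤ W),
        (2 * M ^ 2) * ‖w j i₀‖ ^ 2 ≤ M ^ 2 := by
      refine le_trans (Finset.sum_le_sum fun j hj => ?_)
        ((Finset.sum_le_sum_of_subset_of_nonneg (Finset.filter_subset _ _)
          fun _ _ _ => by positivity).trans hfar)
      have hj := (Finset.mem_filter.1 hj).2
      rw [not_le] at hj
      gcongr
      rw [← sq_abs (μ j - D g₀)]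
      nlinarith
    rw [← Finset.mul_sum] at h1
    have h2 := hw2 i₀
    rw [← Finset.sum_filter_add_sum_filter_not Finset.univ
      (fun j : S => |μ j - D g₀| ≤ W)] at h2
    have h3 : ∑ j ∈ Finset.univ.filter (fun j : S => ¬ |μ j - D g₀| ≤ W),
        ‖w j i₀‖ ^ 2 ≤ 1 / 2 := by
      have : 0 < M ^ 2 := by positivity
      nlinarith
    linarith
  have hJne : J.Nonempty := by
    by_contra h
    rw [Finset.not_nonempty_iff_eq_empty] at h
    rw [h, Finset.sum_empty] at hJmass
    linarith
  obtain ⟨j, hj, hjle⟩ := Finset.exists_le_of_sum_le (f := fun _ => 3 / (8 * N)) hJne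
    (le_trans (by
      rw [Finset.sum_const, nsmul_eq_mul, mul_div_assoc', div_le_iff₀ (by positivity)]
      linarith : ∑ j ∈ J, 3 / (8 * N) ≤ 1 / 2) hJmass)
  let v : G → ℂ := fun k => if h : k ∈ S then w j ⟨k, h⟩ else 0
  have hv : ∀ k : S, v k = w j k := fun k => by simp [v]
  refine ⟨μ j, v, (Finset.mem_filter.1 hj).2, fun k hk => by simp [v, hk], ?_, ?_, ?_⟩
  · rw [← Finset.sum_coe_sort S]
    simp only [hv, hw1]
  · exact (hv i₀).symm ▸ hjle
  · intro k hk
    rw [← Finset.sum_coe_sort S]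
    simp only [hv]
    rw [← heig j ⟨k, hk⟩]
    simp [v, hk]

/-- The infinite matrix `D k δ_{kj} + a (k - j)` has an eigenvector in `ℓ²` with an eigenvalue near
`D g₀` and a large component at `g₀`: it is a limit of eigenvectors of finite sections along an
ultrafilter. The lower bound at `g₀` prevents the limit from vanishing. -/
theorem exists_eigenvector_convolution (ha : Summable fun g => ‖a g‖)
    (haconj : ∀ g, a (-g) = (starRingEnd ℂ) (a g)) (hM : ∑' g, ‖a g‖ ≤ M) (hM0 : 0 < M)
    (D : G → ℝ) {W N : ℝ} (hW : 2 * M ≤ W) (hN0 : 0 < N) (g₀ : G)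
    (hN : ∀ T : Finset G, (∀ k ∈ T, |D k - D g₀| ≤ W + 2 * M) → (T.card : ℝ) ≤ N) :
    ∃ (l : ℝ) (u : G → ℂ), |l - D g₀| ≤ W ∧ HasSum (fun k => ‖u k‖ ^ 2) 1 ∧
      3 / (8 * N) ≤ ‖u g₀‖ ^ 2 ∧ ∀ k, ((l - D k : ℝ) : ℂ) * u k = ∑' j, a (k - j) * u j := by
  classical
  have hex := fun S : Finset G => exists_eigenvector_finite_section ha haconj hM hM0 D hW hN0 g₀ hN
    (insert g₀ S) (Finset.mem_insert_self _ _)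
  choose l v hl hv0 hv1 hvg hveq using hex
  have hfin : ∀ S (T : Finset G), ∑ k ∈ T, ‖v S k‖ ^ 2 ≤ 1 := by
    intro S T
    rw [← hv1 S]
    calc ∑ k ∈ T, ‖v S k‖ ^ 2 = ∑ k ∈ T with k ∈ insert g₀ S, ‖v S k‖ ^ 2 := by
          rw [Finset.sum_filter_of_ne]
          intro k _ hk
          by_contra h
          exact hk (by simp [hv0 S k h])
      _ ≤ _ := Finset.sum_le_sum_of_subset_of_nonneg
          (fun k hk => (Finset.mem_filter.1 hk).2) fun _ _ _ => by positivity
  have hbd : ∀ S k, ‖v S k‖ ≤ 1 := by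
    intro S k
    have := hfin S {k}
    rw [Finset.sum_singleton] at this
    exact (sq_le_one_iff₀ (norm_nonneg _)).1 this
  let U : Ultrafilter (Finset G) := Ultrafilter.of Filter.atTop
  have hU : (U : Filter (Finset G)) ≤ Filter.atTop := Ultrafilter.of_le _
  obtain ⟨L, hL, hLlim⟩ := (isCompact_Icc (a := D g₀ - W) (b := D g₀ + W)).ultrafilter_le_nhds
    (U.map l) (by
      rw [Filter.le_principal_iff]
      refine Filter.mem_map.2 (Filter.univ_mem' fun S => ?_)
      have := abs_le.1 (hl S)
      exact ⟨by linarith, by linarith⟩)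
  have hulim : ∀ k, ∃ z : ℂ, Filter.Tendsto (fun S => v S k) U (nhds z) := by
    intro k
    obtain ⟨z, -, hz⟩ := (isCompact_closedBall (0 : ℂ) 1).ultrafilter_le_nhds
      (U.map fun S => v S k) (by
        rw [Filter.le_principal_iff]
        exact Filter.mem_map.2 (Filter.univ_mem' fun S => by simpa using hbd S k))
    exact ⟨z, hz⟩
  choose u hu using hulim
  have hLlim : Filter.Tendsto l U (nhds L) := hLlim
  have hufin : ∀ T : Finset G, ∑ k ∈ T, ‖u k‖ ^ 2 ≤ 1 := fun T =>
    le_of_tendsto (tendsto_finsetSum T fun k _ => ((hu k).norm.pow 2))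
      (Filter.Eventually.of_forall fun S => hfin S T)
  have husum : Summable fun k => ‖u k‖ ^ 2 :=
    summable_of_sum_le (fun _ => by positivity) hufin
  have hug : 3 / (8 * N) ≤ ‖u g₀‖ ^ 2 :=
    ge_of_tendsto ((hu g₀).norm.pow 2) (Filter.Eventually.of_forall fun S => hvg S)
  have hueq : ∀ k, ((L - D k : ℝ) : ℂ) * u k = ∑' j, a (k - j) * u j := by
    intro k
    have h1 : Filter.Tendsto (fun S => ∑' j, a (k - j) * v S j) U
        (nhds (∑' j, a (k - j) * u j)) := by
      refine tendsto_tsum_of_dominated_convergence (bound := fun j => ‖a (k - j)‖)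
        ((Equiv.subLeft k).summable_iff.2 ha) (fun j => (hu j).const_mul _)
        (Filter.Eventually.of_forall fun S j => ?_)
      rw [norm_mul]
      exact mul_le_of_le_one_right (norm_nonneg _) (hbd S j)
    have h2 : Filter.Tendsto (fun S => ((l S - D k : ℝ) : ℂ) * v S k) U
        (nhds (((L - D k : ℝ) : ℂ) * u k)) :=
      ((Complex.continuous_ofReal.tendsto _).comp (hLlim.sub_const (D k))).mul (hu k)
    refine tendsto_nhds_unique (h2.congr' ?_) h1
    have hev : ∀ᶠ S in (U : Filter (Finset G)), k ∈ S :=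
      hU (Filter.mem_atTop_sets.2 ⟨{k}, fun S hS => hS (Finset.mem_singleton_self k)⟩)
    filter_upwards [hev] with S hS
    rw [hveq S k (Finset.mem_insert_of_mem hS), tsum_eq_sum]
    intro j hj
    rw [hv0 S j hj, mul_zero]
  set n : ℝ := ∑' k, ‖u k‖ ^ 2 with hn
  have hn1 : n ≤ 1 := husum.tsum_le_of_sum_le hufin
  have hn0 : 0 < n := lt_of_lt_of_le (by positivity) (hug.trans
    (husum.le_tsum g₀ fun _ _ => by positivity))
  have hsn : 0 < √n := Real.sqrt_pos.2 hn0
  have hnorm : ∀ k, ‖((√n : ℝ) : ℂ)⁻¹ * u k‖ ^ 2 = ‖u k‖ ^ 2 / n := by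
    intro k
    rw [norm_mul, norm_inv, Complex.norm_real, Real.norm_of_nonneg hsn.le, mul_pow, inv_pow,
      Real.sq_sqrt hn0.le, ← div_eq_inv_mul]
  refine ⟨L, fun k => ((√n : ℝ) : ℂ)⁻¹ * u k, abs_le.2 ⟨by linarith [hL.1], by linarith [hL.2]⟩,
    ?_, ?_, fun k => ?_⟩
  · simp only [hnorm]
    have := husum.hasSum.div_const n
    rwa [← hn, div_self hn0.ne'] at this
  · rw [hnorm]
    refine hug.trans ?_
    rw [le_div_iff₀ hn0]
    exact mul_le_of_le_one_right (by positivity) hn1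
  · rw [mul_left_comm, hueq k, ← tsum_mul_left]
    exact tsum_congr fun j => by ring

end Convolution

/-! ### Absolutely convergent series of plane waves -/

section PlaneSeries

/-- The quasiperiodic function `∑_γ u_γ e^{i⟨γ + t, x⟩}` with coefficients on the dual lattice. -/
noncomputable def planeSeries {Ω : Submodule ℤ (Space d)} (u : dualLattice Ω → ℂ) (t x : Space d) :
    ℂ := ∑' γ : dualLattice Ω, u γ * planeWave ((γ : Space d) + t) x

variable {Ω : Submodule ℤ (Space d)} {u : dualLattice Ω → ℂ} {t : Space d}

theorem norm_planeSeries_le (hu : Summable fun γ => ‖u γ‖) (x : Space d) :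
    ‖planeSeries u t x‖ ≤ ∑' γ, ‖u γ‖ := by
  refine tsum_of_norm_bounded hu.hasSum fun γ => ?_
  rw [norm_mul, norm_planeWave, mul_one]

theorem continuous_planeSeries (hu : Summable fun γ => ‖u γ‖) : Continuous (planeSeries u t) := by
  refine continuous_tsum (fun γ => continuous_const.mul (continuous_planeWave _)) hu fun γ x => ?_
  rw [norm_mul, norm_planeWave, mul_one]

theorem isQuasiperiodic_planeSeries : IsQuasiperiodic Ω t (planeSeries u t) := by
  intro ω hω x
  rw [planeSeries, planeSeries, ← tsum_mul_left]
  refine tsum_congr fun γ => ?_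
  rw [isQuasiperiodic_planeWave γ.2 t ω hω x]
  ring

variable [DiscreteTopology Ω] [IsZLattice ℝ Ω] {F : Set (Space d)}

theorem countable_dualLattice : Countable (dualLattice Ω) := by
  have h : ((dualLattice Ω : Set (Space d)) ⊆ ⋃ n : ℕ, insert 0 (dualBall Ω n)) := by
    intro γ hγ
    obtain ⟨n, hn⟩ := exists_nat_gt ‖γ‖
    refine Set.mem_iUnion.2 ⟨n, ?_⟩
    by_cases h0 : γ = 0
    · exact Or.inl h0
    · exact Or.inr ⟨hγ, norm_pos_iff.2 h0, hn⟩
  exact ((Set.countable_iUnion fun n : ℕ =>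
    (((dualBall_finite Ω n).insert 0).countable)).mono h).to_subtype

theorem integral_planeSeries_mul (hu : Summable fun γ => ‖u γ‖) {h : Space d → ℂ}
    (hh : Integrable h (volume.restrict F)) :
    ∫ x in F, planeSeries u t x * h x = ∑' γ, u γ * ∫ x in F, planeWave ((γ : Space d) + t) x * h x := by
  have := countable_dualLattice (Ω := Ω)
  have hint : ∀ γ : dualLattice Ω, Integrable (fun x => u γ * (planeWave ((γ : Space d) + t) x * h x))
      (volume.restrict F) := fun γ =>
    (hh.bdd_mul (c := 1) (continuous_planeWave _).aestronglyMeasurable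
      (Filter.Eventually.of_forall fun x => (norm_planeWave _ x).le)).const_mul _
  have hnorm : ∀ γ : dualLattice Ω, ∫ x in F, ‖u γ * (planeWave ((γ : Space d) + t) x * h x)‖
      = ‖u γ‖ * ∫ x in F, ‖h x‖ := fun γ => by
    simp only [norm_mul, norm_planeWave, one_mul]
    rw [integral_const_mul]
  have key := integral_tsum_of_summable_integral_norm hint (by
    simp only [hnorm]
    exact hu.mul_right _)
  simp only [integral_const_mul] at key
  rw [key]
  refine integral_congr_ae (Filter.Eventually.of_forall fun x => ?_)
  simp only [planeSeries]
  rw [← tsum_mul_right]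
  exact tsum_congr fun γ => by ring

theorem integrable_of_continuous_of_bounded (hF1 : volume F = 1) {h : Space d → ℂ}
    (hc : Continuous h) {C : ℝ} (hb : ∀ x, ‖h x‖ ≤ C) : Integrable h (volume.restrict F) := by
  have := isProbabilityMeasure_restrict hF1
  exact Integrable.of_bound hc.aestronglyMeasurable C (Filter.Eventually.of_forall hb)

theorem planeCoeff_planeSeries (hF : IsAddFundamentalDomain Ω F volume) (hF1 : volume F = 1)
    (hu : Summable fun γ => ‖u γ‖) (γ : dualLattice Ω) :
    planeCoeff F (planeSeries u t) ((γ : Space d) + t) = u γ := by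
  classical
  have h1 : Integrable (fun x => (starRingEnd ℂ) (planeWave ((γ : Space d) + t) x)) (volume.restrict F) :=
    integrable_of_continuous_of_bounded hF1 (Complex.continuous_conj.comp (continuous_planeWave _))
      (C := 1) fun x => by rw [RCLike.norm_conj, norm_planeWave]
  rw [planeCoeff, integral_planeSeries_mul hu h1]
  have h2 : ∀ γ' : dualLattice Ω, ∫ x in F, planeWave ((γ' : Space d) + t) x *
      (starRingEnd ℂ) (planeWave ((γ : Space d) + t) x) = if γ' = γ then 1 else 0 := by
    intro γ'
    simp only [planeWave_mul_conj, add_sub_add_right_eq_sub]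
    rw [integral_planeWave hF hF1 (sub_mem γ'.2 γ.2)]
    by_cases h : γ' = γ
    · rw [if_pos (by rw [h, sub_self]), if_pos h]
    · rw [if_neg fun h' => h (Subtype.ext (sub_eq_zero.1 h')), if_neg h]
  simp [h2]

theorem integral_norm_sq_planeSeries (hF : IsAddFundamentalDomain Ω F volume)
    (hF1 : volume F = 1) (hu : Summable fun γ => ‖u γ‖) :
    ∫ x in F, ‖planeSeries u t x‖ ^ 2 = ∑' γ, ‖u γ‖ ^ 2 := by
  have h1 : Integrable (fun x => (starRingEnd ℂ) (planeSeries u t x)) (volume.restrict F) :=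
    integrable_of_continuous_of_bounded hF1
      (Complex.continuous_conj.comp (continuous_planeSeries hu)) fun x => by
        rw [RCLike.norm_conj]; exact norm_planeSeries_le hu x
  have h2 := integral_planeSeries_mul (t := t) hu h1
  have h3 : ∀ γ : dualLattice Ω, ∫ x in F, planeWave ((γ : Space d) + t) x *
      (starRingEnd ℂ) (planeSeries u t x) = (starRingEnd ℂ) (u γ) := by
    intro γ
    rw [← planeCoeff_planeSeries (t := t) hF hF1 hu γ, planeCoeff, ← integral_conj]
    refine integral_congr_ae (Filter.Eventually.of_forall fun x => ?_)
    simp only [map_mul, Complex.conj_conj]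
    ring
  simp only [h3, Complex.mul_conj, Complex.normSq_eq_norm_sq] at h2
  have h4 : ∫ x in F, ((‖planeSeries u t x‖ ^ 2 : ℝ) : ℂ)
      = ((∫ x in F, ‖planeSeries u t x‖ ^ 2 : ℝ) : ℂ) := integral_ofReal
  rw [h4, ← Complex.ofReal_tsum] at h2
  exact_mod_cast h2

theorem eq_planeSeries_of_planeCoeff_eq (hF : IsAddFundamentalDomain Ω F volume)
    (hF1 : volume F = 1) (hu : Summable fun γ => ‖u γ‖) {f : Space d → ℂ}
    (hf : IsQuasiperiodic Ω t f) (hf2 : MemLp f 2 (volume.restrict F))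
    (hfu : ∀ γ : dualLattice Ω, planeCoeff F f ((γ : Space d) + t) = u γ) :
    f =ᵐ[volume.restrict F] planeSeries u t := by
  have hprob := isProbabilityMeasure_restrict hF1
  have hs2 : MemLp (planeSeries u t) 2 (volume.restrict F) :=
    MemLp.of_bound (continuous_planeSeries hu).aestronglyMeasurable (∑' γ, ‖u γ‖)
      (Filter.Eventually.of_forall fun x => norm_planeSeries_le hu x)
  have hdiff : IsQuasiperiodic Ω t (fun x => f x - planeSeries u t x) := fun ω hω x => by
    beta_reduce
    rw [hf ω hω x, isQuasiperiodic_planeSeries ω hω x, mul_sub]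
  have ht : IsQuasiperiodic Ω t (planeWave t) := fun ω _ x => by
    rw [planeWave_add_right, mul_comm]
  have hsub := hf2.sub hs2
  -- Multiplication by `e^{-i⟨t, x⟩}` reduces to the periodic case.
  have hz := ae_eq_zero_of_planeCoeff_eq_zero hF
    (g := fun x => (f x - planeSeries u t x) * (starRingEnd ℂ) (planeWave t x))
    (fun ω hω x => hdiff.mul_conj ht hω x) (by
      refine hsub.of_le (hsub.1.mul
        (Complex.continuous_conj.comp (continuous_planeWave t)).aestronglyMeasurable)
        (Filter.Eventually.of_forall fun x => ?_)
      rw [norm_mul, RCLike.norm_conj, norm_planeWave, mul_one, Pi.sub_apply]) (by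
      intro γ hγ
      have e : ∀ x, (f x - planeSeries u t x) * (starRingEnd ℂ) (planeWave t x)
          * (starRingEnd ℂ) (planeWave γ x) = f x * (starRingEnd ℂ) (planeWave (γ + t) x)
            - planeSeries u t x * (starRingEnd ℂ) (planeWave (γ + t) x) := fun x => by
        rw [planeWave_add_left, map_mul]; ring
      have hi : ∀ {h : Space d → ℂ}, MemLp h 2 (volume.restrict F) →
          Integrable (fun x => h x * (starRingEnd ℂ) (planeWave (γ + t) x)) (volume.restrict F) :=
        fun hh => (hh.integrable one_le_two).mul_bdd (c := 1)
          (Complex.continuous_conj.comp (continuous_planeWave _)).aestronglyMeasurable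
          (Filter.Eventually.of_forall fun x => by
            simp [norm_planeWave])
      have h1 := hfu ⟨γ, hγ⟩
      have h2 := planeCoeff_planeSeries (t := t) hF hF1 hu ⟨γ, hγ⟩
      simp only [planeCoeff] at h1 h2 ⊢
      simp only [e]
      rw [integral_sub (hi hf2) (hi hs2), h1, h2, sub_self])
  filter_upwards [hz] with x hx
  have h1 : (starRingEnd ℂ) (planeWave t x) ≠ 0 := by
    rw [← norm_pos_iff, RCLike.norm_conj, norm_planeWave]
    exact one_pos
  simp only [Pi.zero_apply, mul_eq_zero, h1, or_false] at hx
  exact sub_eq_zero.1 hx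

/-- A periodic potential with summable Fourier coefficients is the sum of its Fourier series. -/
theorem potential_ae_eq_planeSeries (hF : IsAddFundamentalDomain Ω F volume)
    (hF1 : volume F = 1) {q : Space d → ℝ} (hper : ∀ ω ∈ Ω, ∀ x, q (x + ω) = q x)
    (hq2 : MemLp q 2 (volume.restrict F))
    (hsum : Summable fun γ : dualLattice Ω => ‖potCoeff F q γ‖) :
    (fun x => (q x : ℂ)) =ᵐ[volume.restrict F]
      planeSeries (fun γ : dualLattice Ω => potCoeff F q γ) 0 := by
  refine eq_planeSeries_of_planeCoeff_eq hF hF1 hsum (fun ω hω x => ?_) hq2.ofReal fun γ => ?_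
  · simp [hper ω hω x, planeWave]
  · rw [add_zero]; rfl

/-- The Fourier coefficients of `q f` are the convolution of those of `q` and `f`. -/
theorem integral_potential_mul (hF : IsAddFundamentalDomain Ω F volume)
    (hF1 : volume F = 1) {q : Space d → ℝ} (hper : ∀ ω ∈ Ω, ∀ x, q (x + ω) = q x)
    (hq2 : MemLp q 2 (volume.restrict F))
    (hsum : Summable fun γ : dualLattice Ω => ‖potCoeff F q γ‖) {f : Space d → ℂ}
    (hf : Integrable f (volume.restrict F)) (v : Space d) :
    ∫ x in F, (q x : ℂ) * (f x * (starRingEnd ℂ) (planeWave v x))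
      = ∑' γ : dualLattice Ω, potCoeff F q γ * planeCoeff F f (v - γ) := by
  have h1 : Integrable (fun x => f x * (starRingEnd ℂ) (planeWave v x)) (volume.restrict F) :=
    hf.mul_bdd (c := 1) (Complex.continuous_conj.comp (continuous_planeWave _)).aestronglyMeasurable
      (Filter.Eventually.of_forall fun x => by simp [norm_planeWave])
  have h2 := integral_planeSeries_mul (t := 0) hsum h1
  have h3 : ∫ x in F, (q x : ℂ) * (f x * (starRingEnd ℂ) (planeWave v x))
      = ∫ x in F, planeSeries (fun γ : dualLattice Ω => potCoeff F q γ) 0 x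
        * (f x * (starRingEnd ℂ) (planeWave v x)) := by
    refine integral_congr_ae ?_
    filter_upwards [potential_ae_eq_planeSeries hF hF1 hper hq2 hsum] with x hx
    rw [hx]
  refine (h3.trans h2).trans (tsum_congr fun γ => ?_)
  congr 1
  rw [planeCoeff]
  refine integral_congr_ae (Filter.Eventually.of_forall fun x => ?_)
  simp only [add_zero]
  have : (starRingEnd ℂ) (planeWave (v - (γ : Space d)) x)
      = planeWave γ x * (starRingEnd ℂ) (planeWave v x) := by
    rw [planeWave_mul_conj, conj_planeWave, neg_sub]
  rw [this]
  ring

end PlaneSeries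

/-! ### Integration by parts for quasiperiodic functions -/

section Green

variable {Ω : Submodule ℤ (Space d)} {t : Space d}

theorem norm_add_of_isQuasiperiodic {u : Space d → ℂ} (hu : IsQuasiperiodic Ω t u) {ω : Space d}
    (hω : ω ∈ Ω) (x : Space d) : ‖u (x + ω)‖ = ‖u x‖ := by
  rw [hu ω hω, norm_mul, norm_planeWave, one_mul]

theorem exists_norm_le_of_isQuasiperiodic [DiscreteTopology Ω] [IsZLattice ℝ Ω]
    {u : Space d → ℂ} (hu : IsQuasiperiodic Ω t u) (hc : Continuous u) : ∃ C, ∀ x, ‖u x‖ ≤ C := by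
  let b₀ := Module.Free.chooseBasis ℤ Ω
  let b := b₀.ofZLatticeBasis ℝ Ω
  have hb : Submodule.span ℤ (Set.range b) = Ω := b₀.ofZLatticeBasis_span ℝ
  have hbd := (ZSpan.fundamentalDomain_isBounded b).closure
  obtain ⟨C, hC⟩ := (Metric.isCompact_of_isClosed_isBounded isClosed_closure hbd).exists_bound_of_continuousOn
    hc.continuousOn
  refine ⟨C, fun x => ?_⟩
  have h1 : ((ZSpan.floor b x : Submodule.span ℤ (Set.range b)) : Space d) ∈ Ω := by
    have := (ZSpan.floor b x).2
    exact hb.le this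
  have h2 : x = ZSpan.fract b x + (ZSpan.floor b x : Space d) := by
    rw [ZSpan.fract_apply, sub_add_cancel]
  rw [h2, norm_add_of_isQuasiperiodic hu h1]
  exact hC _ (subset_closure (ZSpan.fract_mem_fundamentalDomain b x))

theorem isQuasiperiodic_fderiv {φ : Space d → ℂ} (hφ : IsQuasiperiodic Ω t φ)
    (hd : Differentiable ℝ φ) (w : Space d) :
    IsQuasiperiodic Ω t (fun x => fderiv ℝ φ x w) := by
  intro ω hω x
  have h1 : (fun y => φ (y + ω)) = fun y => planeWave t ω • φ y := funext fun y => hφ ω hω y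
  have h2 : fderiv ℝ (fun y => φ (y + ω)) x = fderiv ℝ φ (x + ω) := fderiv_comp_add_right ω
  have h3 : fderiv ℝ (fun y => φ (y + ω)) x = planeWave t ω • fderiv ℝ φ x := by
    rw [h1]
    exact fderiv_const_smul (f := φ) (hd x) (planeWave t ω)
  simp only
  rw [← h2, h3]
  rfl

/-- The Fourier coefficients of a directional derivative. Translation of the integration variable
by `s w` turns `∫ φ(x + s w) e^{-i⟨v, x⟩} dx` into `e^{i s ⟨v, w⟩} ∫ φ(x) e^{-i⟨v, x⟩} dx`, and the
formula is the derivative of this at `s = 0`. -/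
theorem planeCoeff_fderiv [DiscreteTopology Ω] [IsZLattice ℝ Ω] {F : Set (Space d)}
    (hF : IsAddFundamentalDomain Ω F volume) (hF1 : volume F = 1) {φ : Space d → ℂ}
    (hφ : IsQuasiperiodic Ω t φ) (hφs : ContDiff ℝ 1 φ) {v : Space d}
    (hv : IsQuasiperiodic Ω t (planeWave v)) (w : Space d) :
    planeCoeff F (fun x => fderiv ℝ φ x w) v
      = (Complex.I * ((inner ℝ v w : ℝ) : ℂ)) * planeCoeff F φ v := by
  have hprob := isProbabilityMeasure_restrict hF1
  have hdiff : Differentiable ℝ φ := hφs.differentiable one_ne_zero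
  have hdc : Continuous fun x => fderiv ℝ φ x w :=
    (hφs.continuous_fderiv one_ne_zero).clm_apply continuous_const
  obtain ⟨C, hC⟩ := exists_norm_le_of_isQuasiperiodic (isQuasiperiodic_fderiv hφ hdiff w) hdc
  obtain ⟨C', hC'⟩ := exists_norm_le_of_isQuasiperiodic hφ hφs.continuous
  have hcw : Continuous fun x => (starRingEnd ℂ) (planeWave v x) :=
    Complex.continuous_conj.comp (continuous_planeWave v)
  have hderiv : ∀ x (s : ℝ), HasDerivAt (fun s : ℝ => φ (x + s • w) * (starRingEnd ℂ) (planeWave v x))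
      (fderiv ℝ φ (x + s • w) w * (starRingEnd ℂ) (planeWave v x)) s := by
    intro x s
    have h1 : HasDerivAt (fun s : ℝ => x + s • w) w s := by
      simpa using ((hasDerivAt_id s).smul_const w).const_add x
    exact ((hdiff (x + s • w)).hasFDerivAt.comp_hasDerivAt s h1).mul_const _
  have hleft := (hasDerivAt_integral_of_dominated_loc_of_deriv_le (μ := volume.restrict F)
    (F := fun (s : ℝ) x => φ (x + s • w) * (starRingEnd ℂ) (planeWave v x))
    (F' := fun (s : ℝ) x => fderiv ℝ φ (x + s • w) w * (starRingEnd ℂ) (planeWave v x))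
    (x₀ := (0 : ℝ)) (s := Set.univ) (bound := fun _ => C) Filter.univ_mem
    (Filter.Eventually.of_forall fun s =>
      ((hφs.continuous.comp (continuous_id.add continuous_const)).mul hcw).aestronglyMeasurable)
    (by
      refine integrable_of_continuous_of_bounded hF1
        ((hφs.continuous.comp (continuous_id.add continuous_const)).mul hcw) (C := C') fun x => ?_
      rw [norm_mul, RCLike.norm_conj, norm_planeWave, mul_one]
      exact hC' _)
    ((hdc.comp (continuous_id.add continuous_const)).mul hcw).aestronglyMeasurable
    (Filter.Eventually.of_forall fun x s _ => by
      rw [norm_mul, RCLike.norm_conj, norm_planeWave, mul_one]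
      exact hC _)
    (integrable_const C)
    (Filter.Eventually.of_forall fun x s _ => hderiv x s)).2
  have htrans : ∀ s : ℝ, ∫ x in F, φ (x + s • w) * (starRingEnd ℂ) (planeWave v x)
      = planeWave v (s • w) * planeCoeff F φ v := by
    intro s
    rw [planeCoeff, ← setIntegral_add_right_of_periodic hF
      (f := fun x => φ x * (starRingEnd ℂ) (planeWave v x))
      (fun ω hω x => hφ.mul_conj hv hω x) (s • w), ← integral_const_mul]
    refine integral_congr_ae (Filter.Eventually.of_forall fun x => ?_)
    simp only
    rw [planeWave_add_right, map_mul]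
    linear_combination (-φ (x + s • w) * (starRingEnd ℂ) (planeWave v x))
      * planeWave_mul_conj_self v (s • w)
  have hright : HasDerivAt (fun s : ℝ => planeWave v (s • w) * planeCoeff F φ v)
      ((Complex.I * ((inner ℝ v w : ℝ) : ℂ)) * planeCoeff F φ v) 0 := by
    have h1 : HasDerivAt (fun s : ℝ => planeWave v (s • w))
        (Complex.I * ((inner ℝ v w : ℝ) : ℂ)) 0 := by
      have h2 : (fun s : ℝ => planeWave v (s • w))
          = fun s : ℝ => Complex.exp ((s : ℂ) * (Complex.I * ((inner ℝ v w : ℝ) : ℂ))) := by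
        funext s
        rw [planeWave, inner_smul_right]
        push_cast
        ring_nf
      rw [h2]
      have h3 : HasDerivAt (fun s : ℝ => (s : ℂ) * (Complex.I * ((inner ℝ v w : ℝ) : ℂ)))
          (1 * (Complex.I * ((inner ℝ v w : ℝ) : ℂ))) 0 :=
        Complex.ofRealCLM.hasDerivAt.mul_const _
      simpa using h3.cexp
    exact h1.mul_const _
  simp only [htrans] at hleft
  have := hleft.unique hright
  simpa only [zero_smul, add_zero, planeCoeff] using this

theorem laplacian_eq_sum_fderiv {φ : Space d → ℂ} (hφ : ContDiff ℝ 2 φ) (x : Space d) :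
    Laplacian.laplacian φ x = ∑ i, fderiv ℝ (fun y => fderiv ℝ φ y
      (EuclideanSpace.basisFun (Fin d) ℝ i)) x (EuclideanSpace.basisFun (Fin d) ℝ i) := by
  rw [InnerProductSpace.laplacian_eq_iteratedFDeriv_orthonormalBasis φ
    (EuclideanSpace.basisFun (Fin d) ℝ)]
  refine Finset.sum_congr rfl fun i _ => ?_
  have h1 : DifferentiableAt ℝ (fderiv ℝ φ) x :=
    ((hφ.fderiv_right (m := 1) le_rfl).differentiable one_ne_zero) x
  rw [iteratedFDeriv_two_apply, fderiv_clm_apply h1 (differentiableAt_const _)]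
  simp

theorem sum_inner_basisFun_sq (v : Space d) :
    ∑ i, ((inner ℝ v (EuclideanSpace.basisFun (Fin d) ℝ i) : ℝ)) ^ 2 = ‖v‖ ^ 2 := by
  rw [EuclideanSpace.norm_sq_eq]
  simp [EuclideanSpace.inner_single_right]

theorem fderiv_planeWave (v x w : Space d) :
    fderiv ℝ (planeWave v) x w = (Complex.I * ((inner ℝ v w : ℝ) : ℂ)) * planeWave v x := by
  have h1 : HasFDerivAt (fun y : Space d => Complex.I * ((inner ℝ v y : ℝ) : ℂ))
      (Complex.I • (Complex.ofRealCLM.comp (innerSL ℝ v))) x :=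
    ((Complex.ofRealCLM.comp (innerSL ℝ v)).hasFDerivAt).const_mul Complex.I
  have h2 := h1.cexp.fderiv
  unfold planeWave
  rw [h2]
  simp
  ring

theorem laplacian_planeWave (v x : Space d) :
    Laplacian.laplacian (planeWave v) x = -((‖v‖ ^ 2 : ℝ) : ℂ) * planeWave v x := by
  rw [laplacian_eq_sum_fderiv (contDiff_planeWave v)]
  simp only [fderiv_planeWave]
  have h : ∀ i, fderiv ℝ (fun y => Complex.I * ((inner ℝ v (EuclideanSpace.basisFun (Fin d) ℝ i) : ℝ) : ℂ)
      * planeWave v y) x (EuclideanSpace.basisFun (Fin d) ℝ i)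
      = -(((inner ℝ v (EuclideanSpace.basisFun (Fin d) ℝ i) : ℝ) ^ 2 : ℝ) : ℂ)
        * planeWave v x := by
    intro i
    rw [fderiv_const_mul ((contDiff_planeWave v (n := 1)).differentiable one_ne_zero x)]
    simp only [smul_apply, fderiv_planeWave, smul_eq_mul]
    push_cast
    linear_combination (((inner ℝ v (EuclideanSpace.basisFun (Fin d) ℝ i) : ℝ) : ℂ) ^ 2
      * planeWave v x) * Complex.I_mul_I
  rw [Finset.sum_congr rfl fun i _ => h i, ← Finset.sum_mul, ← sum_inner_basisFun_sq]
  push_cast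
  rw [Finset.sum_neg_distrib]

theorem planeCoeff_laplacian [DiscreteTopology Ω] [IsZLattice ℝ Ω] {F : Set (Space d)}
    (hF : IsAddFundamentalDomain Ω F volume) (hF1 : volume F = 1) {φ : Space d → ℂ}
    (hφ : IsQuasiperiodic Ω t φ) (hφs : ContDiff ℝ 2 φ) {v : Space d}
    (hv : IsQuasiperiodic Ω t (planeWave v)) :
    planeCoeff F (fun x => Laplacian.laplacian φ x) v
      = -((‖v‖ ^ 2 : ℝ) : ℂ) * planeCoeff F φ v := by
  have hd1 : Differentiable ℝ φ := hφs.differentiable two_ne_zero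
  have hs1 : ∀ w, ContDiff ℝ 1 fun x => fderiv ℝ φ x w := fun w =>
    (hφs.fderiv_right (m := 1) le_rfl).clm_apply contDiff_const
  have hq1 : ∀ w, IsQuasiperiodic Ω t fun x => fderiv ℝ φ x w := fun w =>
    isQuasiperiodic_fderiv hφ hd1 w
  have hc2 : ∀ w, Continuous fun x => fderiv ℝ (fun y => fderiv ℝ φ y w) x w := fun w =>
    ((hs1 w).continuous_fderiv one_ne_zero).clm_apply continuous_const
  have hint : ∀ w, Integrable (fun x => fderiv ℝ (fun y => fderiv ℝ φ y w) x w
      * (starRingEnd ℂ) (planeWave v x)) (volume.restrict F) := by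
    intro w
    obtain ⟨C, hC⟩ := exists_norm_le_of_isQuasiperiodic
      (isQuasiperiodic_fderiv (hq1 w) ((hs1 w).differentiable one_ne_zero) w) (hc2 w)
    refine integrable_of_continuous_of_bounded hF1
      ((hc2 w).mul (Complex.continuous_conj.comp (continuous_planeWave v))) (C := C) fun x => ?_
    rw [norm_mul, RCLike.norm_conj, norm_planeWave, mul_one]
    exact hC x
  have h2 : ∀ w, ∫ x in F, fderiv ℝ (fun y => fderiv ℝ φ y w) x w
      * (starRingEnd ℂ) (planeWave v x) = -(((inner ℝ v w : ℝ) ^ 2 : ℝ) : ℂ) * planeCoeff F φ v := by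
    intro w
    have e1 := planeCoeff_fderiv hF hF1 (hq1 w) (hs1 w) hv w
    have e2 := planeCoeff_fderiv hF hF1 hφ (hφs.of_le one_le_two) hv w
    rw [e2, planeCoeff] at e1
    rw [e1]
    push_cast
    linear_combination (((inner ℝ v w : ℝ) : ℂ) ^ 2 * planeCoeff F φ v) * Complex.I_mul_I
  rw [planeCoeff]
  simp only [laplacian_eq_sum_fderiv hφs, Finset.sum_mul]
  rw [integral_finsetSum _ fun i _ => hint _]
  simp only [h2]
  rw [← Finset.sum_mul, ← sum_inner_basisFun_sq]
  push_cast
  rw [Finset.sum_neg_distrib]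

end Green

/-! ### The binding formula -/

section Binding

theorem IsBlochEigenfunction.norm_planeCoeff_le {Ω : Submodule ℤ (Space d)} {F : Set (Space d)}
    {q : Space d → ℝ} {t : Space d} (hF1 : volume F = 1) {Λ : ℝ} {Ψ : Space d → ℂ}
    (hΨ : IsBlochEigenfunction Ω F q t Λ Ψ) (v : Space d) : ‖planeCoeff F Ψ v‖ ≤ 1 := by
  have hprob := isProbabilityMeasure_restrict hF1
  have hsq : Integrable (fun x => ‖Ψ x‖ ^ 2) (volume.restrict F) :=
    (memLp_two_iff_integrable_sq_norm hΨ.eigen_eq.memLp.1).1 hΨ.eigen_eq.memLp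
  calc ‖planeCoeff F Ψ v‖ ≤ ∫ x in F, ‖Ψ x‖ := by
        refine (norm_integral_le_integral_norm _).trans (le_of_eq ?_)
        simp [norm_planeWave]
    _ ≤ ∫ x in F, (1 + ‖Ψ x‖ ^ 2) / 2 := by
        refine integral_mono (hΨ.eigen_eq.memLp.integrable one_le_two).norm
          (((integrable_const 1).add hsq).div_const 2) fun x => ?_
        have := sq_nonneg (‖Ψ x‖ - 1)
        simp only
        linarith
    _ = 1 := by
        rw [integral_div, integral_add (integrable_const 1) hsq, hΨ.normalized]
        simp [measureReal_def]

variable {Ω : Submodule ℤ (Space d)} [DiscreteTopology Ω] [IsZLattice ℝ Ω] {F : Set (Space d)}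
  {q : Space d → ℝ} {t : Space d}

/-- The binding formula: the eigenvalue equation, tested against plane waves. -/
theorem IsBlochEigenfunction.binding (hF : IsAddFundamentalDomain Ω F volume)
    (hF1 : volume F = 1) (hper : ∀ ω ∈ Ω, ∀ x, q (x + ω) = q x)
    (hq2 : MemLp q 2 (volume.restrict F))
    (hsum : Summable fun γ : dualLattice Ω => ‖potCoeff F q γ‖) {Λ : ℝ} {Ψ : Space d → ℂ}
    (hΨ : IsBlochEigenfunction Ω F q t Λ Ψ) {γ : Space d} (hγ : γ ∈ dualLattice Ω) :
    ((Λ : ℂ) - ((‖γ + t‖ ^ 2 : ℝ) : ℂ)) * planeCoeff F Ψ (γ + t)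
      = ∑' γ' : dualLattice Ω, potCoeff F q γ' * planeCoeff F Ψ (γ + t - γ') := by
  have hprob := isProbabilityMeasure_restrict hF1
  have h1 := hΨ.eigen_eq.weak_eq (planeWave (γ + t)) (contDiff_planeWave _)
    (isQuasiperiodic_planeWave hγ t)
  have hΨi := hΨ.eigen_eq.memLp.integrable one_le_two
  have hcw : Continuous fun x => (starRingEnd ℂ) (planeWave (γ + t) x) :=
    Complex.continuous_conj.comp (continuous_planeWave _)
  have hb : ∀ᵐ x ∂(volume.restrict F), ‖(starRingEnd ℂ) (planeWave (γ + t) x)‖ ≤ 1 :=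
    Filter.Eventually.of_forall fun x => by simp [norm_planeWave]
  have hi1 : Integrable (fun x => Ψ x * (starRingEnd ℂ) (planeWave (γ + t) x))
      (volume.restrict F) := hΨi.mul_bdd (c := 1) hcw.aestronglyMeasurable hb
  have hi2 : Integrable (fun x => (q x : ℂ) * (Ψ x * (starRingEnd ℂ) (planeWave (γ + t) x)))
      (volume.restrict F) := by
    have := (hq2.ofReal (K := ℂ)).integrable_mul hΨ.eigen_eq.memLp
    have := this.mul_bdd (c := 1) hcw.aestronglyMeasurable hb
    refine this.congr (Filter.Eventually.of_forall fun x => ?_)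
    simp only [Pi.mul_apply, Complex.coe_algebraMap]
    ring_nf
  have e1 : ∀ x, Ψ x * (starRingEnd ℂ) (-(Laplacian.laplacian (planeWave (γ + t)) x)
      + (q x : ℂ) * planeWave (γ + t) x)
      = ((‖γ + t‖ ^ 2 : ℝ) : ℂ) * (Ψ x * (starRingEnd ℂ) (planeWave (γ + t) x))
        + (q x : ℂ) * (Ψ x * (starRingEnd ℂ) (planeWave (γ + t) x)) := fun x => by
    rw [laplacian_planeWave]
    simp only [map_add, map_neg, map_mul, Complex.conj_ofReal]
    ring
  have e2 : ∀ x, (Λ : ℂ) * Ψ x * (starRingEnd ℂ) (planeWave (γ + t) x)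
      = (Λ : ℂ) * (Ψ x * (starRingEnd ℂ) (planeWave (γ + t) x)) := fun x => by ring
  simp only [e1, e2] at h1
  rw [integral_add (hi1.const_mul _) hi2, integral_const_mul, integral_const_mul,
    integral_potential_mul hF hF1 hper hq2 hsum hΨi] at h1
  rw [sub_mul, sub_eq_iff_eq_add', planeCoeff]
  exact h1.symm

end Binding

/-! ### Eigenfunctions from `ℓ²` eigenvectors -/

section Construction

variable {Ω : Submodule ℤ (Space d)} {F : Set (Space d)} {q : Space d → ℝ} {t : Space d}

/-- Bootstrapping: the coefficients of an `ℓ²` eigenvector decay polynomially, since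
`u = (q * u) / (Λ - |γ + t|²)` gains two powers of `|γ|` over `u`. -/
theorem exists_decay_of_eigenvector {p : ℝ}
    (hsum : Summable fun γ : dualLattice Ω => (1 + ‖(γ : Space d)‖) ^ p * ‖potCoeff F q γ‖)
    {u : dualLattice Ω → ℂ} {Λ : ℝ} (hu1 : ∀ γ, ‖u γ‖ ≤ 1)
    (heq : ∀ γ : dualLattice Ω, ((Λ - ‖(γ : Space d) + t‖ ^ 2 : ℝ) : ℂ) * u γ
      = ∑' γ' : dualLattice Ω, potCoeff F q ((γ - γ' : dualLattice Ω) : Space d) * u γ')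
    (j : ℕ) (hj : 2 * (j : ℝ) ≤ p + 2) :
    ∃ C, 0 ≤ C ∧ ∀ γ : dualLattice Ω, (1 + ‖(γ : Space d)‖) ^ (2 * j) * ‖u γ‖ ≤ C := by
  induction j with
  | zero => exact ⟨1, zero_le_one, fun γ => by simpa using hu1 γ⟩
  | succ j ih =>
    push_cast at hj
    obtain ⟨C, hC0, hC⟩ := ih (by linarith)
    set A : ℝ := ∑' γ : dualLattice Ω, (1 + ‖(γ : Space d)‖) ^ p * ‖potCoeff F q γ‖ with hA
    have hA0 : 0 ≤ A := tsum_nonneg fun _ => by positivity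
    have hconv : ∀ γ : dualLattice Ω, (1 + ‖(γ : Space d)‖) ^ (2 * j)
        * ‖((Λ - ‖(γ : Space d) + t‖ ^ 2 : ℝ) : ℂ) * u γ‖ ≤ A * C := by
      intro γ
      have hs := ((Equiv.subLeft γ).summable_iff.2 hsum).mul_right C
      have h2 : ∑' γ' : dualLattice Ω, (1 + ‖((γ - γ' : dualLattice Ω) : Space d)‖) ^ p
          * ‖potCoeff F q ((γ - γ' : dualLattice Ω) : Space d)‖ = A :=
        (Equiv.subLeft γ).tsum_eq fun γ : dualLattice Ω =>
          (1 + ‖(γ : Space d)‖) ^ p * ‖potCoeff F q γ‖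
      have hpos : 0 < (1 + ‖(γ : Space d)‖) ^ (2 * j) := by positivity
      rw [heq γ, mul_comm, ← le_div_iff₀ hpos, ← h2, ← tsum_mul_right, ← tsum_div_const]
      refine tsum_of_norm_bounded (hs.div_const _).hasSum fun γ' => ?_
      rw [le_div_iff₀ hpos, norm_mul]
      simp only [Function.comp_apply, Equiv.subLeft_apply]
      set m := ‖((γ - γ' : dualLattice Ω) : Space d)‖ with hm
      have h3 : 1 + ‖(γ : Space d)‖ ≤ (1 + m) * (1 + ‖(γ' : Space d)‖) := by
        have h4 : ‖(γ : Space d)‖ ≤ m + ‖(γ' : Space d)‖ := by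
          have e : (γ : Space d) = ((γ - γ' : dualLattice Ω) : Space d) + γ' := by
            rw [AddSubgroup.coe_sub]; abel
          calc ‖(γ : Space d)‖ = ‖((γ - γ' : dualLattice Ω) : Space d) + γ'‖ := by rw [← e]
            _ ≤ _ := norm_add_le _ _
        have : 0 ≤ m * ‖(γ' : Space d)‖ := by positivity
        linarith
      have h5 : (1 + m) ^ (2 * j) ≤ (1 + m) ^ p := by
        have hm0 : 0 ≤ m := norm_nonneg _
        rw [← Real.rpow_natCast]
        refine Real.rpow_le_rpow_of_exponent_le (by linarith) ?_
        push_cast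
        linarith
      set Q := ‖potCoeff F q ((γ - γ' : dualLattice Ω) : Space d)‖
      calc Q * ‖u γ'‖ * (1 + ‖(γ : Space d)‖) ^ (2 * j)
          ≤ Q * ‖u γ'‖ * ((1 + m) * (1 + ‖(γ' : Space d)‖)) ^ (2 * j) := by gcongr
        _ = (1 + m) ^ (2 * j) * Q * ((1 + ‖(γ' : Space d)‖) ^ (2 * j) * ‖u γ'‖) := by
            rw [mul_pow]; ring
        _ ≤ (1 + m) ^ p * Q * C := by
            gcongr
            exact hC γ'
    set R : ℝ := 1 + 2 * ‖t‖ + 8 * |Λ| with hR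
    have hR0 : 0 ≤ R := by positivity
    refine ⟨(1 + R) ^ (2 * (j + 1)) + 32 * (A * C), by positivity, fun γ => ?_⟩
    set n := ‖(γ : Space d)‖ with hn
    have hn0 : 0 ≤ n := norm_nonneg _
    by_cases hlt : n ≤ R
    · calc (1 + n) ^ (2 * (j + 1)) * ‖u γ‖ ≤ (1 + R) ^ (2 * (j + 1)) * 1 := by
            gcongr
            exact hu1 γ
        _ ≤ _ := by
            have : 0 ≤ 32 * (A * C) := by positivity
            linarith
    · have hlt := not_le.1 hlt
      have ht0 := norm_nonneg t
      have hL0 := abs_nonneg Λ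
      have h1 : n / 2 ≤ ‖(γ : Space d) + t‖ := by
        have := norm_sub_le ((γ : Space d) + t) t
        rw [add_sub_cancel_right, ← hn] at this
        linarith
      have h2 : (1 + n) ^ 2 ≤ 32 * |Λ - ‖(γ : Space d) + t‖ ^ 2| := by
        have h3 : (n / 2) ^ 2 ≤ ‖(γ : Space d) + t‖ ^ 2 := by gcongr
        have h4 := le_abs_self (-(Λ - ‖(γ : Space d) + t‖ ^ 2))
        rw [abs_neg] at h4
        have h5 := le_abs_self Λ
        have h6 : 8 * |Λ| ≤ n ^ 2 := by nlinarith
        have h7 : (1 + n) ^ 2 ≤ 4 * n ^ 2 := by nlinarith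
        nlinarith
      have h3 := hconv γ
      rw [norm_mul, Complex.norm_real, Real.norm_eq_abs] at h3
      calc (1 + n) ^ (2 * (j + 1)) * ‖u γ‖ = (1 + n) ^ (2 * j) * ((1 + n) ^ 2 * ‖u γ‖) := by ring
        _ ≤ (1 + n) ^ (2 * j) * (32 * |Λ - ‖(γ : Space d) + t‖ ^ 2| * ‖u γ‖) := by gcongr
        _ = 32 * ((1 + n) ^ (2 * j) * (|Λ - ‖(γ : Space d) + t‖ ^ 2| * ‖u γ‖)) := by ring
        _ ≤ 32 * (A * C) := by gcongr
        _ ≤ _ := by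
            have : 0 ≤ (1 + R) ^ (2 * (j + 1)) := by positivity
            linarith

variable [DiscreteTopology Ω] [IsZLattice ℝ Ω]

/-- An eigenvector with rapidly decreasing coefficients is the coefficient sequence of an
eigenfunction. -/
theorem isBlochEigenfunction_planeSeries (hF : IsAddFundamentalDomain Ω F volume)
    (hF1 : volume F = 1) (hper : ∀ ω ∈ Ω, ∀ x, q (x + ω) = q x)
    (hq2 : MemLp q 2 (volume.restrict F))
    (hsum : Summable fun γ : dualLattice Ω => ‖potCoeff F q γ‖) {u : dualLattice Ω → ℂ} {Λ : ℝ}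
    (hu : Summable fun γ : dualLattice Ω => (1 + ‖(γ : Space d) + t‖ ^ 2) * ‖u γ‖)
    (hu1 : ∑' γ, ‖u γ‖ ^ 2 = 1)
    (heq : ∀ γ : dualLattice Ω, ((Λ - ‖(γ : Space d) + t‖ ^ 2 : ℝ) : ℂ) * u γ
      = ∑' γ' : dualLattice Ω, potCoeff F q ((γ - γ' : dualLattice Ω) : Space d) * u γ') :
    IsBlochEigenfunction Ω F q t Λ (planeSeries u t) := by
  have hprob := isProbabilityMeasure_restrict hF1
  have hu0 : Summable fun γ => ‖u γ‖ :=
    Summable.of_nonneg_of_le (fun _ => norm_nonneg _)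
      (fun γ => le_mul_of_one_le_left (norm_nonneg _) (by
        linarith [sq_nonneg ‖(γ : Space d) + t‖])) hu
  set u2 : dualLattice Ω → ℂ := fun γ => ((‖(γ : Space d) + t‖ ^ 2 : ℝ) : ℂ) * u γ with hu2
  have hu2s : Summable fun γ => ‖u2 γ‖ := by
    refine Summable.of_nonneg_of_le (fun _ => norm_nonneg _) (fun γ => ?_) hu
    rw [hu2, norm_mul, Complex.norm_real, Real.norm_of_nonneg (by positivity)]
    exact mul_le_mul_of_nonneg_right (by linarith) (norm_nonneg _)
  set Ψ := planeSeries u t with hΨ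
  have hΨc : Continuous Ψ := continuous_planeSeries hu0
  have hΨb : ∀ x, ‖Ψ x‖ ≤ ∑' γ, ‖u γ‖ := norm_planeSeries_le hu0
  have hΨq : IsQuasiperiodic Ω t Ψ := isQuasiperiodic_planeSeries
  have hΨ2 : MemLp Ψ 2 (volume.restrict F) :=
    MemLp.of_bound hΨc.aestronglyMeasurable _ (Filter.Eventually.of_forall hΨb)
  have hΨi := hΨ2.integrable one_le_two
  have hqΨ : MemLp (fun x => (q x : ℂ) * Ψ x) 2 (volume.restrict F) := by
    refine ((hq2.ofReal (K := ℂ)).const_mul ((∑' γ, ‖u γ‖ : ℝ) : ℂ)).of_le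
      ((hq2.ofReal (K := ℂ)).1.mul hΨ2.1) (Filter.Eventually.of_forall fun x => ?_)
    simp only [norm_mul, Complex.norm_real, Complex.coe_algebraMap]
    rw [mul_comm, Real.norm_of_nonneg (tsum_nonneg fun _ => norm_nonneg _)]
    exact mul_le_mul_of_nonneg_right (hΨb x) (norm_nonneg _)
  -- `(Λ - q) Ψ` and `∑ |γ + t|² u_γ e_{γ + t}` have the same Fourier coefficients.
  have hcoeff : ∀ γ : dualLattice Ω,
      planeCoeff F (fun x => (Λ : ℂ) * Ψ x - (q x : ℂ) * Ψ x) ((γ : Space d) + t) = u2 γ := by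
    intro γ
    have hm : ∀ {h : Space d → ℂ}, MemLp h 2 (volume.restrict F) →
        Integrable (fun x => h x * (starRingEnd ℂ) (planeWave ((γ : Space d) + t) x))
          (volume.restrict F) := fun hh => (hh.integrable one_le_two).mul_bdd (c := 1)
      (Complex.continuous_conj.comp (continuous_planeWave _)).aestronglyMeasurable
      (Filter.Eventually.of_forall fun x => by simp [norm_planeWave])
    have h1 := integral_potential_mul hF hF1 hper hq2 hsum hΨi ((γ : Space d) + t)
    have h2 : ∑' γ' : dualLattice Ω, potCoeff F q γ' * planeCoeff F Ψ ((γ : Space d) + t - γ')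
        = ((Λ - ‖(γ : Space d) + t‖ ^ 2 : ℝ) : ℂ) * u γ := by
      rw [heq γ, ← (Equiv.subLeft γ).tsum_eq]
      refine tsum_congr fun γ' => ?_
      have e : (γ : Space d) + t - ((γ - γ' : dualLattice Ω) : Space d) = (γ' : Space d) + t := by
        rw [AddSubgroup.coe_sub]; abel
      rw [Equiv.subLeft_apply, e, planeCoeff_planeSeries hF hF1 hu0]
    have h3 := planeCoeff_planeSeries (t := t) hF hF1 hu0 γ
    rw [planeCoeff]
    simp only [sub_mul]
    rw [integral_sub (hm (hΨ2.const_mul _)) (hm hqΨ)]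
    simp only [mul_assoc]
    rw [integral_const_mul, h1, h2]
    rw [planeCoeff] at h3
    rw [h3, hu2]
    push_cast
    ring
  have hqp : IsQuasiperiodic Ω t fun x => (Λ : ℂ) * Ψ x - (q x : ℂ) * Ψ x := fun ω hω x => by
    beta_reduce
    rw [hΨq ω hω x, hper ω hω x]
    ring
  have hae := eq_planeSeries_of_planeCoeff_eq hF hF1 hu2s hqp ((hΨ2.const_mul _).sub hqΨ) hcoeff
  refine ⟨⟨hΨq, hΨ2, fun ω hω x => ?_, hΨ2.const_mul _, fun φ hφ hφq => ?_⟩, ?_⟩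
  · beta_reduce
    rw [hΨq ω hω x]
    ring
  · have hφ2 : ContDiff ℝ 2 φ := by exact_mod_cast contDiff_infty.1 hφ 2
    obtain ⟨Cφ, hCφ⟩ := exists_norm_le_of_isQuasiperiodic hφq hφ.continuous
    have hcφ : Continuous fun x => (starRingEnd ℂ) (φ x) :=
      Complex.continuous_conj.comp hφ.continuous
    have hφi : Integrable (fun x => (starRingEnd ℂ) (φ x)) (volume.restrict F) :=
      integrable_of_continuous_of_bounded hF1 hcφ (C := Cφ) fun x => by
        rw [RCLike.norm_conj]; exact hCφ x
    have hs1 : ∀ w, ContDiff ℝ 1 fun x => fderiv ℝ φ x w := fun w =>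
      (hφ2.fderiv_right (m := 1) le_rfl).clm_apply contDiff_const
    have hLc : Continuous fun x => Laplacian.laplacian φ x := by
      simp only [laplacian_eq_sum_fderiv hφ2]
      exact continuous_finsetSum _ fun i _ =>
        ((hs1 _).continuous_fderiv one_ne_zero).clm_apply continuous_const
    have hLq : IsQuasiperiodic Ω t fun x => Laplacian.laplacian φ x := fun ω hω x => by
      simp only [laplacian_eq_sum_fderiv hφ2, Finset.mul_sum]
      refine Finset.sum_congr rfl fun i _ => ?_
      exact isQuasiperiodic_fderiv (isQuasiperiodic_fderiv hφq
        (hφ2.differentiable two_ne_zero) _) ((hs1 _).differentiable one_ne_zero) _ ω hω x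
    obtain ⟨CL, hCL⟩ := exists_norm_le_of_isQuasiperiodic hLq hLc
    have hLi : Integrable (fun x => -(starRingEnd ℂ) (Laplacian.laplacian φ x))
        (volume.restrict F) :=
      integrable_of_continuous_of_bounded hF1 (Complex.continuous_conj.comp hLc).neg
        (C := CL) fun x => by rw [norm_neg, RCLike.norm_conj]; exact hCL x
    have hterm : ∀ γ : dualLattice Ω, u γ * ∫ x in F, planeWave ((γ : Space d) + t) x
        * -(starRingEnd ℂ) (Laplacian.laplacian φ x)
        = u2 γ * ∫ x in F, planeWave ((γ : Space d) + t) x * (starRingEnd ℂ) (φ x) := by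
      intro γ
      have h1 := congrArg (starRingEnd ℂ) (planeCoeff_laplacian hF hF1 hφq hφ2
        (isQuasiperiodic_planeWave γ.2 t))
      simp only [planeCoeff, map_mul, map_neg, Complex.conj_ofReal, ← integral_conj,
        Complex.conj_conj] at h1
      have h2 : ∀ x, planeWave ((γ : Space d) + t) x * -(starRingEnd ℂ) (Laplacian.laplacian φ x)
          = -((starRingEnd ℂ) (Laplacian.laplacian φ x) * planeWave ((γ : Space d) + t) x) :=
        fun x => by ring
      have h3 : ∀ x, planeWave ((γ : Space d) + t) x * (starRingEnd ℂ) (φ x)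
          = (starRingEnd ℂ) (φ x) * planeWave ((γ : Space d) + t) x := fun x => mul_comm _ _
      simp only [h2, h3, integral_neg, h1, hu2]
      ring
    have hgreen : ∫ x in F, Ψ x * -(starRingEnd ℂ) (Laplacian.laplacian φ x)
        = ∫ x in F, ((Λ : ℂ) * Ψ x - (q x : ℂ) * Ψ x) * (starRingEnd ℂ) (φ x) := by
      rw [hΨ, integral_planeSeries_mul hu0 hLi, tsum_congr hterm,
        ← integral_planeSeries_mul hu2s hφi]
      refine integral_congr_ae ?_
      filter_upwards [hae] with x hx
      rw [← hx]
    have hbφ : ∀ᵐ x ∂(volume.restrict F), ‖(starRingEnd ℂ) (φ x)‖ ≤ Cφ :=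
      Filter.Eventually.of_forall fun x => by rw [RCLike.norm_conj]; exact hCφ x
    have hi1 : Integrable (fun x => Ψ x * -(starRingEnd ℂ) (Laplacian.laplacian φ x))
        (volume.restrict F) :=
      hLi.bdd_mul hΨc.aestronglyMeasurable (Filter.Eventually.of_forall hΨb)
    have hi2 : Integrable (fun x => (q x : ℂ) * Ψ x * (starRingEnd ℂ) (φ x))
        (volume.restrict F) :=
      (hqΨ.integrable one_le_two).mul_bdd hcφ.aestronglyMeasurable hbφ
    have hi3 : Integrable (fun x => ((Λ : ℂ) * Ψ x - (q x : ℂ) * Ψ x) * (starRingEnd ℂ) (φ x))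
        (volume.restrict F) :=
      ((hΨi.const_mul _).sub (hqΨ.integrable one_le_two)).mul_bdd hcφ.aestronglyMeasurable hbφ
    have e1 : ∀ x, Ψ x * (starRingEnd ℂ) (-(Laplacian.laplacian φ x) + (q x : ℂ) * φ x)
        = Ψ x * -(starRingEnd ℂ) (Laplacian.laplacian φ x)
          + (q x : ℂ) * Ψ x * (starRingEnd ℂ) (φ x) := fun x => by
      simp only [map_add, map_neg, map_mul, Complex.conj_ofReal]
      ring
    simp only [e1]
    rw [integral_add hi1 hi2, hgreen, ← integral_add hi3 hi2]
    refine integral_congr_ae (Filter.Eventually.of_forall fun x => ?_)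
    simp only
    ring
  · rw [hΨ, integral_norm_sq_planeSeries hF hF1 hu0, hu1]

theorem summable_of_eigenvector {p : ℝ} (hp : 2 * (d : ℝ) + 2 ≤ p)
    (hsum : Summable fun γ : dualLattice Ω => (1 + ‖(γ : Space d)‖) ^ p * ‖potCoeff F q γ‖)
    {u : dualLattice Ω → ℂ} {Λ : ℝ} (hu1 : ∀ γ, ‖u γ‖ ≤ 1)
    (heq : ∀ γ : dualLattice Ω, ((Λ - ‖(γ : Space d) + t‖ ^ 2 : ℝ) : ℂ) * u γ
      = ∑' γ' : dualLattice Ω, potCoeff F q ((γ - γ' : dualLattice Ω) : Space d) * u γ') :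
    Summable fun γ : dualLattice Ω => (1 + ‖(γ : Space d) + t‖ ^ 2) * ‖u γ‖ := by
  obtain ⟨C, hC0, hC⟩ := exists_decay_of_eigenvector hsum hu1 heq (d + 2) (by push_cast; linarith)
  have hs := (summable_norm_rpow_dualLattice Ω (r := -((2 * d + 2 : ℕ) : ℝ)) (by
    push_cast; linarith [(Nat.cast_nonneg d : (0 : ℝ) ≤ d)])).mul_left ((1 + ‖t‖) ^ 2 * C)
  refine Summable.of_norm_bounded_eventually hs ?_
  rw [Filter.eventually_cofinite]
  refine (Set.finite_singleton (0 : dualLattice Ω)).subset fun γ hγ => ?_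
  simp only [Set.mem_ofPred_eq, Set.mem_singleton_iff] at hγ ⊢
  by_contra h0
  refine hγ ?_
  have hγ0 : (γ : Space d) ≠ 0 := fun h => h0 (Subtype.ext h)
  set n := ‖(γ : Space d)‖ with hn
  have hn0 : 0 < n := norm_pos_iff.2 hγ0
  have ht0 := norm_nonneg t
  rw [Real.norm_of_nonneg (by positivity), Real.rpow_neg hn0.le, Real.rpow_natCast,
    ← div_eq_mul_inv, le_div_iff₀ (by positivity)]
  have h1 : 1 + ‖(γ : Space d) + t‖ ^ 2 ≤ ((1 + ‖t‖) * (1 + n)) ^ 2 := by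
    have h2 := norm_add_le (γ : Space d) t
    have h3 : 1 + ‖(γ : Space d) + t‖ ^ 2 ≤ (1 + ‖(γ : Space d) + t‖) ^ 2 := by
      nlinarith [norm_nonneg ((γ : Space d) + t)]
    refine h3.trans ?_
    gcongr
    nlinarith
  calc (1 + ‖(γ : Space d) + t‖ ^ 2) * ‖u γ‖ * n ^ (2 * d + 2)
      ≤ ((1 + ‖t‖) * (1 + n)) ^ 2 * ‖u γ‖ * (1 + n) ^ (2 * d + 2) := by
        gcongr
        linarith
    _ = (1 + ‖t‖) ^ 2 * ((1 + n) ^ (2 * (d + 2)) * ‖u γ‖) := by ring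
    _ ≤ _ := by
        gcongr
        exact hC γ

end Construction

/-! ### The exponents -/

section Exponents

theorem kap_ge (hd : 2 ≤ d) : 13 ≤ kap d := by
  have h1 : (2 : ℝ) ≤ d := by exact_mod_cast hd
  have h2 : (3 : ℝ) ^ 2 ≤ 3 ^ d := pow_le_pow_right₀ (by norm_num) hd
  rw [kap]
  linarith

theorem alph_pos (hd : 2 ≤ d) : 0 < alph d := by
  have := kap_ge hd
  rw [alph]
  positivity

theorem alphOne_pos (hd : 2 ≤ d) : 0 < alphOne d := by
  have := alph_pos hd
  rw [alphOne]
  positivity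

theorem alphOne_le_one (hd : 2 ≤ d) : alphOne d ≤ 1 := by
  have := kap_ge hd
  rw [alphOne, alph, mul_one_div, div_le_one (by linarith)]
  linarith

/-- The smoothness leaves room for the loss `c = ϰ (d - 1) / 2` and for the decay of the
coefficients that an eigenfunction needs. -/
theorem sZero_sub_ge (hd : 2 ≤ d) :
    kap d * (d - 1) / 2 + 2 * (d : ℝ) + 6 ≤ sZero d - d := by
  have h1 : (2 : ℝ) ≤ d := by exact_mod_cast hd
  have h3 : (0 : ℝ) < 3 ^ d := by positivity
  rw [sZero, kap]
  have : 0 ≤ (d : ℝ) * 3 ^ d := by positivity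
  nlinarith

theorem half_le_norm_of_mem_nonResonanceDomain {Ω : Submodule ℤ (Space d)} {ρ p : ℝ} {x : Space d}
    (hx : x ∈ nonResonanceDomain Ω ρ p) : ρ / 2 ≤ ‖x‖ ∧ ‖x‖ < 3 / 2 * ρ := by
  have h1 := hx.1
  simp only [shell, Set.mem_sdiff, Metric.mem_ball, dist_zero_right, not_lt] at h1
  exact ⟨by linarith [h1.2], h1.1⟩

theorem le_rpow_alphOne (hd : 2 ≤ d) {A ρ : ℝ} (hA : 0 ≤ A) (hρ : A ^ (1 / alphOne d) ≤ ρ) :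
    A ≤ ρ ^ alphOne d := by
  have h1 := alphOne_pos hd
  calc A = (A ^ (1 / alphOne d)) ^ alphOne d := by
        rw [← Real.rpow_mul hA, one_div, inv_mul_cancel₀ h1.ne', Real.rpow_one]
    _ ≤ ρ ^ alphOne d := Real.rpow_le_rpow (by positivity) hρ h1.le

theorem rpow_neg_le_of_mem_nonResonanceDomain {Ω : Submodule ℤ (Space d)} {ρ p : ℝ} {x : Space d}
    (hd : 2 ≤ d) (hρ : 0 < ρ) (hx : x ∈ nonResonanceDomain Ω ρ p) (k : ℕ) :
    (ρ ^ (-alphOne d)) ^ k ≤ (3 / 2) ^ k * ‖x‖ ^ (-(k * alphOne d)) := by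
  obtain ⟨h1, h2⟩ := half_le_norm_of_mem_nonResonanceDomain hx
  have hx0 : 0 < ‖x‖ := by linarith
  have ha := alphOne_pos hd
  have e : ‖x‖ ^ (-(k * alphOne d)) = (‖x‖ ^ (-alphOne d)) ^ k := by
    rw [← Real.rpow_natCast, ← Real.rpow_mul hx0.le]
    ring_nf
  rw [e, ← mul_pow]
  refine pow_le_pow_left₀ (by positivity) ?_ k
  have h3 : (3 / 2 * ρ) ^ (-alphOne d) ≤ ‖x‖ ^ (-alphOne d) :=
    Real.rpow_le_rpow_of_nonpos hx0 h2.le (by linarith)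
  rw [Real.mul_rpow (by norm_num) hρ.le, Real.rpow_neg (by norm_num : (0 : ℝ) ≤ 3 / 2)] at h3
  have h4 : (3 / 2 : ℝ) ^ alphOne d ≤ 3 / 2 := by
    calc (3 / 2 : ℝ) ^ alphOne d ≤ (3 / 2 : ℝ) ^ (1 : ℝ) :=
          Real.rpow_le_rpow_of_exponent_le (by norm_num) (alphOne_le_one hd)
      _ = 3 / 2 := Real.rpow_one _
  have h5 : 0 < (3 / 2 : ℝ) ^ alphOne d := by positivity
  rw [inv_mul_le_iff₀ h5] at h3
  refine h3.trans ?_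
  gcongr

/-- Division of a small error by a coefficient that may be as small as `ρ^{-ca}`: the truncation
error `ρ^{-pa}` and the last term `θ^m` of the iteration both absorb the loss and still leave
`θ^K`, because `3 K ≤ p - c` and `c ≤ 3 (m - K)`. -/
theorem le_of_mul_rpow_neg_le {a c p ρ θ r M A X c₅ : ℝ} {m K : ℕ} (ha : 0 < a) (hρ : 1 ≤ ρ)
    (hr : r = ρ ^ (-(3 * a))) (hM : 1 ≤ M) (hθ : θ = 2 * M * r) (hA : 0 ≤ A) (hc5 : 0 < c₅)
    (hK : 3 * (K : ℝ) ≤ p - c) (hKm : K ≤ m) (hc : c ≤ 3 * ((m : ℝ) - K))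
    (h : X * (c₅ * ρ ^ (-(c * a))) ≤ (2 * m + 1) * (A * (ρ ^ a) ^ (-p)) + θ ^ m * M) :
    X ≤ ((2 * m + 1) * A + (2 * M) ^ m * M) / c₅ * θ ^ K := by
  have hρ0 : 0 < ρ := by linarith
  have hr0 : 0 < r := by rw [hr]; positivity
  have hθ0 : 0 < θ := by rw [hθ]; positivity
  have hrθ : r ≤ θ := by rw [hθ]; exact le_mul_of_one_le_left hr0.le (by linarith)
  have hcpos : 0 < ρ ^ (c * a) := by positivity
  have h1 : X * c₅ ≤ ((2 * m + 1) * (A * (ρ ^ a) ^ (-p)) + θ ^ m * M) * ρ ^ (c * a) := by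
    rw [Real.rpow_neg hρ0.le, ← mul_assoc, ← div_eq_mul_inv, div_le_iff₀ hcpos] at h
    exact h
  have h2 : (ρ ^ a) ^ (-p) * ρ ^ (c * a) ≤ θ ^ K := by
    refine le_trans ?_ (pow_le_pow_left₀ hr0.le hrθ K)
    rw [hr, ← Real.rpow_natCast, ← Real.rpow_mul hρ0.le, ← Real.rpow_mul hρ0.le,
      ← Real.rpow_add hρ0]
    refine Real.rpow_le_rpow_of_exponent_le hρ ?_
    have := mul_le_mul_of_nonneg_right hK ha.le
    linarith
  have h3 : r ^ (m - K) * ρ ^ (c * a) ≤ 1 := by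
    rw [hr, ← Real.rpow_natCast, ← Real.rpow_mul hρ0.le, ← Real.rpow_add hρ0, Nat.cast_sub hKm]
    refine Real.rpow_le_one_of_one_le_of_nonpos hρ ?_
    have := mul_le_mul_of_nonneg_right hc ha.le
    linarith
  have h4 : θ ^ (m - K) * ρ ^ (c * a) ≤ (2 * M) ^ m := by
    calc θ ^ (m - K) * ρ ^ (c * a)
        = (2 * M) ^ (m - K) * (r ^ (m - K) * ρ ^ (c * a)) := by rw [hθ, mul_pow]; ring
      _ ≤ (2 * M) ^ (m - K) * 1 := by gcongr
      _ = (2 * M) ^ (m - K) := mul_one _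
      _ ≤ (2 * M) ^ m := pow_le_pow_right₀ (by linarith) (Nat.sub_le _ _)
  have h5 : θ ^ m * ρ ^ (c * a) ≤ (2 * M) ^ m * θ ^ K := by
    calc θ ^ m * ρ ^ (c * a) = (θ ^ (m - K) * ρ ^ (c * a)) * θ ^ K := by
          rw [← pow_sub_mul_pow θ hKm]; ring
      _ ≤ _ := by gcongr
  rw [div_mul_eq_mul_div, le_div_iff₀ hc5]
  calc X * c₅ ≤ (2 * m + 1) * A * ((ρ ^ a) ^ (-p) * ρ ^ (c * a))
        + (θ ^ m * ρ ^ (c * a)) * M := by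
        refine h1.trans (le_of_eq ?_)
        ring
    _ ≤ (2 * m + 1) * A * θ ^ K + ((2 * M) ^ m * θ ^ K) * M := by gcongr
    _ = _ := by ring

end Exponents

/-! ### Asymptotics of eigenvalues whose eigenfunctions have a large Fourier coefficient -/

section Asymptotics

variable {Ω : Submodule ℤ (Space d)} [DiscreteTopology Ω] [IsZLattice ℝ Ω] {F : Set (Space d)}
  {q : Space d → ℝ} {s p : ℝ}

theorem potCoeff_zero (hq0 : ∫ x in F, q x = 0) : potCoeff F q 0 = 0 := by
  have h : ∫ x in F, (q x : ℂ) = ((∫ x in F, q x : ℝ) : ℂ) := integral_ofReal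
  simp [potCoeff, planeCoeff, planeWave_zero, h, hq0]

/-- The error made by truncating the convolution in the binding formula to frequencies of length
less than `R` is `O(R^{-p})`. -/
theorem norm_tsum_sub_sum_le (hq : IsSobolevPotential Ω F s q) (hd : 0 < d) (hp : p = s - d)
    (hp0 : 0 ≤ p) (hq0 : potCoeff F q 0 = 0) {R : ℝ} (hR : 0 < R) {β : Space d → ℂ}
    (hβ : ∀ v, ‖β v‖ ≤ 1) :
    ‖∑' γ : dualLattice Ω, potCoeff F q γ * β γ - ∑ γ ∈ dualBallFinset Ω R, potCoeff F q γ * β γ‖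
      ≤ (∑' γ : dualLattice Ω, (1 + ‖(γ : Space d)‖) ^ p * ‖potCoeff F q γ‖) * R ^ (-p) := by
  classical
  have hsum := hq.summable_norm hd hp hp0
  have hs : Summable fun γ : dualLattice Ω => potCoeff F q γ * β γ :=
    Summable.of_norm_bounded hsum fun γ => by
      rw [norm_mul]
      exact mul_le_of_le_one_right (norm_nonneg _) (hβ _)
  set B : Finset (dualLattice Ω) := (dualBallFinset Ω R).subtype (· ∈ dualLattice Ω) with hB
  have h1 : ∑ γ ∈ dualBallFinset Ω R, potCoeff F q γ * β γ
      = ∑ γ ∈ B, potCoeff F q (γ : Space d) * β γ := by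
    rw [Finset.sum_subtype_of_mem (fun γ => potCoeff F q γ * β γ)]
    exact fun γ hγ => ((mem_dualBallFinset Ω).1 hγ).1
  have h2 : ∑ γ ∈ B, potCoeff F q (γ : Space d) * β γ
      = ∑' γ : dualLattice Ω, if γ ∈ B then potCoeff F q (γ : Space d) * β γ else 0 := by
    rw [tsum_eq_sum (s := B) fun γ hγ => if_neg hγ]
    exact Finset.sum_congr rfl fun γ hγ => (if_pos hγ).symm
  have hs2 : Summable fun γ : dualLattice Ω =>
      if γ ∈ B then potCoeff F q (γ : Space d) * β γ else 0 :=
    summable_of_ne_finset_zero (s := B) fun γ hγ => if_neg hγ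
  rw [h1, h2, ← hs.tsum_sub hs2]
  refine le_trans ?_ (hq.tsum_tail_le hd hp hp0 hR (fun γ => R ≤ ‖(γ : Space d)‖) fun γ h => h)
  refine tsum_of_norm_bounded (Summable.hasSum ?_) fun γ => ?_
  · refine Summable.of_nonneg_of_le (fun γ => by split_ifs <;> positivity) (fun γ => ?_) hsum
    split_ifs
    · exact le_rfl
    · positivity
  · by_cases hγ : γ ∈ B
    · rw [if_pos hγ, sub_self, norm_zero]
      split_ifs <;> positivity
    · rw [if_neg hγ, sub_zero, norm_mul]
      by_cases h0 : (γ : Space d) = 0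
      · rw [h0, hq0, norm_zero, zero_mul]
        split_ifs <;> simp
      · have hge : R ≤ ‖(γ : Space d)‖ := by
          by_contra! hlt
          exact hγ (Finset.mem_subtype.2 ((mem_dualBallFinset Ω).2
            ⟨γ.2, norm_pos_iff.2 h0, hlt⟩))
        rw [if_pos hge]
        exact mul_le_of_le_one_right (norm_nonneg _) (hβ _)

theorem norm_potCoeff_le_tail (hq : IsSobolevPotential Ω F s q) (hd : 0 < d) (hp : p = s - d)
    (hp0 : 0 ≤ p) {R : ℝ} (hR : 0 < R) {γ : Space d} (hγ : γ ∈ dualLattice Ω) (hγR : R ≤ ‖γ‖) :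
    ‖potCoeff F q γ‖
      ≤ (∑' γ : dualLattice Ω, (1 + ‖(γ : Space d)‖) ^ p * ‖potCoeff F q γ‖) * R ^ (-p) := by
  classical
  have h := (hq.summable_rpow hd hp hp0).le_tsum ⟨γ, hγ⟩ fun _ _ => by positivity
  have h1 : R ^ p ≤ (1 + ‖γ‖) ^ p := Real.rpow_le_rpow hR.le (by linarith) hp0
  rw [Real.rpow_neg hR.le, ← div_eq_mul_inv, le_div_iff₀ (Real.rpow_pos_of_pos hR _), mul_comm]
  exact (mul_le_mul_of_nonneg_right h1 (norm_nonneg _)).trans h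

/-- An eigenvalue near `|x|²` whose eigenfunction has a non-zero coefficient at `x` solves
`Λ = |x|² + ∑ S_j(Λ, x)` up to a small error. -/
theorem norm_eigenvalue_sub_sum_iterSum_le (hF : IsAddFundamentalDomain Ω F volume)
    (hF1 : volume F = 1) (hd : 0 < d) (hq : IsSobolevPotential Ω F s q) (hp : p = s - d)
    (hp0 : 0 ≤ p) (hq0 : potCoeff F q 0 = 0) {ρ : ℝ} (hρ : 0 < ρ) {t γ : Space d}
    (hγ : γ ∈ dualLattice Ω) (hx : γ + t ∈ nonResonanceDomain Ω ρ p) {Λ : ℝ} {Ψ : Space d → ℂ}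
    (hΨ : IsBlochEigenfunction Ω F q t Λ Ψ) {δ M : ℝ} (hδ : δ = 1 / 2 * ρ ^ alphOne d)
    (hM : ∑ γ ∈ dualBallFinset Ω (ρ ^ alph d), ‖potCoeff F q γ‖ ≤ M) (hMδ : M ≤ δ)
    (hΛ : |Λ - ‖γ + t‖ ^ 2| ≤ δ) {m : ℕ} (hm : (m : ℝ) ≤ p) :
    ‖(Λ : ℂ) - ((‖γ + t‖ ^ 2 : ℝ) : ℂ)
        - ∑ j ∈ Finset.Icc 1 m, iterSum Ω F q ρ j Λ (γ + t)‖ * ‖planeCoeff F Ψ (γ + t)‖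
      ≤ (2 * m + 1) * ((∑' γ : dualLattice Ω, (1 + ‖(γ : Space d)‖) ^ p * ‖potCoeff F q γ‖)
          * (ρ ^ alph d) ^ (-p)) + (M / δ) ^ m * M := by
  classical
  have hR : 0 < ρ ^ alph d := Real.rpow_pos_of_pos hρ _
  have hδ0 : 0 < δ := by rw [hδ]; positivity
  set ε := (∑' γ : dualLattice Ω, (1 + ‖(γ : Space d)‖) ^ p * ‖potCoeff F q γ‖)
          * (ρ ^ alph d) ^ (-p) with hε
  have hε0 : 0 ≤ ε := mul_nonneg (tsum_nonneg fun _ => by positivity) (by positivity)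
  set x := γ + t with hxdef
  set B := dualBallFinset Ω (ρ ^ alph d) with hB
  let D : Space d → ℂ := fun τ => (Λ : ℂ) - ((‖x - τ‖ ^ 2 : ℝ) : ℂ)
  let β : Space d → ℂ := fun τ => planeCoeff F Ψ (x - τ)
  let e : Space d → ℂ := fun τ => D τ * β τ - ∑ γ' ∈ B, potCoeff F q γ' * β (τ + γ')
  have hΛ' : ‖(Λ : ℂ) - ((‖x‖ ^ 2 : ℝ) : ℂ)‖ ≤ δ := by
    rw [← Complex.ofReal_sub, Complex.norm_real]
    exact hΛ
  have hβ1 : ∀ σ, ‖β σ‖ ≤ 1 := fun σ => hΨ.norm_planeCoeff_le hF1 _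
  have hB0 : (0 : Space d) ∉ B := fun h => by
    simpa using ((mem_dualBallFinset Ω).1 h).2.1
  have hS := stepRegion_step Ω hρ hx (a := (Λ : ℂ)) (hδ ▸ hΛ')
  rw [← hδ] at hS
  have key := norm_sub_sum_pathStep_le (B := B) (w := potCoeff F q)
    (S := stepRegion Ω p (ρ ^ alph d)) (D := D) (β := β) (e := e) (ε := ε) hδ0 hM hMδ hB0 hS
    (antitone_stepRegion Ω hR.le) (fun σ _ => by simp only [e]; ring) hβ1
    (fun σ hσ => by
      have hb := hΨ.binding hF hF1 hq.periodic hq.memLp (hq.summable_norm hd hp hp0)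
        (γ := γ - σ) (sub_mem hγ hσ.1)
      have e1 : γ - σ + t = x - σ := by rw [hxdef]; abel
      rw [e1] at hb
      have h2 := norm_tsum_sub_sum_le hq hd hp hp0 hq0 hR
        (β := fun γ' => planeCoeff F Ψ (x - σ - γ')) fun v => hΨ.norm_planeCoeff_le hF1 _
      rw [← hb] at h2
      simpa only [e, D, β, ← sub_sub] using h2)
    (fun σ hσ hσB => by
      by_cases h0 : σ = 0
      · rw [h0, neg_zero, hq0, norm_zero]; exact hε0
      · refine norm_potCoeff_le_tail hq hd hp hp0 hR (neg_mem hσ.1) ?_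
        by_contra! hlt
        exact hσB ((mem_dualBallFinset Ω).2 ⟨neg_mem hσ.1, by simpa using h0, hlt⟩))
    (zero_mem_stepRegion Ω hR.le hm)
  rw [← norm_mul]
  refine le_trans (le_of_eq ?_) key
  congr 1
  simp only [iterSum_eq_pathStep_iterate, D, β, sub_zero]
  ring

/-- The constant bounding the Fourier coefficients of `q` and their partial sums. -/
theorem exists_bound_potCoeff (hq : IsSobolevPotential Ω F s q) (hd : 0 < d) (hp : p = s - d)
    (hp0 : 0 ≤ p) : ∃ M : ℝ, 1 ≤ M ∧ ∑' γ : dualLattice Ω, ‖potCoeff F q γ‖ ≤ M ∧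
      (∀ R, ∑ γ ∈ dualBallFinset Ω R, ‖potCoeff F q γ‖ ≤ M) ∧
      ∀ γ ∈ dualLattice Ω, ‖potCoeff F q γ‖ ≤ M := by
  have hsum := hq.summable_norm hd hp hp0
  refine ⟨1 + ∑' γ : dualLattice Ω, ‖potCoeff F q γ‖, ?_, ?_, fun R => ?_, fun γ hγ => ?_⟩
  · have h : 0 ≤ ∑' γ : dualLattice Ω, ‖potCoeff F q γ‖ := tsum_nonneg fun _ => norm_nonneg _
    linarith
  · linarith
  · have := sum_norm_potCoeff_le_tsum hsum (dualBallFinset Ω R)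
      fun γ hγ => ((mem_dualBallFinset Ω).1 hγ).1
    linarith
  · have := hsum.le_tsum ⟨γ, hγ⟩ fun _ _ => norm_nonneg _
    linarith

theorem exists_norm_correction_le (hd : 2 ≤ d) (hq : IsSobolevPotential Ω F s q) (hp : p = s - d)
    (hp0 : 0 ≤ p) : ∃ C ρ₀ : ℝ, 0 < C ∧ 0 < ρ₀ ∧ ∀ ρ : ℝ, ρ₀ ≤ ρ →
      ∀ x ∈ nonResonanceDomain Ω ρ p, ∀ k : ℕ, (k : ℝ) ≤ p →
        ‖correction Ω F q ρ k x‖ ≤ C * ρ ^ (-alphOne d) := by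
  obtain ⟨M, hM1, -, hMR, hMγ⟩ := exists_bound_potCoeff hq (by omega) hp hp0
  refine ⟨4 * M ^ 2, (4 * M) ^ (1 / alphOne d), by positivity, by positivity,
    fun ρ hρ x hx k hk => ?_⟩
  have hρ0 : 0 < ρ := lt_of_lt_of_le (by positivity) hρ
  have h4 := le_rpow_alphOne hd (by positivity) hρ
  have hpos : 0 < ρ ^ alphOne d := by positivity
  refine (norm_correction_le hρ0 hx rfl (hMR _) hMγ ?_ hk).trans (le_of_eq ?_)
  · rw [div_le_iff₀ (by positivity)]
    linarith
  · rw [Real.rpow_neg hρ0.le]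
    field_simp
    ring

/-- An eigenvalue near `|γ + t|²` whose eigenfunction has a coefficient at `γ + t` of size at least
`c₅ ρ^{-cα}` is given by the corrections. -/
theorem exists_eigenvalue_asymptotics (hF : IsAddFundamentalDomain Ω F volume)
    (hF1 : volume F = 1) (hd : 2 ≤ d) (hq : IsSobolevPotential Ω F s q) (hp : p = s - d)
    (hp3 : 3 ≤ p) (hq0 : potCoeff F q 0 = 0) {c c₅ : ℝ} (hc0 : 0 ≤ c) (hc5 : 0 < c₅) :
    ∃ C ρ₀ : ℝ, 0 < C ∧ 0 < ρ₀ ∧ ∀ ρ : ℝ, ρ₀ ≤ ρ →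
      ∀ t : Space d, ∀ γ ∈ dualLattice Ω, γ + t ∈ nonResonanceDomain Ω ρ p →
      ∀ (Λ : ℝ) (Ψ : Space d → ℂ), IsBlochEigenfunction Ω F q t Λ Ψ →
        |Λ - ‖γ + t‖ ^ 2| < 1 / 2 * ρ ^ alphOne d →
        c₅ * ρ ^ (-(c * alph d)) < ‖planeCoeff F Ψ (γ + t)‖ →
      ∀ k : ℕ, 1 ≤ k → (k : ℤ) ≤ ⌊(p - c) / 3⌋ →
        ‖(Λ : ℂ) - (((‖γ + t‖ ^ 2 : ℝ) : ℂ) + correction Ω F q ρ (k - 1) (γ + t))‖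
          ≤ C * ‖γ + t‖ ^ (-(k * alphOne d)) := by
  have hp0 : 0 ≤ p := by linarith
  have hd0 : 0 < d := by omega
  obtain ⟨M, hM1, -, hMR, hMγ⟩ := exists_bound_potCoeff hq hd0 hp hp0
  set A := ∑' γ : dualLattice Ω, (1 + ‖(γ : Space d)‖) ^ p * ‖potCoeff F q γ‖ with hA
  have hA0 : 0 ≤ A := tsum_nonneg fun _ => by positivity
  set m : ℕ := ⌊p⌋₊ with hm
  set K : ℕ := ⌊(p - c) / 3⌋.toNat with hK
  have hmp : (m : ℝ) ≤ p := Nat.floor_le hp0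
  have hpm : p < m + 1 := Nat.lt_floor_add_one p
  set E : ℝ := ((2 * m + 1) * A + (2 * M) ^ m * M) / c₅ with hE
  have hE0 : 0 ≤ E := by positivity
  have hm0 : (0 : ℝ) ≤ m := Nat.cast_nonneg m
  set b : ℝ := 3 / 2 * ((1 + (m : ℝ) ^ 2) * (2 * M)) with hb
  have hb1 : 1 ≤ b := by
    have h1 : 1 ≤ 1 + (m : ℝ) ^ 2 := by nlinarith
    have h2 : 1 ≤ (1 + (m : ℝ) ^ 2) * (2 * M) := one_le_mul_of_one_le_of_one_le h1 (by linarith)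
    rw [hb]; linarith
  refine ⟨(E + 2 * M) * b ^ m, (4 * M) ^ (1 / alphOne d), by positivity, by positivity,
    fun ρ hρ t γ hγ hx Λ Ψ hΨ hΛ hcoeff k hk1 hk => ?_⟩
  have hα := alph_pos hd
  have hα1 := alphOne_pos hd
  have hρ1 : 1 ≤ ρ := le_trans (Real.one_le_rpow (by linarith) (by positivity)) hρ
  have hρ0 : 0 < ρ := by linarith
  have h4 := le_rpow_alphOne hd (by positivity) hρ
  have hpos : 0 < ρ ^ alphOne d := by positivity
  set δ : ℝ := 1 / 2 * ρ ^ alphOne d with hδ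
  have hδ0 : 0 < δ := by positivity
  set θ := M / δ with hθdef
  have hθ : θ ≤ 1 / 2 := by
    rw [hθdef, div_le_iff₀ hδ0, hδ]
    linarith
  have hθ0 : 0 < θ := by positivity
  set r := ρ ^ (-alphOne d) with hr
  have hr0 : 0 < r := by positivity
  have hθr : θ = 2 * M * r := by
    rw [hθdef, hδ, hr, Real.rpow_neg hρ0.le]
    field_simp
  -- `k ≤ K ≤ m`, and `3 K ≤ p - c`.
  have hfloor : (⌊(p - c) / 3⌋ : ℤ) = (K : ℤ) := by
    rw [hK, Int.toNat_of_nonneg]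
    have : (1 : ℤ) ≤ k := by exact_mod_cast hk1
    linarith
  have hkK : k ≤ K := by rw [hfloor] at hk; exact_mod_cast hk
  have h3K : 3 * (K : ℝ) ≤ p - c := by
    have h1 := Int.floor_le ((p - c) / 3)
    rw [hfloor] at h1
    push_cast at h1
    linarith
  have hKm : K ≤ m := by
    rw [hm]
    refine Nat.le_floor ?_
    have : (0 : ℝ) ≤ K := Nat.cast_nonneg K
    linarith
  have hmain := norm_eigenvalue_sub_sum_iterSum_le hF hF1 hd0 hq hp hp0 hq0 hρ0 hγ hx hΨ
    hδ (hMR _) (by rw [hδ]; linarith) hΛ.le hmp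
  rw [← hθdef, ← hA] at hmain
  have hEb : ‖(Λ : ℂ) - ((‖γ + t‖ ^ 2 : ℝ) : ℂ)
      - ∑ j ∈ Finset.Icc 1 m, iterSum Ω F q ρ j Λ (γ + t)‖ ≤ E * θ ^ K := by
    refine le_of_mul_rpow_neg_le hα hρ1 hr hM1 hθr hA0 hc5 h3K hKm ?_
      ((mul_le_mul_of_nonneg_left hcoeff.le (norm_nonneg _)).trans hmain)
    linarith
  have hΛ' : ‖(Λ : ℂ) - ((‖γ + t‖ ^ 2 : ℝ) : ℂ)‖ ≤ δ := by
    rw [← Complex.ofReal_sub, Complex.norm_real]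
    exact hΛ.le
  refine (norm_sub_correction_le hρ0 hx hδ (hMR _) hMγ hθ hmp hKm hE0 hΛ' hEb hk1 hkK).trans ?_
  have hconv := rpow_neg_le_of_mem_nonResonanceDomain hd hρ0 hx k
  have hx0 : 0 ≤ ‖γ + t‖ ^ (-(k * alphOne d)) := by positivity
  rw [← hθdef, hθr, mul_pow]
  calc (E + 2 * M) * (1 + (m : ℝ) ^ 2) ^ k * ((2 * M) ^ k * r ^ k)
      ≤ (E + 2 * M) * (1 + (m : ℝ) ^ 2) ^ k * ((2 * M) ^ k
        * ((3 / 2) ^ k * ‖γ + t‖ ^ (-(k * alphOne d)))) := by gcongr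
    _ = (E + 2 * M) * b ^ k * ‖γ + t‖ ^ (-(k * alphOne d)) := by
        rw [hb, mul_pow (3 / 2), mul_pow (1 + (m : ℝ) ^ 2)]
        ring
    _ ≤ (E + 2 * M) * b ^ m * ‖γ + t‖ ^ (-(k * alphOne d)) := by
        have := pow_le_pow_right₀ hb1 (hkK.trans hKm)
        gcongr

/-! ### Existence of an eigenfunction with a large Fourier coefficient -/

/-- The exponent `(d - 1) / 2` is half of the growth exponent of the number of lattice points in the
shell of radius `|γ + t|`. -/
theorem exists_eigenfunction_large_coeff (hF : IsAddFundamentalDomain Ω F volume)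
    (hF1 : volume F = 1) (hd : 2 ≤ d) (hq : IsSobolevPotential Ω F s q) (hp : p = s - d)
    (hpd : 2 * (d : ℝ) + 2 ≤ p) :
    ∃ c₅ ρ₀ : ℝ, 0 < c₅ ∧ 0 < ρ₀ ∧ ∀ ρ : ℝ, ρ₀ ≤ ρ → ∀ t : Space d, ∀ γ ∈ dualLattice Ω,
      γ + t ∈ nonResonanceDomain Ω ρ p → ∃ (Λ : ℝ) (Ψ : Space d → ℂ),
        IsBlochEigenfunction Ω F q t Λ Ψ ∧ |Λ - ‖γ + t‖ ^ 2| < 1 / 2 * ρ ^ alphOne d ∧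
        c₅ * ρ ^ (-((d - 1 : ℝ) / 2)) < ‖planeCoeff F Ψ (γ + t)‖ := by
  classical
  have hp0 : 0 ≤ p := by linarith [(Nat.cast_nonneg d : (0 : ℝ) ≤ d)]
  have hd0 : 0 < d := by omega
  obtain ⟨M, hM1, hMt, -, -⟩ := exists_bound_potCoeff hq hd0 hp hp0
  obtain ⟨C₀, hC0, hcard⟩ := exists_card_shell_le Ω
  set c₅ : ℝ := √(3 / (8 * (C₀ * (3 / 2) ^ (d - 1)))) / 2 with hc5
  have hc50 : 0 < c₅ := by positivity
  refine ⟨c₅, max 4 ((8 * M) ^ (1 / alphOne d)), hc50, by positivity, fun ρ hρ t γ hγ hx => ?_⟩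
  have hρ4 : 4 ≤ ρ := (le_max_left _ _).trans hρ
  have hρ0 : 0 < ρ := by linarith
  have h8 := le_rpow_alphOne hd (by positivity) ((le_max_right _ _).trans hρ)
  have hpos : 0 < ρ ^ alphOne d := by positivity
  have hρα : ρ ^ alphOne d ≤ ρ := by
    calc ρ ^ alphOne d ≤ ρ ^ (1 : ℝ) :=
          Real.rpow_le_rpow_of_exponent_le (by linarith) (alphOne_le_one hd)
      _ = ρ := Real.rpow_one ρ
  obtain ⟨hx1, hx2⟩ := half_le_norm_of_mem_nonResonanceDomain hx
  have hx0 : 0 < ‖γ + t‖ := by linarith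
  -- The spectral window `O(ρ^{α₁})` for `|k + t|²` is a shell of thickness at most `2`.
  have hN : ∀ T : Finset (dualLattice Ω), (∀ k ∈ T, |‖(k : Space d) + t‖ ^ 2 - ‖γ + t‖ ^ 2|
      ≤ 1 / 4 * ρ ^ alphOne d + 2 * M) → (T.card : ℝ) ≤ C₀ * ‖γ + t‖ ^ (d - 1) := by
    intro T hT
    have h1 := hcard ‖γ + t‖ (by linarith) t (T.map (Function.Embedding.subtype _)) (fun k hk => by
      rw [Finset.mem_map] at hk
      obtain ⟨k', hk', rfl⟩ := hk
      refine ⟨k'.2, ?_⟩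
      have h2 := hT k' hk'
      rw [sq_sub_sq, abs_mul, abs_of_nonneg (by positivity)] at h2
      have h3 : |‖(k' : Space d) + t‖ - ‖γ + t‖| * (ρ / 2) ≤ 1 * (ρ / 2) := by
        have h5 : ρ / 2 ≤ ‖(k' : Space d) + t‖ + ‖γ + t‖ := by
          linarith [norm_nonneg ((k' : Space d) + t)]
        have h6 := mul_le_mul_of_nonneg_right h5
          (abs_nonneg (‖(k' : Space d) + t‖ - ‖γ + t‖))
        linarith
      exact le_of_mul_le_mul_right h3 (by positivity))
    rwa [Finset.card_map] at h1
  obtain ⟨Λ, u, hΛ, hu1, hug, hueq⟩ := exists_eigenvector_convolution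
    (a := fun γ : dualLattice Ω => potCoeff F q γ) (hq.summable_norm hd0 hp hp0)
    (fun γ => by rw [AddSubgroup.coe_neg, potCoeff_neg]) hMt (by linarith)
    (fun k : dualLattice Ω => ‖(k : Space d) + t‖ ^ 2) (W := 1 / 4 * ρ ^ alphOne d)
    (N := C₀ * ‖γ + t‖ ^ (d - 1)) (by linarith) (by positivity) ⟨γ, hγ⟩ hN
  have hub : ∀ k, ‖u k‖ ≤ 1 := fun k => by
    have h1 := hu1.summable.le_tsum k fun _ _ => by positivity
    rw [hu1.tsum_eq] at h1
    exact (sq_le_one_iff₀ (norm_nonneg _)).1 h1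
  have hus := summable_of_eigenvector hpd (hq.summable_rpow hd0 hp hp0) hub hueq
  have hu0 : Summable fun γ => ‖u γ‖ :=
    Summable.of_nonneg_of_le (fun _ => norm_nonneg _)
      (fun γ => le_mul_of_one_le_left (norm_nonneg _) (by
        linarith [sq_nonneg ‖(γ : Space d) + t‖])) hus
  refine ⟨Λ, planeSeries u t, isBlochEigenfunction_planeSeries hF hF1 hq.periodic hq.memLp
    (hq.summable_norm hd0 hp hp0) hus hu1.tsum_eq hueq, ?_, ?_⟩
  · refine lt_of_le_of_lt hΛ ?_
    linarith
  · have h1 : planeCoeff F (planeSeries u t) (γ + t) = u ⟨γ, hγ⟩ :=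
      planeCoeff_planeSeries (t := t) hF hF1 hu0 ⟨γ, hγ⟩
    rw [h1]
    have h2 : (2 * c₅ * ρ ^ (-((d - 1 : ℝ) / 2))) ^ 2 ≤ ‖u ⟨γ, hγ⟩‖ ^ 2 := by
      refine le_trans ?_ hug
      have e1 : (ρ ^ (-((d - 1 : ℝ) / 2))) ^ 2 = (ρ ^ (d - 1))⁻¹ := by
        rw [← Real.rpow_natCast, ← Real.rpow_mul hρ0.le, ← Real.rpow_natCast, ← Real.rpow_neg hρ0.le,
          Nat.cast_sub (by omega)]
        push_cast
        ring_nf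
      have e2 : (2 * c₅) ^ 2 = 3 / (8 * (C₀ * (3 / 2) ^ (d - 1))) := by
        rw [hc5, mul_div_cancel₀ _ (two_ne_zero), Real.sq_sqrt (by positivity)]
      rw [mul_pow, e1, e2, ← div_eq_mul_inv, div_div]
      have h3 : ‖γ + t‖ ^ (d - 1) ≤ (3 / 2 * ρ) ^ (d - 1) := by gcongr
      rw [mul_pow] at h3
      refine div_le_div_of_nonneg_left (by norm_num) (by positivity) ?_
      calc 8 * (C₀ * ‖γ + t‖ ^ (d - 1)) ≤ 8 * (C₀ * ((3 / 2) ^ (d - 1) * ρ ^ (d - 1))) := by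
            gcongr
        _ = _ := by ring
    have h4 := (le_abs_self _).trans (abs_le_of_sq_le_sq h2 (norm_nonneg _))
    have h5 : 0 < c₅ * ρ ^ (-((d - 1 : ℝ) / 2)) := by positivity
    linarith

end Asymptotics

end PeriodicSchrodinger

theorem theorem2p1 (d : ℕ) (hd : 2 ≤ d)
    (Ω : Submodule ℤ (Space d)) [DiscreteTopology Ω] [IsZLattice ℝ Ω]
    (F : Set (Space d)) (hF : IsAddFundamentalDomain Ω F volume)
    (hF1 : volume F = 1)
    (s p : ℝ) (hs : sZero d ≤ s) (hp : p = s - d)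
    (q : Space d → ℝ)
    (hq : IsSobolevPotential Ω F s q) (hq0 : ∫ x in F, q x = 0) :
    -- the explicit form of the corrections
    ((∀ (ρ : ℝ) (x : Space d),
        correction Ω F q ρ 0 x = 0 ∧
        correction Ω F q ρ 1 x =
          ∑ γ ∈ dualBallFinset Ω (ρ ^ alph d),
            ((‖potCoeff F q γ‖ ^ 2 / (‖x‖ ^ 2 - ‖x - γ‖ ^ 2) : ℝ) : ℂ) ∧
        ∀ n : ℕ, 1 ≤ n → correction Ω F q ρ n x =
          ∑ k ∈ Finset.Icc 1 n, iterSum Ω F q ρ k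
            (((‖x‖ ^ 2 : ℝ) : ℂ) + correction Ω F q ρ (n - 1) x) x) ∧
    -- the size of the corrections, in the range in which the denominators are controlled
      (∃ C ρ₀ : ℝ, 0 < C ∧ 0 < ρ₀ ∧ ∀ ρ : ℝ, ρ₀ ≤ ρ →
        ∀ x ∈ nonResonanceDomain Ω ρ p, ∀ k : ℕ, (k : ℝ) ≤ p →
          ‖correction Ω F q ρ k x‖
            ≤ C * ρ ^ (-alphOne d)) ∧
    -- part (a)
      (∀ c c₅ : ℝ, 0 ≤ c → c < p - d * 3 ^ d / 4 → 0 < c₅ →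
        ∃ C ρ₀ : ℝ, 0 < C ∧ 0 < ρ₀ ∧ ∀ ρ : ℝ, ρ₀ ≤ ρ →
          ∀ t : Space d, ∀ γ ∈ dualLattice Ω,
            γ + t ∈ nonResonanceDomain Ω ρ p →
          ∀ (Λ : ℝ) (Ψ : Space d → ℂ),
            IsBlochEigenfunction Ω F q t Λ Ψ →
            |Λ - ‖γ + t‖ ^ 2| < 1 / 2 * ρ ^ alphOne d →
            c₅ * ρ ^ (-(c * alph d))
              < ‖planeCoeff F Ψ (γ + t)‖ →
          ∀ k : ℕ, 1 ≤ k → (k : ℤ) ≤ ⌊(p - c) / 3⌋ →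
            ‖(Λ : ℂ) - (((‖γ + t‖ ^ 2 : ℝ) : ℂ)
                + correction Ω F q ρ (k - 1) (γ + t))‖
              ≤ C * ‖γ + t‖ ^ (-(k * alphOne d)))) ∧
    -- part (b)
    (∃ C ρ₀ : ℝ, 0 < C ∧ 0 < ρ₀ ∧ ∀ ρ : ℝ, ρ₀ ≤ ρ →
      ∀ t : Space d, ∀ γ ∈ dualLattice Ω,
        γ + t ∈ nonResonanceDomain Ω ρ p →
      ∃ Λ : ℝ, IsBlochEigenvalue Ω F q t Λ ∧
        ∀ k : ℕ, 1 ≤ k → (k : ℤ) ≤ ⌊(p - kap d * (d - 1) / 2) / 3⌋ →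
          ‖(Λ : ℂ) - (((‖γ + t‖ ^ 2 : ℝ) : ℂ)
              + correction Ω F q ρ (k - 1) (γ + t))‖
            ≤ C * ‖γ + t‖ ^ (-(k * alphOne d))) := by
  have hd0 : 0 < d := by omega
  have hκ := sZero_sub_ge hd
  have hk13 := kap_ge hd
  have hdr : (2 : ℝ) ≤ d := by exact_mod_cast hd
  have hκd : 0 ≤ kap d * (d - 1) / 2 := by
    have : 0 ≤ kap d * ((d : ℝ) - 1) := mul_nonneg (by linarith) (by linarith)
    linarith
  have hpd : 2 * (d : ℝ) + 6 ≤ p := by linarith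
  have hq00 := potCoeff_zero hq0
  refine ⟨⟨fun ρ x => ⟨rfl, correction_one Ω F q ρ x, fun n hn => ?_⟩,
    exists_norm_correction_le hd hq hp (by linarith), fun c c₅ hc0 _ hc5 =>
      exists_eigenvalue_asymptotics hF hF1 hd hq hp (by linarith) hq00 hc0 hc5⟩, ?_⟩
  · obtain ⟨l, rfl⟩ : ∃ l, n = l + 1 := ⟨n - 1, by omega⟩
    rw [correction]
    rfl
  · obtain ⟨c₅, ρ₁, hc5, hρ1, hex⟩ :=
      exists_eigenfunction_large_coeff hF hF1 hd hq hp (by linarith)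
    obtain ⟨C, ρ₂, hC, hρ2, hasym⟩ :=
      exists_eigenvalue_asymptotics hF hF1 hd hq hp (by linarith) hq00 hκd hc5
    refine ⟨C, max ρ₁ ρ₂, hC, lt_max_of_lt_left hρ1, fun ρ hρ t γ hγ hx => ?_⟩
    obtain ⟨Λ, Ψ, hΨ, hΛ, hcoeff⟩ := hex ρ ((le_max_left _ _).trans hρ) t γ hγ hx
    refine ⟨Λ, ⟨Ψ, hΨ⟩, hasym ρ ((le_max_right _ _).trans hρ) t γ hγ hx Λ Ψ hΨ hΛ ?_⟩
    -- The coefficient bound `ρ^{-(d-1)/2}` is `ρ^{-cα}` for `c = ϰ (d - 1) / 2`.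
    have e : kap d * (d - 1) / 2 * alph d = ((d : ℝ) - 1) / 2 := by
      rw [alph]
      field_simp
    rwa [e]
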